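/- All registers are finite-dimensional complex Hilbert spaces, $\log=\log_2$, and $\mathrm{D}_=(A)$ denotes the set of density operators on $A$. For $\alpha\in(0,1)\cup(1,\infty)$ and positive semidefinite $\rho\neq 0,\sigma$ on the same register, the sandwiched and the Petz Rényi divergence are $$\widetilde D_\alpha(\rho\|\sigma)=\frac1{\alpha-1}\log\frac{\operatorname{Tr}\big[(\sigma^{\frac{1-\alpha}{2\alpha}}\rho\,\sigma^{\frac{1-\alpha}{2\alpha}})^\alpha\big]}{\operatorname{Tr}\rho},\qquad \bar D_\alpha(\rho\|\sigma)=\frac1{\alpha-1}\log\frac{\operatorname{Tr}[\rho^\alpha\sigma^{1-\alpha}]}{\operatorname{Tr}\rho}$$ if ($\alpha<1$ and $\rho\not\perp\sigma$) or $\operatorname{supp}\rho\subseteq\operatorname{supp}\sigma$, and $+\infty$ otherwise (negative powers are taken on the support). For $\alpha\in\{0,\infty\}$ they are defined as the limits in $\alpha$, and for $\alpha=1$ both are the relative entropy $D(\rho\|\sigma)$, which is $\operatorname{Tr}[\rho(\log\rho-\log\sigma)]/\operatorname{Tr}\rho$ if $\operatorname{supp}\rho\subseteq\operatorname{supp}\sigma$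 and $+\infty$ otherwise. For $\rho_{AB}\in\mathrm{D}_=(AB)$ put $$\bar H^\downarrow_\alpha(A|B)_\rho=-\bar D_\alpha(\rho_{AB}\|I_A\otimes\rho_B),\qquad \bar H^\uparrow_\alpha(A|B)_\rho=\sup_{\sigma_B\in\mathrm{D}_=(B)}-\bar D_\alpha(\rho_{AB}\|I_A\otimes\sigma_B),$$ $$\widetilde H^\downarrow_\alpha(A|B)_\rho=-\widetilde D_\alpha(\rho_{AB}\|I_A\otimes\rho_B),\qquad \widetilde H^\uparrow_\alpha(A|B)_\rho=\sup_{\sigma_B\in\mathrm{D}_=(B)}-\widetilde D_\alpha(\rho_{AB}\|I_A\otimes\sigma_B).$$ **Lemma.** Let $\mathcal M:Q\to SI$ be a completely positive trace-preserving map, let $V:Q\to SIR$ be any Stinespring dilation of it (an isometry with $\mathcal M(X)=\operatorname{Tr}_R[VXV^\dagger]$ for all $X$), and let $\mathcal N:Q\to SR$, $\mathcal N(X)=\operatorname{Tr}_I[VXV^\dagger]$. Let $\rho_{QE}\in\mathrm{D}_=(QE)$ be pure, and write $\mathcal M(\rho_{QE})=(\mathcal M\otimes\mathrm{id}_E)(\rho_{QE})$.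 Then, with $\tau_R$ ranging over $\mathrm{D}_=(R)$ and with $1/0=\infty$, $1/\infty=0$: 1. for all $\alpha\in[\frac12,\infty]$: $\displaystyle\widetilde H^\uparrow_\alpha(S|IE)_{\mathcal M(\rho_{QE})}=\inf_{\tau_R}\widetilde D_{\frac{\alpha}{2\alpha-1}}(\mathcal N(\rho_Q)\,\|\,I_S\otimes\tau_R)$, where $\frac{\alpha}{2\alpha-1}$ is $\infty$ at $\alpha=\frac12$ and $\frac12$ at $\alpha=\infty$; 2. for all $\alpha\in[0,\infty]$: $\displaystyle\widetilde H^\downarrow_\alpha(S|IE)_{\mathcal M(\rho_{QE})}=\inf_{\tau_R}\bar D_{\frac1\alpha}(\mathcal N(\rho_Q)\,\|\,I_S\otimes\tau_R)=\frac1{1-\alpha}\log\operatorname{Tr}\Big[\big(\operatorname{Tr}_S[\mathcal N(\rho_Q)^{\frac1\alpha}]\big)^\alpha\Big]$, where the last expression is understood as its limit (which exists) for $\alpha\in\{0,1,\infty\}$; 3. for all $\alpha\in[0,\infty]$: $\displaystyle\bar H^\uparrow_\alpha(S|IE)_{\mathcal M(\rho_{QE})}=\widetilde D_{\frac1\alpha}\big(\mathcal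 N(\rho_Q)\,\|\,I_S\otimes\operatorname{Tr}_S[\mathcal N(\rho_Q)]\big)$; 4. for all $\alpha\in[0,2]$: $\displaystyle\bar H^\downarrow_\alpha(S|IE)_{\mathcal M(\rho_{QE})}=\bar D_{2-\alpha}\big(\mathcal N(\rho_Q)\,\|\,I_S\otimes\operatorname{Tr}_S[\mathcal N(\rho_Q)]\big)$. Moreover, for the conditional von Neumann entropy $H(A|B)=H(AB)-H(B)$, $$H(S|IE)_{\mathcal M(\rho_{QE})}=\inf_{\tau_R}D(\mathcal N(\rho_Q)\,\|\,I_S\otimes\tau_R)=D\big(\mathcal N(\rho_Q)\,\|\,I_S\otimes\operatorname{Tr}_S[\mathcal N(\rho_Q)]\big).$$ -/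

import Mathlib

open Matrix Filter Topology
open scoped Kronecker ENNReal ComplexOrder

noncomputable section

namespace RenyiCone

/-! Registers are finite-dimensional: a register is a finite index type, and operators on it are
complex matrices indexed by that type. A composite register is a product type. -/

section States

variable {A B C : Type*} [Fintype A] [DecidableEq A] [Fintype B] [Fintype C]

/-- Normalized quantum states (density operators). -/
def IsState (ρ : Matrix A A ℂ) : Prop :=
  ρ.PosSemidef ∧ ρ.trace = 1

/-- A state is pure if it is a rank-one projector `|ψ⟩⟨ψ|`. -/
def IsPureState (ρ : Matrix A A ℂ) : Prop :=
  IsState ρ ∧ ∃ ψ : A → ℂ, ρ = vecMulVec ψ (star ψ)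

/-- Partial trace over the first tensor factor. -/
def trFst (X : Matrix (A × B) (A × B) ℂ) : Matrix B B ℂ :=
  Matrix.of fun b b' => ∑ a, X (a, b) (a, b')

/-- Partial trace over the second tensor factor. -/
def trSnd (X : Matrix (A × B) (A × B) ℂ) : Matrix A A ℂ :=
  Matrix.of fun a a' => ∑ b, X (a, b) (a', b)

/-- Partial trace over the middle factor `B` of an operator on `(A B) C`. -/
def trMid (X : Matrix ((A × B) × C) ((A × B) × C) ℂ) : Matrix (A × C) (A × C) ℂ :=
  Matrix.of fun p p' => ∑ b, X ((p.1, b), p.2) ((p'.1, b), p'.2)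

end States

section Channels

variable {A B : Type*} [Fintype A] [Fintype B]

/-- `Φ ⊗ id_E` applied to an operator on `A E`. -/
def tensorId (Φ : Matrix A A ℂ →ₗ[ℂ] Matrix B B ℂ) {E : Type*}
    (X : Matrix (A × E) (A × E) ℂ) : Matrix (B × E) (B × E) ℂ :=
  Matrix.of fun p p' => Φ (Matrix.of fun a a' => X (a, p.2) (a', p'.2)) p.1 p'.1

/-- Completely positive and trace preserving linear maps. -/
def IsCPTP (Φ : Matrix A A ℂ →ₗ[ℂ] Matrix B B ℂ) : Prop :=
  (∀ (k : ℕ) (X : Matrix (A × Fin k) (A × Fin k) ℂ),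
      X.PosSemidef → (tensorId Φ X).PosSemidef) ∧
    ∀ X : Matrix A A ℂ, (Φ X).trace = X.trace

/-- `V : A → B R` is a Stinespring dilation of `Φ : A → B`: it is an isometry and
`Φ X = Tr_R (V X V†)`. -/
def IsStinespring [DecidableEq A] {R : Type*} [Fintype R]
    (Φ : Matrix A A ℂ →ₗ[ℂ] Matrix B B ℂ) (V : Matrix (B × R) A ℂ) : Prop :=
  Vᴴ * V = 1 ∧ ∀ X : Matrix A A ℂ, Φ X = trSnd (V * X * Vᴴ)

end Channels

section Divergences

variable {A : Type*} [Fintype A] [DecidableEq A]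

/-- Power of a positive semidefinite matrix through its eigenvalues. For a nonzero exponent the
eigenvalue `0` is sent to `0`, so that negative powers are taken on the support. -/
def mpow (X : Matrix A A ℂ) (p : ℝ) : Matrix A A ℂ :=
  cfc (fun x : ℝ => x ^ p) X

/-- Base-2 logarithm of a positive semidefinite matrix, taken on its support
(the eigenvalue `0` is sent to `0`). -/
def mlog (X : Matrix A A ℂ) : Matrix A A ℂ :=
  cfc (fun x : ℝ => Real.logb 2 x) X

/-- `supp ρ ⊆ supp σ`; the support of a Hermitian matrix is its range. -/
def SuppLE (ρ σ : Matrix A A ℂ) : Prop :=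
  LinearMap.range ρ.mulVecLin ≤ LinearMap.range σ.mulVecLin

/-- `ρ ⊥ σ` for positive semidefinite matrices. -/
def Orthogonal (ρ σ : Matrix A A ℂ) : Prop :=
  ρ * σ = 0

/-- The domain on which the Rényi divergences of order `a` are given by their trace formula;
outside of it they equal `∞`. -/
def FiniteDomain (a : ℝ) (ρ σ : Matrix A A ℂ) : Prop :=
  (a < 1 ∧ ¬ Orthogonal ρ σ) ∨ SuppLE ρ σ

open Classical in
/-- Petz Rényi divergence of order `a ∈ (0,1) ∪ (1,∞)`. -/
def petzReal (a : ℝ) (ρ σ : Matrix A A ℂ) : EReal :=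
  if FiniteDomain a ρ σ then
    ((1 / (a - 1) * Real.logb 2
      ((mpow ρ a * mpow σ (1 - a)).trace.re / ρ.trace.re) : ℝ) : EReal)
  else ⊤

open Classical in
/-- Sandwiched (minimal) Rényi divergence of order `a ∈ (0,1) ∪ (1,∞)`. -/
def sandReal (a : ℝ) (ρ σ : Matrix A A ℂ) : EReal :=
  if FiniteDomain a ρ σ then
    ((1 / (a - 1) * Real.logb 2
      ((mpow (mpow σ ((1 - a) / (2 * a)) * ρ * mpow σ ((1 - a) / (2 * a))) a).trace.re
        / ρ.trace.re) : ℝ) : EReal)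
  else ⊤

open Classical in
/-- Umegaki (quantum) relative entropy, in base 2. -/
def relEntropy (ρ σ : Matrix A A ℂ) : EReal :=
  if SuppLE ρ σ then
    (((ρ * (mlog ρ - mlog σ)).trace.re / ρ.trace.re : ℝ) : EReal)
  else ⊤

open Classical in
/-- Extends a family of divergences from orders in `(0,1) ∪ (1,∞)` to all orders in `[0,∞]`: the
value at `1` is the relative entropy, the values at `0` and `∞` are the limits. The families above
are monotone in the order, so both limits exist in the extended reals and coincide with the lower
limits written here. -/
def extendOrder (D : ℝ → Matrix A A ℂ → Matrix A A ℂ → EReal) (α : ℝ≥0∞)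
    (ρ σ : Matrix A A ℂ) : EReal :=
  if α = 0 then liminf (fun a : ℝ => D a ρ σ) (𝓝[>] 0)
  else if α = 1 then relEntropy ρ σ
  else if α = ⊤ then liminf (fun a : ℝ => D a ρ σ) atTop
  else D α.toReal ρ σ

/-- Petz Rényi divergence of order `α ∈ [0,∞]`. -/
def petzDiv (α : ℝ≥0∞) (ρ σ : Matrix A A ℂ) : EReal :=
  extendOrder petzReal α ρ σ

/-- Sandwiched Rényi divergence of order `α ∈ [0,∞]`. -/
def sandDiv (α : ℝ≥0∞) (ρ σ : Matrix A A ℂ) : EReal :=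
  extendOrder sandReal α ρ σ

/-- Von Neumann entropy, in base 2. -/
def entropy (ρ : Matrix A A ℂ) : ℝ :=
  -(ρ * mlog ρ).trace.re

end Divergences

section ConditionalEntropies

variable {A B : Type*} [Fintype A] [DecidableEq A] [Fintype B] [DecidableEq B]

/-- `H̄↓_α(A|B)`: Petz divergence, not optimized. -/
def petzDown (α : ℝ≥0∞) (ρ : Matrix (A × B) (A × B) ℂ) : EReal :=
  -petzDiv α ρ ((1 : Matrix A A ℂ) ⊗ₖ trFst ρ)

/-- `H̄↑_α(A|B)`: Petz divergence, optimized. -/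
def petzUp (α : ℝ≥0∞) (ρ : Matrix (A × B) (A × B) ℂ) : EReal :=
  ⨆ σ : {σ : Matrix B B ℂ // IsState σ}, -petzDiv α ρ ((1 : Matrix A A ℂ) ⊗ₖ σ.1)

/-- `H̃↓_α(A|B)`: sandwiched divergence, not optimized. -/
def sandDown (α : ℝ≥0∞) (ρ : Matrix (A × B) (A × B) ℂ) : EReal :=
  -sandDiv α ρ ((1 : Matrix A A ℂ) ⊗ₖ trFst ρ)

/-- `H̃↑_α(A|B)`: sandwiched divergence, optimized. -/
def sandUp (α : ℝ≥0∞) (ρ : Matrix (A × B) (A × B) ℂ) : EReal :=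
  ⨆ σ : {σ : Matrix B B ℂ // IsState σ}, -sandDiv α ρ ((1 : Matrix A A ℂ) ⊗ₖ σ.1)

/-- Conditional von Neumann entropy `H(A|B) = H(AB) - H(B)`. -/
def condEntropy (ρ : Matrix (A × B) (A × B) ℂ) : ℝ :=
  entropy ρ - entropy (trFst ρ)

/-- The expression `1/(1-a) · log Tr[(Tr_A[ρ^{1/a}])^a]` for an operator `ρ` on `A B`. -/
def closedForm (a : ℝ) (ρ : Matrix (A × B) (A × B) ℂ) : ℝ :=
  1 / (1 - a) * Real.logb 2 (mpow (trFst (mpow ρ (1 / a))) a).trace.re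

/-- The order `α / (2 α - 1)` for `α ∈ [1/2, ∞]`, equal to `1/2` at `α = ∞` and, by the conventions
of `ℝ≥0∞`, to `∞` at `α = 1/2`. -/
def dualOrder (α : ℝ≥0∞) : ℝ≥0∞ :=
  if α = ⊤ then 1 / 2 else α / (2 * α - 1)

end ConditionalEntropies

section Protocol

variable {Q S I R E : Type*} [Fintype Q] [Fintype S] [Fintype I] [Fintype R]

/-- The channel `N = Tr_I ∘ V : Q → S R` obtained from an isometry `V : Q → (S I) R`. -/
def complChannel (V : Matrix ((S × I) × R) Q ℂ) (X : Matrix Q Q ℂ) :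
    Matrix (S × R) (S × R) ℂ :=
  trMid (V * X * Vᴴ)

/-- The state `(M ⊗ id_E)(ρ_QE)` on `(S I) E`, regarded as a bipartite operator on `S (I E)`. -/
def outState (M : Matrix Q Q ℂ →ₗ[ℂ] Matrix (S × I) (S × I) ℂ)
    (ρ : Matrix (Q × E) (Q × E) ℂ) : Matrix (S × (I × E)) (S × (I × E)) ℂ :=
  (tensorId M ρ).submatrix (Equiv.prodAssoc S I E).symm (Equiv.prodAssoc S I E).symm

end Protocol

end RenyiCone

end

set_option linter.unusedSectionVars false

namespace RenyiCone

/-! ### Functions of Hermitian matrices and their joint spectral weights. -/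

section SpectralCalculus

variable {m n : Type*} [Fintype m] [DecidableEq m] [Fintype n] [DecidableEq n]

/-! Everything is a duality between two marginals of one pure vector. Dilating `ρ = |ψ⟩⟨ψ|` by `V`
gives a vector on S, B = IE and C = R, whose amplitudes form a matrix `M` from C to SB. Then `M *
Mᴴ` is the state on S(IE), and with `N = flipMat M` (the same amplitudes, read from B to SC) `N *
Nᴴ` is the state on SR. A function of a marginal of a pure vector can be moved to the complementary
marginal, and `sliceMap M` and `sliceMap N` are adjoint for the trace pairing.

Part 4 follows by moving both powers across (`trace_cfc_mul_cfc_trFst`). For part 2 the sandwiched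
trace with the marginal of B becomes `closedForm` of the state on SC (`sandReal_trFst`). Hölder and
reverse Hölder, with their equality case, identify this with the optimized Petz divergence
(`iInf_petzReal`). The orders 0, 1, ∞ are monotone limits; exchanging a supremum over orders with
the infimum over states uses compactness and lower semicontinuity (`iInf_iSup_le_of_monotoneOn`).
Part 3 is part 2 with B and C interchanged.

For part 1 write the two dual orders as 1/(1-s) and 1/(1+s). Both traces are extremal values of the
bilinear pairing Tr[`sliceMap M A` D], with A = ω^s and D = τ^(-s): maximizing over A gives one by
Hölder, minimizing over D gives the other by reverse Hölder. In the variables A and D the constraint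
sets are convex and the first is compact, so Sion's theorem exchanges the extrema
(`exists_state_forall_trace_le`). Orders below 1 come from interchanging B and C, order 1 from von
Neumann entropies, and s = 1 from a limit. -/

theorem continuousOn_spectrum (f : ℝ → ℝ) (X : Matrix n n ℂ) : ContinuousOn f (spectrum ℝ X) :=
  (Matrix.finite_real_spectrum (A := X)).continuousOn f

theorem cfc_mul_cfc (f g : ℝ → ℝ) (X : Matrix n n ℂ) :
    cfc f X * cfc g X = cfc (fun x => f x * g x) X :=
  (cfc_mul f g X (continuousOn_spectrum _ _) (continuousOn_spectrum _ _)).symm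

theorem cfc_cfc (g f : ℝ → ℝ) {X : Matrix n n ℂ} (hX : X.IsHermitian) :
    cfc g (cfc f X) = cfc (fun x => g (f x)) X :=
  (cfc_comp g f X hX (((Matrix.finite_real_spectrum (A := X)).image f).continuousOn g)
    (continuousOn_spectrum _ _)).symm

theorem isHermitian_cfc (f : ℝ → ℝ) (X : Matrix n n ℂ) : (cfc f X).IsHermitian :=
  cfc_predicate f X

/-- A function agrees with a polynomial on the spectra of two given matrices. -/
theorem exists_polynomial_cfc (f : ℝ → ℝ) {X : Matrix m m ℂ} {Y : Matrix n n ℂ}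
    (hX : X.IsHermitian) (hY : Y.IsHermitian) :
    ∃ p : Polynomial ℝ, cfc f X = Polynomial.aeval X p ∧ cfc f Y = Polynomial.aeval Y p := by
  have hfin : (spectrum ℝ X ∪ spectrum ℝ Y).Finite :=
    (Matrix.finite_real_spectrum (A := X)).union Matrix.finite_real_spectrum
  set T := hfin.toFinset with hT
  have key : ∀ x ∈ spectrum ℝ X ∪ spectrum ℝ Y, f x = (Lagrange.interpolate T id f).eval x := by
    intro x hx
    exact (Lagrange.eval_interpolate_at_node (s := T) (v := id) f (Set.injOn_id _)
      (hfin.mem_toFinset.2 hx)).symm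
  refine ⟨Lagrange.interpolate T id f, ?_, ?_⟩
  · rw [← cfc_polynomial _ X hX]
    exact cfc_congr fun x hx => key x (Or.inl hx)
  · rw [← cfc_polynomial _ Y hY]
    exact cfc_congr fun x hx => key x (Or.inr hx)

/-- One interpolating polynomial serves both matrices, and for powers the relation propagates by
induction. Used with `X = M * Mᴴ` and `Y = Mᴴ * M` to carry functions through `M`. -/
theorem cfc_mul_intertwine (f : ℝ → ℝ) {X : Matrix m m ℂ} {Y : Matrix n n ℂ}
    (hX : X.IsHermitian) (hY : Y.IsHermitian) {A : Matrix m n ℂ} (h : X * A = A * Y) :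
    cfc f X * A = A * cfc f Y := by
  obtain ⟨p, hp, hq⟩ := exists_polynomial_cfc f hX hY
  have hpow : ∀ k : ℕ, X ^ k * A = A * Y ^ k := by
    intro k
    induction k with
    | zero => simp
    | succ k ih => rw [pow_succ, Matrix.mul_assoc, h, ← Matrix.mul_assoc, ih, Matrix.mul_assoc,
        ← pow_succ]
  rw [hp, hq, Polynomial.aeval_eq_sum_range, Polynomial.aeval_eq_sum_range, Matrix.sum_mul,
    Matrix.mul_sum]
  refine Finset.sum_congr rfl fun k _ => ?_
  rw [Matrix.smul_mul, Matrix.mul_smul, hpow]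

theorem cfc_transpose (f : ℝ → ℝ) {X : Matrix n n ℂ} (hX : X.IsHermitian) :
    cfc f Xᵀ = (cfc f X)ᵀ := by
  obtain ⟨p, hp, hq⟩ := exists_polynomial_cfc f hX hX.transpose
  rw [hp, hq, Polynomial.aeval_eq_sum_range, Polynomial.aeval_eq_sum_range, transpose_sum]
  simp [transpose_pow]

theorem isHermitian_one_kronecker {X : Matrix n n ℂ} (hX : X.IsHermitian) :
    ((1 : Matrix m m ℂ) ⊗ₖ X).IsHermitian := by
  rw [Matrix.IsHermitian, Matrix.conjTranspose_kronecker, hX.eq, Matrix.conjTranspose_one]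

theorem one_kronecker_pow (X : Matrix n n ℂ) (k : ℕ) :
    ((1 : Matrix m m ℂ) ⊗ₖ X) ^ k = (1 : Matrix m m ℂ) ⊗ₖ (X ^ k) := by
  induction k with
  | zero => simp
  | succ k ih => rw [pow_succ, pow_succ, ih, ← Matrix.mul_kronecker_mul, Matrix.one_mul]

theorem cfc_one_kronecker (f : ℝ → ℝ) {X : Matrix n n ℂ} (hX : X.IsHermitian) :
    cfc f ((1 : Matrix m m ℂ) ⊗ₖ X) = (1 : Matrix m m ℂ) ⊗ₖ cfc f X := by
  obtain ⟨p, hp, hq⟩ := exists_polynomial_cfc f hX (isHermitian_one_kronecker (m := m) hX)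
  rw [hp, hq, Polynomial.aeval_eq_sum_range, Polynomial.aeval_eq_sum_range]
  simp only [one_kronecker_pow]
  ext ⟨i, j⟩ ⟨i', j'⟩
  simp [Matrix.sum_apply, Finset.mul_sum, mul_left_comm]

theorem cfc_eq_conj (f : ℝ → ℝ) {X : Matrix n n ℂ} (hX : X.IsHermitian) :
    cfc f X = (hX.eigenvectorUnitary : Matrix n n ℂ) *
      diagonal (fun i => (f (hX.eigenvalues i) : ℂ)) * (hX.eigenvectorUnitary : Matrix n n ℂ)ᴴ := by
  rw [hX.cfc_eq, Matrix.IsHermitian.cfc, Unitary.conjStarAlgAut_apply]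
  rfl

theorem exists_unitary_cfc {X : Matrix n n ℂ} (hX : X.IsHermitian) :
    ∃ U : Matrix n n ℂ, Uᴴ * U = 1 ∧ U * Uᴴ = 1 ∧
      ∀ f : ℝ → ℝ, cfc f X = U * diagonal (fun i => (f (hX.eigenvalues i) : ℂ)) * Uᴴ :=
  ⟨hX.eigenvectorUnitary, Unitary.coe_star_mul_self hX.eigenvectorUnitary,
    Unitary.coe_mul_star_self hX.eigenvectorUnitary, fun f => cfc_eq_conj f hX⟩

/-- Two Hermitian matrices have joint spectral weights `w i j = |⟨uᵢ, vⱼ⟩|²`, a doubly stochastic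
array through which traces and vanishing of products of functions of them are computed. -/
theorem exists_overlap {X Y : Matrix n n ℂ} (hX : X.IsHermitian) (hY : Y.IsHermitian) :
    ∃ w : n → n → ℝ, (∀ i j, 0 ≤ w i j) ∧ (∀ i, ∑ j, w i j = 1) ∧ (∀ j, ∑ i, w i j = 1) ∧
      (∀ f g : ℝ → ℝ, (cfc f X * cfc g Y).trace.re =
        ∑ i, ∑ j, f (hX.eigenvalues i) * g (hY.eigenvalues j) * w i j) ∧
      (∀ f g : ℝ → ℝ, cfc f X * cfc g Y = 0 ↔
        ∀ i j, f (hX.eigenvalues i) * g (hY.eigenvalues j) * w i j = 0) := by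
  obtain ⟨U, hUU, hUU', hUf⟩ := exists_unitary_cfc hX
  obtain ⟨W, hWW, hWW', hWf⟩ := exists_unitary_cfc hY
  generalize hX.eigenvalues = x at *
  generalize hY.eigenvalues = y at *
  -- The unitary change between the two eigenbases; its squared entries are the weights.
  set G : Matrix n n ℂ := Uᴴ * W with hG
  have hG1 : G * Gᴴ = 1 := by
    rw [hG, conjTranspose_mul, conjTranspose_conjTranspose, Matrix.mul_assoc,
      ← Matrix.mul_assoc W, hWW', Matrix.one_mul, hUU]
  have hG2 : Gᴴ * G = 1 := by
    rw [hG, conjTranspose_mul, conjTranspose_conjTranspose, Matrix.mul_assoc,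
      ← Matrix.mul_assoc U, hUU', Matrix.one_mul, hWW]
  have hprod : ∀ f g : ℝ → ℝ, cfc f X * cfc g Y =
      U * (diagonal (fun i => (f (x i) : ℂ)) * G *
        diagonal (fun i => (g (y i) : ℂ))) * Wᴴ := by
    intro f g
    rw [hUf, hWf, hG]
    simp only [Matrix.mul_assoc]
  have hentry : ∀ f g : ℝ → ℝ, ∀ i j, (diagonal (fun i => (f (x i) : ℂ)) * G *
        diagonal (fun i => (g (y i) : ℂ))) i j =
      f (x i) * G i j * g (y j) := by
    intro f g i j
    rw [Matrix.mul_diagonal, Matrix.diagonal_mul]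
  refine ⟨fun i j => Complex.normSq (G i j), fun i j => Complex.normSq_nonneg _, ?_, ?_, ?_, ?_⟩
  · intro i
    have := congrFun (congrFun hG1 i) i
    rw [Matrix.mul_apply, Matrix.one_apply_eq] at this
    have h2 := congrArg Complex.re this
    rw [Complex.re_sum] at h2
    simpa [Complex.normSq_apply] using h2
  · intro j
    have := congrFun (congrFun hG2 j) j
    rw [Matrix.mul_apply, Matrix.one_apply_eq] at this
    have h2 := congrArg Complex.re this
    rw [Complex.re_sum] at h2
    simpa [Complex.normSq_apply] using h2
  · intro f g
    rw [hprod, Matrix.mul_assoc, Matrix.trace_mul_comm, Matrix.mul_assoc]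
    have hWU : Wᴴ * U = Gᴴ := by rw [hG, conjTranspose_mul, conjTranspose_conjTranspose]
    rw [hWU, Matrix.trace, Complex.re_sum]
    refine Finset.sum_congr rfl fun i _ => ?_
    rw [Matrix.diag_apply, Matrix.mul_apply, Complex.re_sum]
    refine Finset.sum_congr rfl fun j _ => ?_
    rw [hentry, Matrix.conjTranspose_apply]
    have : (f (x i) : ℂ) * G i j * g (y j) * star (G i j) =
        ((f (x i) * g (y j) * Complex.normSq (G i j) : ℝ) : ℂ) := by
      push_cast
      rw [Complex.normSq_eq_conj_mul_self]
      simp only [Complex.star_def]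
      ring
    rw [this, Complex.ofReal_re]
  · intro f g
    have h0 : cfc f X * cfc g Y = 0 ↔ (diagonal (fun i => (f (x i) : ℂ)) * G *
        diagonal (fun i => (g (y i) : ℂ))) = 0 := by
      rw [hprod]
      constructor
      · intro h
        have h2 := congrArg (fun Z => Uᴴ * Z * W) h
        simp only [Matrix.mul_zero, Matrix.zero_mul] at h2
        rw [← h2]
        simp only [Matrix.mul_assoc, hWW, Matrix.mul_one]
        rw [← Matrix.mul_assoc Uᴴ U, hUU, Matrix.one_mul]
      · intro h
        rw [h]; simp
    have hterm : ∀ (a b : ℝ) (z : ℂ), (a : ℂ) * z * b = 0 ↔ a * b * Complex.normSq z = 0 := by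
      intro a b z
      simp only [mul_eq_zero, Complex.ofReal_eq_zero, Complex.normSq_eq_zero]
      tauto
    rw [h0, ← Matrix.ext_iff]
    refine forall_congr' fun i => forall_congr' fun j => ?_
    rw [hentry, Matrix.zero_apply]
    exact hterm _ _ _

theorem trace_cfc_re (f : ℝ → ℝ) {X : Matrix n n ℂ} (hX : X.IsHermitian) :
    (cfc f X).trace.re = ∑ i, f (hX.eigenvalues i) := by
  rw [cfc_eq_conj f hX, Matrix.trace_mul_comm, ← Matrix.mul_assoc]
  have : (hX.eigenvectorUnitary : Matrix n n ℂ)ᴴ * (hX.eigenvectorUnitary : Matrix n n ℂ) = 1 :=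
    Unitary.coe_star_mul_self hX.eigenvectorUnitary
  rw [this, Matrix.one_mul, Matrix.trace_diagonal, Complex.re_sum]
  simp

theorem cfc_congr_eigenvalues {f g : ℝ → ℝ} {X : Matrix n n ℂ} (hX : X.IsHermitian)
    (h : ∀ i, f (hX.eigenvalues i) = g (hX.eigenvalues i)) : cfc f X = cfc g X := by
  refine cfc_congr ?_
  rw [hX.spectrum_real_eq_range_eigenvalues]
  rintro _ ⟨i, rfl⟩
  exact h i

theorem cfc_congr_nonneg {f g : ℝ → ℝ} {X : Matrix n n ℂ} (hX : X.PosSemidef)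
    (h : ∀ x, 0 ≤ x → f x = g x) : cfc f X = cfc g X :=
  cfc_congr_eigenvalues hX.1 fun i => h _ (hX.eigenvalues_nonneg i)

theorem cfc_congr_pos {f g : ℝ → ℝ} {X : Matrix n n ℂ} (hX : X.PosDef)
    (h : ∀ x, 0 < x → f x = g x) : cfc f X = cfc g X :=
  cfc_congr_eigenvalues hX.1 fun i => h _ (hX.eigenvalues_pos i)

theorem posSemidef_cfc {f : ℝ → ℝ} {X : Matrix n n ℂ} (hX : X.IsHermitian)
    (h : ∀ i, 0 ≤ f (hX.eigenvalues i)) : (cfc f X).PosSemidef := by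
  rw [cfc_eq_conj f hX]
  refine Matrix.PosSemidef.mul_mul_conjTranspose_same ?_ _
  rw [Matrix.posSemidef_diagonal_iff]
  intro i
  exact_mod_cast h i

theorem posSemidef_mpow {X : Matrix n n ℂ} (hX : X.PosSemidef) (p : ℝ) : (mpow X p).PosSemidef :=
  posSemidef_cfc hX.1 fun i => Real.rpow_nonneg (hX.eigenvalues_nonneg i) p

theorem cfc_id_matrix {X : Matrix n n ℂ} (hX : X.IsHermitian) : cfc (fun x : ℝ => x) X = X :=
  cfc_id' ℝ X hX

theorem cfc_const_smul (c : ℝ) (f : ℝ → ℝ) (X : Matrix n n ℂ) :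
    cfc (fun x => c * f x) X = c • cfc f X :=
  cfc_const_mul c f X (continuousOn_spectrum _ _)

theorem posDef_cfc {f : ℝ → ℝ} {X : Matrix n n ℂ} (hX : X.IsHermitian)
    (h : ∀ i, 0 < f (hX.eigenvalues i)) : (cfc f X).PosDef := by
  have h1 : cfc f X * cfc (fun x => (f x)⁻¹) X = 1 := by
    rw [cfc_mul_cfc, cfc_congr_eigenvalues (g := fun _ => 1) hX
      (fun i => mul_inv_cancel₀ (h i).ne'), cfc_const_one ℝ X]
  rw [(posSemidef_cfc hX fun i => (h i).le).posDef_iff_isUnit]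
  exact IsUnit.of_mul_eq_one _ h1

end SpectralCalculus

/-! ### Hölder-type trace inequalities and supports. -/

section TraceInequalities

variable {n : Type*} [Fintype n] [DecidableEq n]

/-- Averaging over the doubly stochastic overlaps lifts a scalar inequality between eigenvalues to
traces. Pairs with `u * v ≠ 0` carry no weight, which is how support conditions enter. -/
theorem trace_cfc_mul_cfc_le {X Y : Matrix n n ℂ} (hX : X.IsHermitian) (hY : Y.IsHermitian)
    {u v f g h k : ℝ → ℝ} (h0 : cfc u X * cfc v Y = 0)
    (hle : ∀ i j, u (hX.eigenvalues i) * v (hY.eigenvalues j) = 0 →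
      f (hX.eigenvalues i) * g (hY.eigenvalues j) ≤ h (hX.eigenvalues i) + k (hY.eigenvalues j)) :
    (cfc f X * cfc g Y).trace.re ≤ (cfc h X).trace.re + (cfc k Y).trace.re := by
  obtain ⟨w, hw, hw1, hw2, htr, hz⟩ := exists_overlap hX hY
  rw [htr, trace_cfc_re h hX, trace_cfc_re k hY]
  have e : ∑ i, h (hX.eigenvalues i) + ∑ j, k (hY.eigenvalues j) =
      ∑ i, ∑ j, (h (hX.eigenvalues i) + k (hY.eigenvalues j)) * w i j := by
    simp only [add_mul, Finset.sum_add_distrib]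
    congr 1
    · simp only [← Finset.mul_sum, hw1, mul_one]
    · rw [Finset.sum_comm]
      simp only [← Finset.mul_sum, hw2, mul_one]
  rw [e]
  refine Finset.sum_le_sum fun i _ => Finset.sum_le_sum fun j _ => ?_
  have hz' := (hz u v).1 h0 i j
  rcases mul_eq_zero.1 hz' with h1 | h1
  · exact mul_le_mul_of_nonneg_right (hle i j h1) (hw i j)
  · rw [h1, mul_zero, mul_zero]

theorem trace_mul_re_nonneg {X Y : Matrix n n ℂ} (hX : X.PosSemidef) (hY : Y.PosSemidef) :
    0 ≤ (X * Y).trace.re := by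
  obtain ⟨w, hw, -, -, htr, -⟩ := exists_overlap hX.1 hY.1
  have := htr (fun x => x) (fun x => x)
  rw [cfc_id_matrix hX.1, cfc_id_matrix hY.1] at this
  rw [this]
  exact Finset.sum_nonneg fun i _ => Finset.sum_nonneg fun j _ =>
    mul_nonneg (mul_nonneg (hX.eigenvalues_nonneg i) (hY.eigenvalues_nonneg j)) (hw i j)

/-- The trace is a sum of nonnegative overlap terms. Orthogonality thus becomes a trace condition,
which passes through partial traces. -/
theorem trace_mul_re_eq_zero {X Y : Matrix n n ℂ} (hX : X.PosSemidef) (hY : Y.PosSemidef) :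
    (X * Y).trace.re = 0 ↔ X * Y = 0 := by
  refine ⟨fun h => ?_, fun h => by rw [h]; simp⟩
  obtain ⟨w, hw, -, -, htr, hz⟩ := exists_overlap hX.1 hY.1
  have h1 := htr (fun x => x) (fun x => x)
  have h2 := hz (fun x => x) (fun x => x)
  rw [cfc_id_matrix hX.1, cfc_id_matrix hY.1] at h1 h2
  rw [h2]
  rw [h1] at h
  have hnn : ∀ i j, 0 ≤ hX.1.eigenvalues i * hY.1.eigenvalues j * w i j := fun i j =>
    mul_nonneg (mul_nonneg (hX.eigenvalues_nonneg i) (hY.eigenvalues_nonneg j)) (hw i j)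
  intro i j
  have h3 := (Finset.sum_eq_zero_iff_of_nonneg
    (fun i _ => Finset.sum_nonneg fun j _ => hnn i j)).1 h i (Finset.mem_univ i)
  exact (Finset.sum_eq_zero_iff_of_nonneg (fun j _ => hnn i j)).1 h3 j (Finset.mem_univ j)

theorem trace_re_nonneg {X : Matrix n n ℂ} (hX : X.PosSemidef) : 0 ≤ X.trace.re :=
  (Complex.le_def.1 hX.trace_nonneg).1

theorem trace_re_pos {X : Matrix n n ℂ} (hX : X.PosSemidef) (h : X ≠ 0) : 0 < X.trace.re := by
  refine lt_of_le_of_ne (trace_re_nonneg hX) fun h0 => h ?_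
  have := (trace_mul_re_eq_zero hX Matrix.PosSemidef.one).1 (by rw [Matrix.mul_one, ← h0])
  rwa [Matrix.mul_one] at this

theorem mpow_one {X : Matrix n n ℂ} (hX : X.IsHermitian) : mpow X 1 = X := by
  rw [mpow]
  simp only [Real.rpow_one]
  exact cfc_id_matrix hX

/-- The hypothesis guards the kernel: `0 ^ p * 0 ^ (-p) = 0` for `p ≠ 0`, whereas `0 ^ 0 = 1`. -/
theorem mpow_mul_mpow {X : Matrix n n ℂ} (hX : X.PosSemidef) {p q : ℝ}
    (hpq : p + q = 0 → p = 0) : mpow X p * mpow X q = mpow X (p + q) := by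
  rw [mpow, mpow, mpow, cfc_mul_cfc]
  refine cfc_congr_nonneg hX fun x hx => ?_
  rcases hx.eq_or_lt with rfl | hx
  · by_cases h : p + q = 0
    · have hp := hpq h
      have hq : q = 0 := by linarith
      simp [hp, hq]
    · rw [Real.zero_rpow h]
      by_cases hp : p = 0
      · have hq : q ≠ 0 := by rintro rfl; exact h (by linarith)
        rw [Real.zero_rpow hq, mul_zero]
      · rw [Real.zero_rpow hp, zero_mul]
  · rw [Real.rpow_add hx]

theorem mpow_mpow {X : Matrix n n ℂ} (hX : X.PosSemidef) (p q : ℝ) :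
    mpow (mpow X p) q = mpow X (p * q) := by
  rw [mpow, mpow, mpow, cfc_cfc _ _ hX.1]
  exact cfc_congr_nonneg hX fun x hx => (Real.rpow_mul hx p q).symm

theorem mpow_smul {X : Matrix n n ℂ} (hX : X.PosSemidef) {c : ℝ} (hc : 0 ≤ c) (p : ℝ) :
    mpow (c • X) p = c ^ p • mpow X p := by
  have h1 : c • X = cfc (fun x => c * x) X := by
    rw [cfc_const_smul, cfc_id_matrix hX.1]
  rw [mpow, h1, cfc_cfc _ _ hX.1, mpow, ← cfc_const_smul]
  exact cfc_congr_nonneg hX fun x hx => Real.mul_rpow hc hx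

theorem trace_mpow_nonneg {X : Matrix n n ℂ} (hX : X.PosSemidef) (p : ℝ) :
    0 ≤ (mpow X p).trace.re :=
  trace_re_nonneg (posSemidef_mpow hX p)

theorem mpow_ne_zero {X : Matrix n n ℂ} (hX : X.PosSemidef) (h : X ≠ 0) (p : ℝ) :
    mpow X p ≠ 0 := by
  intro h0
  have h1 : mpow X p * cfc (fun x : ℝ => x ^ (1 - p) * (if x = 0 then 0 else 1)) X = X := by
    rw [mpow, cfc_mul_cfc]
    conv_rhs => rw [← cfc_id_matrix hX.1]
    refine cfc_congr_nonneg hX fun x hx => ?_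
    rcases hx.eq_or_lt with rfl | hx
    · simp
    · simp only [hx.ne', if_false, mul_one]
      rw [← Real.rpow_add hx, add_sub_cancel, Real.rpow_one]
  rw [h0, Matrix.zero_mul] at h1
  exact h h1.symm

theorem trace_mpow_pos {X : Matrix n n ℂ} (hX : X.PosSemidef) (h : X ≠ 0) (p : ℝ) :
    0 < (mpow X p).trace.re :=
  trace_re_pos (posSemidef_mpow hX p) (mpow_ne_zero hX h p)

/-- The spectral projection of a Hermitian matrix onto its kernel. -/
noncomputable def kerProj (X : Matrix n n ℂ) : Matrix n n ℂ :=
  cfc (fun x : ℝ => if x = 0 then 1 else 0) X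

theorem posSemidef_kerProj {X : Matrix n n ℂ} (hX : X.IsHermitian) : (kerProj X).PosSemidef :=
  posSemidef_cfc hX fun i => by split_ifs <;> norm_num

theorem kerProj_mul_self {X : Matrix n n ℂ} (hX : X.IsHermitian) : kerProj X * X = 0 := by
  have : kerProj X * cfc (fun x : ℝ => x) X = 0 := by
    rw [kerProj, cfc_mul_cfc, ← cfc_const_zero ℝ X]
    exact cfc_congr fun x _ => by by_cases h : x = 0 <;> simp [h]
  rwa [cfc_id_matrix hX] at this

theorem suppLE_iff {ρ σ : Matrix n n ℂ} (hσ : σ.IsHermitian) :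
    SuppLE ρ σ ↔ kerProj σ * ρ = 0 := by
  constructor
  · intro h
    ext i j
    have h1 : ρ *ᵥ Pi.single j 1 ∈ LinearMap.range σ.mulVecLin :=
      h ⟨Pi.single j 1, rfl⟩
    obtain ⟨v, hv⟩ := h1
    rw [Matrix.mulVecLin_apply] at hv
    have h2 : (kerProj σ * ρ) *ᵥ Pi.single j 1 = 0 := by
      rw [← Matrix.mulVec_mulVec, ← hv, Matrix.mulVec_mulVec, kerProj_mul_self hσ,
        Matrix.zero_mulVec]
    have h3 := congrFun h2 i
    rwa [Matrix.mulVec_single_one] at h3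
  · intro h
    -- Since `0⁻¹ = 0`, the inverse is the pseudoinverse, and σ times it is the projection onto the
    -- support.
    have h1 : kerProj σ + σ * cfc (fun x : ℝ => x⁻¹) σ = 1 := by
      conv_lhs => rw [← cfc_id_matrix hσ, kerProj, cfc_cfc _ _ hσ, cfc_cfc _ _ hσ, cfc_mul_cfc,
        ← cfc_add (a := σ) _ _ (continuousOn_spectrum _ _) (continuousOn_spectrum _ _)]
      rw [← cfc_const_one ℝ σ]
      exact cfc_congr fun x _ => by by_cases hx : x = 0 <;> simp [hx]
    have h2 : ρ = σ * (cfc (fun x : ℝ => x⁻¹) σ * ρ) := by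
      conv_lhs => rw [← Matrix.one_mul ρ, ← h1, Matrix.add_mul, h, zero_add, Matrix.mul_assoc]
    rintro _ ⟨v, rfl⟩
    refine ⟨(cfc (fun x : ℝ => x⁻¹) σ * ρ) *ᵥ v, ?_⟩
    rw [Matrix.mulVecLin_apply, Matrix.mulVecLin_apply, Matrix.mulVec_mulVec, ← h2]

theorem suppLE_iff' {ρ σ : Matrix n n ℂ} (hρ : ρ.IsHermitian) (hσ : σ.IsHermitian) :
    SuppLE ρ σ ↔ ρ * kerProj σ = 0 := by
  rw [suppLE_iff hσ]
  have hk : (kerProj σ).IsHermitian := isHermitian_cfc _ _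
  constructor
  · intro h
    have := congrArg conjTranspose h
    rwa [conjTranspose_mul, hρ.eq, hk.eq, conjTranspose_zero] at this
  · intro h
    have := congrArg conjTranspose h
    rwa [conjTranspose_mul, hρ.eq, hk.eq, conjTranspose_zero] at this

theorem kerProj_eq_zero {X : Matrix n n ℂ} (hX : X.PosDef) : kerProj X = 0 := by
  rw [kerProj, ← cfc_const_zero ℝ X]
  exact cfc_congr_pos hX fun x hx => by simp [hx.ne']

theorem suppLE_of_posDef (ρ : Matrix n n ℂ) {σ : Matrix n n ℂ} (hσ : σ.PosDef) : SuppLE ρ σ := by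
  rw [suppLE_iff hσ.1, kerProj_eq_zero hσ, Matrix.zero_mul]

/-- Hölder's inequality for the trace pairing with a power of a subnormalized operator. -/
theorem trace_mul_mpow_le {X Y : Matrix n n ℂ} (hX : X.PosSemidef) (hY : Y.PosSemidef)
    (hY1 : Y.trace.re ≤ 1) {s : ℝ} (hs : 0 < s) (hs1 : s < 1) :
    (X * mpow Y s).trace.re ≤ (mpow X (1 / (1 - s))).trace.re ^ (1 - s) := by
  have h1s : 0 < 1 - s := by linarith
  by_cases hX0 : X = 0
  · subst hX0
    rw [Matrix.zero_mul]
    simpa using Real.rpow_nonneg (trace_mpow_nonneg hX _) _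
  set T := (mpow X (1 / (1 - s))).trace.re with hT
  have hTpos : 0 < T := trace_mpow_pos hX hX0 _
  have hz : cfc (fun _ : ℝ => (0 : ℝ)) X * cfc (fun _ : ℝ => (0 : ℝ)) Y = 0 := by
    rw [cfc_const_zero ℝ X, Matrix.zero_mul]
  -- Weighted AM-GM for `x ^ (1 / (1 - s)) / T` and `y` with weights `1 - s` and `s`, multiplied by
  -- `T ^ (1 - s)`.
  have key := trace_cfc_mul_cfc_le hX.1 hY.1 (f := fun x => x) (g := fun y => y ^ s)
    (h := fun x => (T ^ (1 - s) * (1 - s) / T) * x ^ (1 / (1 - s)))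
    (k := fun y => (T ^ (1 - s) * s) * y) hz ?_
  · rw [cfc_id_matrix hX.1, cfc_const_smul, cfc_const_smul, cfc_id_matrix hY.1, trace_smul,
      trace_smul, Complex.smul_re, Complex.smul_re] at key
    refine key.trans ?_
    change T ^ (1 - s) * (1 - s) / T * T + T ^ (1 - s) * s * Y.trace.re ≤ _
    have hTp : 0 < T ^ (1 - s) := Real.rpow_pos_of_pos hTpos _
    have e : T ^ (1 - s) * (1 - s) / T * T = T ^ (1 - s) * (1 - s) := by field_simp
    rw [e]
    nlinarith [mul_le_mul_of_nonneg_left hY1 (mul_pos hTp hs).le]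
  · intro i j _
    set x := hX.1.eigenvalues i
    set y := hY.1.eigenvalues j
    have hx : 0 ≤ x := hX.eigenvalues_nonneg i
    have hy : 0 ≤ y := hY.eigenvalues_nonneg j
    have hp : 0 ≤ x ^ (1 / (1 - s)) / T := div_nonneg (Real.rpow_nonneg hx _) hTpos.le
    have am := Real.geom_mean_le_arith_mean2_weighted h1s.le hs.le hp hy (by ring)
    have e : (x ^ (1 / (1 - s)) / T) ^ (1 - s) = x / T ^ (1 - s) := by
      rw [Real.div_rpow (Real.rpow_nonneg hx _) hTpos.le, ← Real.rpow_mul hx,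
        one_div_mul_cancel h1s.ne', Real.rpow_one]
    rw [e] at am
    have hTp : 0 < T ^ (1 - s) := Real.rpow_pos_of_pos hTpos _
    have := mul_le_mul_of_nonneg_left am hTp.le
    have e2 : T ^ (1 - s) * (x / T ^ (1 - s) * y ^ s) = x * y ^ s := by field_simp
    rw [e2] at this
    refine this.trans (le_of_eq ?_)
    ring

/-- The reverse Hölder inequality, for negative powers of a subnormalized operator. -/
theorem le_trace_mul_mpow_neg {X Y : Matrix n n ℂ} (hX : X.PosSemidef) (hY : Y.PosSemidef)
    (hY1 : Y.trace.re ≤ 1) {s : ℝ} (hs : 0 < s) (hsupp : X * kerProj Y = 0) :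
    (mpow X (1 / (1 + s))).trace.re ^ (1 + s) ≤ (X * mpow Y (-s)).trace.re := by
  have h1s : 0 < 1 + s := by linarith
  by_cases hX0 : X = 0
  · subst hX0
    have : mpow (0 : Matrix n n ℂ) (1 / (1 + s)) = 0 := by
      have h := mpow_smul (X := (0 : Matrix n n ℂ)) hX (le_refl (0 : ℝ)) (1 / (1 + s))
      rwa [Real.zero_rpow (by positivity), zero_smul ℝ (0 : Matrix n n ℂ), zero_smul] at h
    rw [this, Matrix.zero_mul]
    simp [Real.zero_rpow h1s.ne']
  set T := (mpow X (1 / (1 + s))).trace.re with hT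
  have hTpos : 0 < T := trace_mpow_pos hX hX0 _
  have hz : cfc (fun x : ℝ => x) X * cfc (fun y : ℝ => if y = 0 then (1 : ℝ) else 0) Y = 0 := by
    rw [cfc_id_matrix hX.1]; exact hsupp
  -- The sign turns the lower bound into an upper bound; by `hz` a pair with `y = 0` matters only if
  -- `x = 0`.
  have key := trace_cfc_mul_cfc_le hX.1 hY.1 (f := fun x => x) (g := fun y => -1 * y ^ (-s))
    (h := fun x => (-(T ^ s * (1 + s))) * x ^ (1 / (1 + s)))
    (k := fun y => (T ^ s * s * T) * y) hz ?_
  · rw [cfc_id_matrix hX.1, cfc_const_smul, cfc_const_smul, cfc_const_smul, cfc_id_matrix hY.1, trace_smul,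
      trace_smul, Complex.smul_re, Complex.smul_re, Matrix.mul_smul, trace_smul,
      Complex.smul_re] at key
    change -1 • (X * mpow Y (-s)).trace.re ≤ -(T ^ s * (1 + s)) * T + T ^ s * s * T * Y.trace.re
      at key
    rw [neg_smul, one_smul] at key
    have hTp : 0 < T ^ s := Real.rpow_pos_of_pos hTpos _
    have e : T ^ (1 + s) = T * T ^ s := by rw [Real.rpow_add hTpos, Real.rpow_one]
    rw [e]
    nlinarith [mul_le_mul_of_nonneg_left hY1 (mul_pos (mul_pos hTp hs) hTpos).le]
  · intro i j hij
    set x := hX.1.eigenvalues i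
    set y := hY.1.eigenvalues j
    have hx : 0 ≤ x := hX.eigenvalues_nonneg i
    have hy : 0 ≤ y := hY.eigenvalues_nonneg j
    rcases hy.eq_or_lt with hy0 | hy0
    · rw [← hy0] at hij ⊢
      have hx0 : x = 0 := by simpa using hij
      rw [hx0, Real.zero_rpow (one_div_pos.2 h1s).ne']
      simp
    · have hp : 0 ≤ x * y ^ (-s) / T ^ s := by positivity
      -- The two terms are chosen so that `y` and `T` cancel in the geometric mean, leaving `x ^ (1
      -- / (1 + s))`.
      have am := Real.geom_mean_le_arith_mean2_weighted (w₁ := 1 / (1 + s)) (w₂ := s / (1 + s))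
        (by positivity) (by positivity) hp (mul_pos hTpos hy0).le (by field_simp)
      have e : (x * y ^ (-s) / T ^ s) ^ (1 / (1 + s)) * (T * y) ^ (s / (1 + s)) =
          x ^ (1 / (1 + s)) := by
        rw [Real.div_rpow (by positivity) (by positivity), Real.mul_rpow hx (by positivity),
          Real.mul_rpow hTpos.le hy0.le, ← Real.rpow_mul hy0.le, ← Real.rpow_mul hTpos.le,
          mul_one_div, mul_one_div, neg_div, Real.rpow_neg hy0.le]
        field_simp
      rw [e] at am
      have hTp : 0 < T ^ s := Real.rpow_pos_of_pos hTpos _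
      have := mul_le_mul_of_nonneg_left am (mul_pos hTp h1s).le
      have e2 : T ^ s * (1 + s) * (1 / (1 + s) * (x * y ^ (-s) / T ^ s) +
          s / (1 + s) * (T * y)) = x * y ^ (-s) + T ^ s * s * T * y := by
        field_simp
      rw [e2] at this
      linarith

end TraceInequalities

/-! ### Compactness and convexity of the sets entering the minimax argument. -/

section ConvexCompact

variable {n : Type*} [Fintype n] [DecidableEq n]

open scoped Matrix.Norms.L2Operator in
theorem continuousOn_mpow {p : ℝ} (hp : 0 ≤ p) :
    ContinuousOn (fun A : Matrix n n ℂ => mpow A p) {A | A.PosSemidef} :=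
  ContinuousOn.cfc_of_mem_nhdsSet (s := Set.univ) (fun x : ℝ => x ^ p) Filter.univ_mem
    continuousOn_id (fun _ hA => hA.1) (Real.continuous_rpow_const hp).continuousOn

open scoped Matrix.Norms.L2Operator in
theorem isClosed_posSemidef : IsClosed {A : Matrix n n ℂ | A.PosSemidef} := by
  have : {A : Matrix n n ℂ | A.PosSemidef} =
      {A | Aᴴ = A} ∩ ⋂ x : n → ℂ, {A | 0 ≤ (star x ⬝ᵥ (A *ᵥ x)).re ∧
        (star x ⬝ᵥ (A *ᵥ x)).im = 0} := by
    ext A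
    simp only [Set.mem_ofPred_eq, Set.mem_inter_iff, Set.mem_iInter,
      Matrix.posSemidef_iff_dotProduct_mulVec, Complex.le_def, Complex.zero_re, Complex.zero_im,
      Matrix.IsHermitian, eq_comm (a := (0 : ℝ))]
  rw [this]
  refine (isClosed_eq (by fun_prop) (by fun_prop)).inter (isClosed_iInter fun x => ?_)
  have hc : Continuous fun A : Matrix n n ℂ => star x ⬝ᵥ (A *ᵥ x) := by fun_prop
  exact (isClosed_le continuous_const (Complex.continuous_re.comp hc)).inter
    (isClosed_eq (Complex.continuous_im.comp hc) continuous_const)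

/-- The positive part of the unit ball of the Schatten `q`-norm. -/
def schattenBall (n : Type*) [Fintype n] [DecidableEq n] (q : ℝ) : Set (Matrix n n ℂ) :=
  {A | A.PosSemidef ∧ (mpow A q).trace.re ≤ 1}

/-- Eigenvalues in the ball are at most 1 and so are the entries of a unitary. The crude bound
suffices for compactness. -/
theorem norm_entry_le_of_mem_schattenBall {q : ℝ} (hq : 0 < q) {A : Matrix n n ℂ}
    (hA : A ∈ schattenBall n q) (i j : n) : ‖A i j‖ ≤ Fintype.card n := by
  have hle : ∀ i, hA.1.1.eigenvalues i ≤ 1 := by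
    intro i
    by_contra! h
    have h1 : 1 < hA.1.1.eigenvalues i ^ q := Real.one_lt_rpow h hq
    have h2 := hA.2
    rw [mpow, trace_cfc_re _ hA.1.1] at h2
    have h3 := Finset.single_le_sum (f := fun i => hA.1.1.eigenvalues i ^ q)
      (fun k _ => Real.rpow_nonneg (hA.1.eigenvalues_nonneg k) q) (Finset.mem_univ i)
    linarith
  obtain ⟨U, -, hU, hf⟩ := exists_unitary_cfc hA.1.1
  have hUle : ∀ i k, ‖U i k‖ ≤ 1 := by
    intro i k
    have h := congrArg Complex.re (congrFun (congrFun hU i) i)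
    rw [Matrix.mul_apply, Matrix.one_apply_eq, Complex.re_sum, Complex.one_re] at h
    have h1 : ∀ k, (U i k * Uᴴ k i).re = ‖U i k‖ ^ 2 := by
      intro k
      rw [Matrix.conjTranspose_apply, Complex.star_def, Complex.mul_conj, Complex.ofReal_re,
        Complex.normSq_eq_norm_sq]
    simp only [h1] at h
    have h3 := Finset.single_le_sum (f := fun k => ‖U i k‖ ^ 2) (fun k _ => sq_nonneg _)
      (Finset.mem_univ k)
    have h4 : ‖U i k‖ ^ 2 ≤ 1 := by rw [← h]; exact h3
    exact (sq_le_one_iff₀ (norm_nonneg _)).1 h4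
  have hA' := hf (fun x => x)
  rw [cfc_id_matrix hA.1.1] at hA'
  have hij : A i j = ∑ k, U i k * (hA.1.1.eigenvalues k : ℂ) * star (U j k) := by
    conv_lhs => rw [hA']
    rw [Matrix.mul_apply]
    simp only [Matrix.mul_diagonal, Matrix.conjTranspose_apply]
  rw [hij]
  refine (norm_sum_le _ _).trans ?_
  rw [← nsmul_one, ← Finset.card_univ]
  refine Finset.sum_le_card_nsmul _ _ _ fun k _ => ?_
  rw [norm_mul, norm_mul, norm_star, Complex.norm_real, Real.norm_eq_abs,
    abs_of_nonneg (hA.1.eigenvalues_nonneg k)]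
  have h1 := mul_le_one₀ (hUle i k) (hA.1.eigenvalues_nonneg k) (hle k)
  exact mul_le_one₀ h1 (norm_nonneg _) (hUle j k)

theorem isCompact_schattenBall {q : ℝ} (hq : 0 < q) : IsCompact (schattenBall n q) := by
  have hbox : IsCompact (Set.univ.pi fun _ : n => Set.univ.pi fun _ : n =>
      Metric.closedBall (0 : ℂ) (Fintype.card n)) :=
    isCompact_univ_pi fun _ => isCompact_univ_pi fun _ => isCompact_closedBall _ _
  refine hbox.of_isClosed_subset ?_ ?_
  · have hc : ContinuousOn (fun A : Matrix n n ℂ => (mpow A q).trace.re) {A | A.PosSemidef} :=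
      (Complex.continuous_re.comp (continuous_id.matrix_trace)).comp_continuousOn
        (continuousOn_mpow hq.le)
    exact hc.preimage_isClosed_of_isClosed isClosed_posSemidef isClosed_Iic
  · intro A hA i _ j _
    rw [mem_closedBall_zero_iff]
    exact norm_entry_le_of_mem_schattenBall hq hA i j

theorem isCompact_isState : IsCompact {σ : Matrix n n ℂ | IsState σ} := by
  refine (isCompact_schattenBall (n := n) one_pos).of_isClosed_subset ?_ ?_
  · exact isClosed_posSemidef.inter
      (isClosed_eq (continuous_id.matrix_trace) continuous_const)
  · rintro σ ⟨h1, h2⟩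
    refine ⟨h1, ?_⟩
    rw [mpow_one h1.1, h2, Complex.one_re]

theorem trace_mpow_add_one {X : Matrix n n ℂ} (hX : X.PosSemidef) (p : ℝ) (hp : p + 1 ≠ 0) :
    (X * mpow X p).trace.re = (mpow X (1 + p)).trace.re := by
  conv_lhs => rw [← mpow_one hX.1, mpow_mpow hX, one_mul,
    mpow_mul_mpow hX (fun h => absurd (by linarith) hp)]

theorem mpow_inv_mpow {X : Matrix n n ℂ} (hX : X.PosSemidef) {p q : ℝ} (h : p * q = 1) :
    mpow (mpow X p) q = X := by
  rw [mpow_mpow hX, h, mpow_one hX.1]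

/-- For a convex combination C with T = Tr C^q, Hölder bounds the pairing of C^(q-1) with each
endpoint by T^(1-1/q). By linearity T ≤ T^(1-1/q), which excludes T > 1. -/
theorem convex_schattenBall {q : ℝ} (hq : 1 ≤ q) : Convex ℝ (schattenBall n q) := by
  intro A hA B hB a b ha hb hab
  have hC : (a • A + b • B).PosSemidef := by
    have h1 : (a • A).PosSemidef := hA.1.smul ha
    have h2 : (b • B).PosSemidef := hB.1.smul hb
    exact h1.add h2
  refine ⟨hC, ?_⟩
  rcases hq.eq_or_lt with rfl | hq
  · have h1 := hA.2
    have h2 := hB.2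
    rw [mpow_one hA.1.1] at h1
    rw [mpow_one hB.1.1] at h2
    rw [mpow_one hC.1, trace_add, trace_smul, trace_smul, Complex.add_re, Complex.smul_re,
      Complex.smul_re, smul_eq_mul, smul_eq_mul]
    nlinarith
  set C := a • A + b • B with hCdef
  set T := (mpow C q).trace.re with hT
  by_contra! hlt
  have hq0 : 0 < q := by linarith
  have hs : 0 < 1 / q := by positivity
  have hs1 : 1 / q < 1 := by rw [div_lt_one hq0]; exact hq
  have hexp : (q - 1) * (1 / (1 - 1 / q)) = q := by
    have : q - 1 ≠ 0 := by linarith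
    field_simp
  have hY : ∀ D : Matrix n n ℂ, D ∈ schattenBall n q →
      (mpow C (q - 1) * D).trace.re ≤ T ^ (1 - 1 / q) := by
    intro D hD
    have := trace_mul_mpow_le (posSemidef_mpow hC (q - 1)) (posSemidef_mpow hD.1 q) hD.2 hs hs1
    rwa [mpow_inv_mpow hD.1 (mul_one_div_cancel hq0.ne'), mpow_mpow hC, hexp] at this
  have hsum : T = a * (mpow C (q - 1) * A).trace.re + b * (mpow C (q - 1) * B).trace.re := by
    have h1 : (mpow C (q - 1) * C).trace.re = T := by
      rw [Matrix.trace_mul_comm, trace_mpow_add_one hC _ (by linarith), add_sub_cancel]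
    rw [← h1, hCdef, Matrix.mul_add, trace_add, Matrix.mul_smul, Matrix.mul_smul, trace_smul,
      trace_smul, Complex.add_re, Complex.smul_re, Complex.smul_re, smul_eq_mul, smul_eq_mul]
  have hTle : T ≤ T ^ (1 - 1 / q) := by
    rw [hsum]
    conv_rhs => rw [← hsum]
    have := mul_le_mul_of_nonneg_left (hY A hA) ha
    have := mul_le_mul_of_nonneg_left (hY B hB) hb
    have e : T ^ (1 - 1 / q) = a * T ^ (1 - 1 / q) + b * T ^ (1 - 1 / q) := by
      rw [← add_mul, hab, one_mul]
    rw [e]; linarith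
  have : T ^ (1 - 1 / q) < T ^ (1 : ℝ) := Real.rpow_lt_rpow_of_exponent_lt hlt (by linarith)
  rw [Real.rpow_one] at this
  linarith

/-- Positive definite operators whose inverse powers are subnormalized. -/
def negSchattenBall (n : Type*) [Fintype n] [DecidableEq n] (p : ℝ) : Set (Matrix n n ℂ) :=
  {A | A.PosDef ∧ (mpow A (-p)).trace.re ≤ 1}

theorem posDef_mpow {X : Matrix n n ℂ} (hX : X.PosDef) (p : ℝ) : (mpow X p).PosDef :=
  posDef_cfc hX.1 fun i => Real.rpow_pos_of_pos (hX.eigenvalues_pos i) p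

/-- The argument of `convex_schattenBall` with reverse Hölder, giving T^(1+1/p) ≤ T. In the variable
D = τ^(-s), with p = 1/s, invertible subnormalized τ thus form a convex set on which the pairing is
linear. -/
theorem convex_negSchattenBall {p : ℝ} (hp : 0 < p) : Convex ℝ (negSchattenBall n p) := by
  intro A hA B hB a b ha hb hab
  have hC : (a • A + b • B).PosDef := by
    rcases ha.eq_or_lt with rfl | ha'
    · have : b = 1 := by linarith
      subst this
      simpa using hB.1
    · have h1 : (a • A).PosDef := hA.1.smul ha'
      have h2 : (b • B).PosSemidef := hB.1.posSemidef.smul hb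
      exact h1.add_posSemidef h2
  refine ⟨hC, ?_⟩
  set C := a • A + b • B with hCdef
  set T := (mpow C (-p)).trace.re with hT
  by_contra! hlt
  have hs : 0 < 1 / p := by positivity
  have hexp : (-p - 1) * (1 / (1 + 1 / p)) = -p := by
    have : 0 < p + 1 := by linarith
    field_simp
    ring
  have hY : ∀ D : Matrix n n ℂ, D ∈ negSchattenBall n p →
      T ^ (1 + 1 / p) ≤ (mpow C (-p - 1) * D).trace.re := by
    intro D hD
    have := le_trace_mul_mpow_neg (posSemidef_mpow hC.posSemidef (-p - 1))
      (posSemidef_mpow hD.1.posSemidef (-p)) hD.2 hs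
      (by rw [kerProj_eq_zero (posDef_mpow hD.1 _), Matrix.mul_zero])
    rwa [mpow_inv_mpow hD.1.posSemidef (by field_simp), mpow_mpow hC.posSemidef, hexp] at this
  have hsum : T = a * (mpow C (-p - 1) * A).trace.re + b * (mpow C (-p - 1) * B).trace.re := by
    have h1 : (mpow C (-p - 1) * C).trace.re = T := by
      rw [Matrix.trace_mul_comm, trace_mpow_add_one hC.posSemidef _ (by linarith)]
      rw [hT]; congr 4; ring
    rw [← h1, hCdef, Matrix.mul_add, trace_add, Matrix.mul_smul, Matrix.mul_smul, trace_smul,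
      trace_smul, Complex.add_re, Complex.smul_re, Complex.smul_re, smul_eq_mul, smul_eq_mul]
  have hTle : T ^ (1 + 1 / p) ≤ T := by
    conv_rhs => rw [hsum]
    have := mul_le_mul_of_nonneg_left (hY A hA) ha
    have := mul_le_mul_of_nonneg_left (hY B hB) hb
    have e : T ^ (1 + 1 / p) = a * T ^ (1 + 1 / p) + b * T ^ (1 + 1 / p) := by
      rw [← add_mul, hab, one_mul]
    rw [e]; linarith
  have : T ^ (1 : ℝ) < T ^ (1 + 1 / p) := Real.rpow_lt_rpow_of_exponent_lt hlt (by linarith)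
  rw [Real.rpow_one] at this
  linarith

end ConvexCompact

/-! ### Pure tripartite vectors as matrices, and moving operators between marginals. -/

section Bipartite

variable {S B C : Type*} [Fintype S] [DecidableEq S] [Fintype B] [DecidableEq B] [Fintype C]
  [DecidableEq C]

/-- Regards a tripartite vector, given as an operator from `C` to `S B`, as an operator from `B` to
`S C`. -/
def flipMat (M : Matrix (S × B) C ℂ) : Matrix (S × C) B ℂ :=
  Matrix.of fun p b => M (p.1, b) p.2

@[simp] theorem flipMat_flipMat (M : Matrix (S × B) C ℂ) : flipMat (flipMat M) = M := rfl

theorem flipMat_kronecker_mul (X : Matrix B B ℂ) (M : Matrix (S × B) C ℂ) :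
    flipMat (((1 : Matrix S S ℂ) ⊗ₖ X) * M) = flipMat M * Xᵀ := by
  ext ⟨s, c⟩ b
  simp [flipMat, Matrix.mul_apply, Fintype.sum_prod_type, Matrix.one_apply, mul_comm]

theorem flipMat_mul (M : Matrix (S × B) C ℂ) (Y : Matrix C C ℂ) :
    flipMat (M * Y) = ((1 : Matrix S S ℂ) ⊗ₖ Yᵀ) * flipMat M := by
  rw [← flipMat_flipMat (((1 : Matrix S S ℂ) ⊗ₖ Yᵀ) * flipMat M), flipMat_kronecker_mul,
    flipMat_flipMat, transpose_transpose]

theorem trace_flipMat (M M' : Matrix (S × B) C ℂ) :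
    (flipMat M * (flipMat M')ᴴ).trace = (M * M'ᴴ).trace := by
  simp only [Matrix.trace, Matrix.diag_apply, Matrix.mul_apply, Fintype.sum_prod_type, flipMat,
    Matrix.of_apply, Matrix.conjTranspose_apply]
  exact Finset.sum_congr rfl fun s _ => Finset.sum_comm

theorem trFst_mul_conjTranspose (M M' : Matrix (S × B) C ℂ) :
    trFst (M * M'ᴴ) = ((flipMat M')ᴴ * flipMat M)ᵀ := by
  ext b b'
  simp [trFst, flipMat, Matrix.mul_apply, Fintype.sum_prod_type, mul_comm]

theorem trace_mul_one_kronecker (Z : Matrix (S × B) (S × B) ℂ) (Y : Matrix B B ℂ) :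
    (Z * ((1 : Matrix S S ℂ) ⊗ₖ Y)).trace = (trFst Z * Y).trace := by
  simp only [Matrix.trace, Matrix.diag_apply, Matrix.mul_apply, Fintype.sum_prod_type, trFst,
    Matrix.of_apply, Matrix.kronecker_apply, Matrix.one_apply, Finset.sum_mul]
  simp only [ite_mul, one_mul, zero_mul, mul_ite, mul_zero, Finset.sum_ite_irrel,
    Finset.sum_const_zero, Finset.sum_ite_eq', Finset.mem_univ, if_true]
  rw [Finset.sum_comm]
  exact Finset.sum_congr rfl fun b _ => Finset.sum_comm

theorem trace_trFst (Z : Matrix (S × B) (S × B) ℂ) : (trFst Z).trace = Z.trace := by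
  have := trace_mul_one_kronecker Z 1
  rwa [Matrix.one_kronecker_one, Matrix.mul_one, Matrix.mul_one, eq_comm] at this

theorem trFst_posSemidef {Z : Matrix (S × B) (S × B) ℂ} (hZ : Z.PosSemidef) :
    (trFst Z).PosSemidef := by
  have : trFst Z = ∑ s : S, Z.submatrix (fun b => (s, b)) (fun b => (s, b)) := by
    ext b b'
    simp [trFst, Matrix.sum_apply]
  rw [this]
  exact Matrix.posSemidef_sum _ fun s _ => hZ.submatrix _

theorem mpow_one_kronecker {X : Matrix B B ℂ} (hX : X.IsHermitian) (p : ℝ) :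
    mpow ((1 : Matrix S S ℂ) ⊗ₖ X) p = (1 : Matrix S S ℂ) ⊗ₖ mpow X p :=
  cfc_one_kronecker _ hX

theorem kerProj_one_kronecker {X : Matrix B B ℂ} (hX : X.IsHermitian) :
    kerProj ((1 : Matrix S S ℂ) ⊗ₖ X) = (1 : Matrix S S ℂ) ⊗ₖ kerProj X :=
  cfc_one_kronecker _ hX

theorem posSemidef_one_kronecker {X : Matrix B B ℂ} (hX : X.PosSemidef) :
    ((1 : Matrix S S ℂ) ⊗ₖ X).PosSemidef :=
  Matrix.PosSemidef.one.kronecker hX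

/-- Both conditions say that the same trace vanishes, before and after tracing out S. -/
theorem suppLE_one_kronecker_iff {Z : Matrix (S × B) (S × B) ℂ} (hZ : Z.PosSemidef)
    {τ : Matrix B B ℂ} (hτ : τ.PosSemidef) :
    SuppLE Z ((1 : Matrix S S ℂ) ⊗ₖ τ) ↔ trFst Z * kerProj τ = 0 := by
  rw [suppLE_iff' hZ.1 (isHermitian_one_kronecker hτ.1), kerProj_one_kronecker hτ.1,
    ← trace_mul_re_eq_zero hZ (posSemidef_one_kronecker (posSemidef_kerProj hτ.1)),
    ← trace_mul_re_eq_zero (trFst_posSemidef hZ) (posSemidef_kerProj hτ.1),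
    trace_mul_one_kronecker]

theorem mul_kerProj_self {n : Type*} [Fintype n] [DecidableEq n] {X : Matrix n n ℂ}
    (hX : X.IsHermitian) : X * kerProj X = 0 := by
  have h := congrArg conjTranspose (kerProj_mul_self hX)
  have hk : (kerProj X).IsHermitian := isHermitian_cfc _ X
  rwa [conjTranspose_mul, hX.eq, hk.eq, conjTranspose_zero] at h

theorem suppLE_one_kronecker_trFst {Z : Matrix (S × B) (S × B) ℂ} (hZ : Z.PosSemidef) :
    SuppLE Z ((1 : Matrix S S ℂ) ⊗ₖ trFst Z) :=
  (suppLE_one_kronecker_iff hZ (trFst_posSemidef hZ)).2 (mul_kerProj_self (trFst_posSemidef hZ).1)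

theorem cfc_mul_self_gram {m n : Type*} [Fintype m] [DecidableEq m] [Fintype n] [DecidableEq n]
    (M : Matrix m n ℂ) (f : ℝ → ℝ) : cfc f (M * Mᴴ) * M = M * cfc f (Mᴴ * M) :=
  cfc_mul_intertwine f (isHermitian_mul_conjTranspose_self M)
    (isHermitian_conjTranspose_mul_self M) (Matrix.mul_assoc _ _ _)

theorem cfc_id_mul {n : Type*} [Fintype n] [DecidableEq n] {X : Matrix n n ℂ}
    (hX : X.IsHermitian) (f : ℝ → ℝ) : cfc (fun x => f x * x) X = cfc f X * X := by
  conv_rhs => rw [← cfc_id_matrix hX, cfc_cfc _ _ hX, cfc_mul_cfc]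

/-- The two Gram matrices share their nonzero spectrum; `f 0 = 0` hides the different multiplicities
of zero. -/
theorem trace_cfc_gram {m n : Type*} [Fintype m] [DecidableEq m] [Fintype n] [DecidableEq n]
    (M : Matrix m n ℂ) {f : ℝ → ℝ} (hf : f 0 = 0) :
    (cfc f (M * Mᴴ)).trace = (cfc f (Mᴴ * M)).trace := by
  have e : f = fun x => f x / x * x := by
    funext x
    by_cases hx : x = 0
    · rw [hx, hf]; simp
    · field_simp
  rw [e, cfc_id_mul (isHermitian_mul_conjTranspose_self M) (fun x => f x / x),
    cfc_id_mul (isHermitian_conjTranspose_mul_self M) (fun x => f x / x), ← Matrix.mul_assoc,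
    cfc_mul_self_gram, Matrix.mul_assoc, Matrix.trace_mul_comm, Matrix.mul_assoc]

/-- The positive map `A ↦ Tr_S[M Aᵀ M†]` from operators on `C` to operators on `B`. -/
def sliceMap (M : Matrix (S × B) C ℂ) (A : Matrix C C ℂ) : Matrix B B ℂ :=
  trFst (M * Aᵀ * Mᴴ)

theorem sliceMap_posSemidef (M : Matrix (S × B) C ℂ) {A : Matrix C C ℂ} (hA : A.PosSemidef) :
    (sliceMap M A).PosSemidef :=
  trFst_posSemidef (hA.transpose.mul_mul_conjTranspose_same M)

/-- Both sides are the expectation of A on C and Y on B in the same vector, so the slice maps of `M`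
and `flipMat M` are adjoint. -/
theorem trace_sliceMap_mul (M : Matrix (S × B) C ℂ) (A : Matrix C C ℂ) (Y : Matrix B B ℂ) :
    (sliceMap M A * Y).trace = (sliceMap (flipMat M) Y * A).trace := by
  rw [sliceMap, sliceMap, ← trace_mul_one_kronecker, ← trace_mul_one_kronecker]
  have h1 : M * Aᵀ * Mᴴ * ((1 : Matrix S S ℂ) ⊗ₖ Y) =
      (M * Aᵀ) * (((1 : Matrix S S ℂ) ⊗ₖ Yᴴ) * M)ᴴ := by
    rw [conjTranspose_mul, conjTranspose_kronecker, conjTranspose_one, conjTranspose_conjTranspose,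
      Matrix.mul_assoc]
  have h2 : (Yᴴᵀ)ᴴ = Yᵀ := by
    ext i j
    simp
  rw [h1, ← trace_flipMat, flipMat_mul, flipMat_kronecker_mul, conjTranspose_mul,
    transpose_transpose, h2, ← Matrix.trace_mul_comm ((1 : Matrix S S ℂ) ⊗ₖ A)]
  simp only [Matrix.mul_assoc]

theorem trFst_gram (M : Matrix (S × B) C ℂ) :
    trFst (M * Mᴴ) = ((flipMat M)ᴴ * flipMat M)ᵀ := trFst_mul_conjTranspose M M

theorem cfc_trFst_gram (M : Matrix (S × B) C ℂ) (f : ℝ → ℝ) :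
    (cfc f (trFst (M * Mᴴ)))ᵀ = cfc f ((flipMat M)ᴴ * flipMat M) := by
  rw [trFst_gram, cfc_transpose f (isHermitian_conjTranspose_mul_self _), transpose_transpose]

theorem mul_cfc_trFst_mul (M : Matrix (S × B) C ℂ) (f : ℝ → ℝ) :
    flipMat M * (cfc f (trFst (M * Mᴴ)))ᵀ * (flipMat M)ᴴ =
      cfc (fun x => f x * x) (flipMat M * (flipMat M)ᴴ) := by
  rw [cfc_trFst_gram, ← cfc_mul_self_gram, Matrix.mul_assoc,
    cfc_id_mul (isHermitian_mul_conjTranspose_self _)]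

/-- The marginal on B is, up to transposition, the other Gram matrix of `flipMat M`; a function of
it can therefore be pulled through onto the state on SC. -/
theorem sliceMap_cfc_trFst (M : Matrix (S × B) C ℂ) (f : ℝ → ℝ) :
    sliceMap (flipMat M) (cfc f (trFst (M * Mᴴ))) =
      trFst (cfc (fun x => f x * x) (flipMat M * (flipMat M)ᴴ)) := by
  rw [sliceMap, mul_cfc_trFst_mul]

/-- Schmidt decomposition: the complementary marginals on SB and on C share their nonzero spectrum.
-/
theorem trace_cfc_gram_eq_trFst (M : Matrix (S × B) C ℂ) {f : ℝ → ℝ} (hf : f 0 = 0) :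
    (cfc f (M * Mᴴ)).trace = (cfc f (trFst (flipMat M * (flipMat M)ᴴ))).trace := by
  rw [trace_cfc_gram M hf, ← Matrix.trace_transpose (cfc f (trFst _)),
    cfc_trFst_gram (flipMat M), flipMat_flipMat]

/-- Sandwiching one marginal of a pure tripartite state by an operator on `B` has the same spectrum
as the corresponding slice on `C`. -/
theorem trace_cfc_sandwich (M : Matrix (S × B) C ℂ) {X : Matrix B B ℂ} (hX : X.IsHermitian)
    {f : ℝ → ℝ} (hf : f 0 = 0) :
    (cfc f (((1 : Matrix S S ℂ) ⊗ₖ X) * (M * Mᴴ) * ((1 : Matrix S S ℂ) ⊗ₖ X))).trace =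
      (cfc f (sliceMap (flipMat M) (X * X))).trace := by
  -- The sandwiched state is the SB marginal of the vector with X applied on B, so its spectrum can
  -- be read off on C.
  have h1 : ((1 : Matrix S S ℂ) ⊗ₖ X) * (M * Mᴴ) * ((1 : Matrix S S ℂ) ⊗ₖ X) =
      (((1 : Matrix S S ℂ) ⊗ₖ X) * M) * (((1 : Matrix S S ℂ) ⊗ₖ X) * M)ᴴ := by
    rw [conjTranspose_mul, (isHermitian_one_kronecker (m := S) hX).eq]
    simp only [Matrix.mul_assoc]
  rw [h1, trace_cfc_gram_eq_trFst _ hf, flipMat_kronecker_mul, sliceMap, conjTranspose_mul,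
    hX.transpose.eq, transpose_mul]
  simp only [Matrix.mul_assoc]

/-- Duality for trace functionals of Petz type. -/
theorem trace_cfc_mul_cfc_trFst (M : Matrix (S × B) C ℂ) (f g : ℝ → ℝ) :
    (cfc (fun x => f x * x) (M * Mᴴ) * ((1 : Matrix S S ℂ) ⊗ₖ cfc g (trFst (M * Mᴴ)))).trace =
      (cfc (fun x => g x * x) (flipMat M * (flipMat M)ᴴ) *
        ((1 : Matrix S S ℂ) ⊗ₖ cfc f (trFst (flipMat M * (flipMat M)ᴴ)))).trace := by
  rw [trace_mul_one_kronecker, trace_mul_one_kronecker, ← sliceMap_cfc_trFst,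
    ← trace_sliceMap_mul]
  have := sliceMap_cfc_trFst (flipMat M) f
  rw [flipMat_flipMat] at this
  rw [this]

end Bipartite

/-! ### Domains of finiteness and trace formulas for states. -/

section Divergence

variable {n : Type*} [Fintype n] [DecidableEq n]

theorem IsState.trace_re {ρ : Matrix n n ℂ} (h : IsState ρ) : ρ.trace.re = 1 := by
  rw [h.2, Complex.one_re]

theorem IsState.ne_zero {ρ : Matrix n n ℂ} (h : IsState ρ) : ρ ≠ 0 := by
  rintro rfl
  have := h.2
  simp at this

theorem mul_mpow_self {X : Matrix n n ℂ} (hX : X.PosSemidef) {p : ℝ} (hp : 1 + p ≠ 0) :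
    X * mpow X p = mpow X (1 + p) := by
  conv_lhs => rw [← mpow_one hX.1, mpow_mpow hX, one_mul,
    mpow_mul_mpow hX (fun h => absurd h hp)]

theorem suppLE_mpow_iff {ρ σ : Matrix n n ℂ} (hρ : ρ.PosSemidef) (hσ : σ.IsHermitian) {p : ℝ}
    (hp : p ≠ 0) : SuppLE (mpow ρ p) σ ↔ SuppLE ρ σ := by
  rw [suppLE_iff hσ, suppLE_iff hσ]
  constructor
  · intro h
    have : ρ = mpow ρ p * mpow ρ (1 - p) := by
      rw [mpow_mul_mpow hρ (fun h => absurd h (by simp)), add_sub_cancel, mpow_one hρ.1]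
    rw [this, ← Matrix.mul_assoc, h, Matrix.zero_mul]
  · intro h
    have : mpow ρ p = ρ * mpow ρ (p - 1) := by
      rw [mul_mpow_self hρ (by simpa using hp), add_sub_cancel]
    rw [this, ← Matrix.mul_assoc, h, Matrix.zero_mul]

theorem not_orthogonal_of_suppLE {ρ σ : Matrix n n ℂ} (hρ : ρ.IsHermitian) (hρ0 : ρ ≠ 0)
    (hσ : σ.IsHermitian) (h : SuppLE ρ σ) : ¬ Orthogonal ρ σ := by
  intro ho
  have h1 : σ * ρ = 0 := by
    have := congrArg conjTranspose (show ρ * σ = 0 from ho)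
    rwa [conjTranspose_mul, hρ.eq, hσ.eq, conjTranspose_zero] at this
  have h2 : kerProj σ + cfc (fun x : ℝ => x⁻¹) σ * σ = 1 := by
    conv_lhs => rw [← cfc_id_matrix hσ, kerProj, cfc_cfc _ _ hσ, cfc_cfc _ _ hσ, cfc_mul_cfc,
      ← cfc_add (a := σ) _ _ (continuousOn_spectrum _ _) (continuousOn_spectrum _ _)]
    rw [← cfc_const_one ℝ σ]
    exact cfc_congr fun x _ => by by_cases hx : x = 0 <;> simp [hx]
  apply hρ0
  rw [← Matrix.one_mul ρ, ← h2, Matrix.add_mul, (suppLE_iff hσ).1 h, Matrix.mul_assoc, h1]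
  simp

theorem finiteDomain_of_lt_one {a : ℝ} (ha : a < 1) {ρ σ : Matrix n n ℂ} (hρ : ρ.IsHermitian)
    (hρ0 : ρ ≠ 0) (hσ : σ.IsHermitian) : FiniteDomain a ρ σ ↔ ¬ Orthogonal ρ σ := by
  constructor
  · rintro (h | h)
    · exact h.2
    · exact not_orthogonal_of_suppLE hρ hρ0 hσ h
  · exact fun h => Or.inl ⟨ha, h⟩

theorem finiteDomain_of_one_lt {a : ℝ} (ha : 1 < a) {ρ σ : Matrix n n ℂ} :
    FiniteDomain a ρ σ ↔ SuppLE ρ σ := by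
  constructor
  · rintro (h | h)
    · linarith [h.1]
    · exact h
  · exact Or.inr

theorem petzReal_eq {a : ℝ} {ρ σ : Matrix n n ℂ} (h : FiniteDomain a ρ σ) (hρ : IsState ρ) :
    petzReal a ρ σ =
      ((1 / (a - 1) * Real.logb 2 (mpow ρ a * mpow σ (1 - a)).trace.re : ℝ) : EReal) := by
  rw [petzReal, if_pos h, hρ.trace_re, div_one]

theorem sandReal_eq {a : ℝ} {ρ σ : Matrix n n ℂ} (h : FiniteDomain a ρ σ) (hρ : IsState ρ) :
    sandReal a ρ σ = ((1 / (a - 1) * Real.logb 2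
      (mpow (mpow σ ((1 - a) / (2 * a)) * ρ * mpow σ ((1 - a) / (2 * a))) a).trace.re : ℝ) :
        EReal) := by
  rw [sandReal, if_pos h, hρ.trace_re, div_one]

theorem petz_trace_pos_of_not_orthogonal {a : ℝ} {ρ σ : Matrix n n ℂ} (hρ : ρ.PosSemidef)
    (hσ : σ.PosSemidef) (h : ¬ Orthogonal ρ σ) :
    0 < (mpow ρ a * mpow σ (1 - a)).trace.re := by
  have hρa := posSemidef_mpow hρ a
  have hσa := posSemidef_mpow hσ (1 - a)
  refine lt_of_le_of_ne (trace_mul_re_nonneg hρa hσa) fun h0 => h ?_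
  have h1 := (trace_mul_re_eq_zero hρa hσa).1 h0.symm
  obtain ⟨w, -, -, -, -, hz⟩ := exists_overlap hρ.1 hσ.1
  have h2 := hz (fun x => x) (fun x => x)
  rw [cfc_id_matrix hρ.1, cfc_id_matrix hσ.1] at h2
  refine h2.2 fun i j => ?_
  have h3 := (hz _ _).1 h1 i j
  rcases mul_eq_zero.1 h3 with h4 | h4
  · rcases mul_eq_zero.1 h4 with h5 | h5
    · rw [((Real.rpow_eq_zero_iff_of_nonneg (hρ.eigenvalues_nonneg i)).1 h5).1, zero_mul, zero_mul]
    · rw [((Real.rpow_eq_zero_iff_of_nonneg (hσ.eigenvalues_nonneg j)).1 h5).1, mul_zero, zero_mul]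
  · rw [h4, mul_zero]

end Divergence

/-! ### Divergences relative to the marginal, and von Neumann entropies. -/

section Marginals

variable {S B C : Type*} [Fintype S] [DecidableEq S] [Fintype B] [DecidableEq B] [Fintype C]
  [DecidableEq C]

theorem IsState.trFst {Z : Matrix (S × B) (S × B) ℂ} (hZ : IsState Z) :
    IsState (trFst Z) :=
  ⟨trFst_posSemidef hZ.1, by rw [trace_trFst, hZ.2]⟩

theorem IsState.flip {M : Matrix (S × B) C ℂ} (h : IsState (M * Mᴴ)) :
    IsState (flipMat M * (flipMat M)ᴴ) :=
  ⟨posSemidef_self_mul_conjTranspose _, by rw [trace_flipMat, h.2]⟩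

theorem sandReal_trFst (M : Matrix (S × B) C ℂ) (hM : IsState (M * Mᴴ)) {a : ℝ} (ha : 0 < a) :
    sandReal a (M * Mᴴ) ((1 : Matrix S S ℂ) ⊗ₖ trFst (M * Mᴴ)) =
      ((-closedForm a (flipMat M * (flipMat M)ᴴ) : ℝ) : EReal) := by
  have hB := hM.trFst
  rw [sandReal_eq (Or.inr (suppLE_one_kronecker_trFst hM.1)) hM, mpow_one_kronecker hB.1.1,
    closedForm]
  set x := (1 - a) / (2 * a) with hx
  -- The two outer powers of the marginal, moved to SC, meet one factor of the state there, which
  -- explains the exponent `1 / a`.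
  have hxx : x + x + 1 = 1 / a := by rw [hx]; field_simp; ring
  have h1 := trace_cfc_sandwich M (X := mpow (trFst (M * Mᴴ)) x) (isHermitian_cfc _ _)
    (f := fun t => t ^ a) (Real.zero_rpow ha.ne')
  have h2 : sliceMap (flipMat M) (mpow (trFst (M * Mᴴ)) (x + x)) =
      trFst (mpow (flipMat M * (flipMat M)ᴴ) (1 / a)) := by
    rw [mpow, sliceMap_cfc_trFst, mpow]
    congr 1
    refine cfc_congr_nonneg hM.flip.1 fun t ht => ?_
    rw [← hxx]
    rcases ht.eq_or_lt with rfl | ht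
    · rw [mul_zero, Real.zero_rpow]
      rw [hxx]; positivity
    · rw [Real.rpow_add_one ht.ne']
  rw [mpow_mul_mpow hB.1 (fun h => by linarith), h2] at h1
  change (mpow (_ * (M * Mᴴ) * _) a).trace = (mpow (trFst (mpow _ (1 / a))) a).trace at h1
  rw [h1, ← neg_mul, ← neg_sub 1 a, one_div_neg_eq_neg_one_div]

theorem petzReal_trFst (M : Matrix (S × B) C ℂ) (hM : IsState (M * Mᴴ)) {a : ℝ} (ha : a ≠ 0)
    (ha2 : a ≠ 2) :
    petzReal a (M * Mᴴ) ((1 : Matrix S S ℂ) ⊗ₖ trFst (M * Mᴴ)) =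
      -petzReal (2 - a) (flipMat M * (flipMat M)ᴴ)
        ((1 : Matrix S S ℂ) ⊗ₖ trFst (flipMat M * (flipMat M)ᴴ)) := by
  rw [petzReal_eq (Or.inr (suppLE_one_kronecker_trFst hM.1)) hM,
    petzReal_eq (Or.inr (suppLE_one_kronecker_trFst hM.flip.1)) hM.flip,
    mpow_one_kronecker hM.trFst.1.1, mpow_one_kronecker hM.flip.trFst.1.1, ← EReal.coe_neg,
    EReal.coe_eq_coe_iff]
  -- The extra factor of each state raises the exponents to `a` and `2 - a`. At exponent 0 this
  -- fails on the kernel, where `0 ^ 0 = 1`.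
  have h1 := trace_cfc_mul_cfc_trFst M (fun t => t ^ (a - 1)) (fun t => t ^ (1 - a))
  have key : ∀ p : ℝ, p + 1 ≠ 0 → ∀ t : ℝ, 0 ≤ t → t ^ p * t = t ^ (p + 1) := by
    intro p hp t ht
    rcases ht.eq_or_lt with rfl | ht
    · rw [mul_zero, Real.zero_rpow hp]
    · rw [Real.rpow_add_one ht.ne']
  rw [cfc_congr_nonneg (g := fun t => t ^ a) hM.1,
    cfc_congr_nonneg (g := fun t => t ^ (2 - a)) hM.flip.1] at h1
  · rw [mpow, mpow, mpow, mpow, h1, ← neg_mul]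
    have e1 : 1 - (2 - a) = a - 1 := by ring
    have e2 : 2 - a - 1 = -(a - 1) := by ring
    rw [e1, e2, one_div_neg_eq_neg_one_div, neg_neg]
  · intro t ht
    rw [key _ (by intro h; apply ha2; linarith) t ht]
    congr 1; ring
  · intro t ht
    rw [key _ (by simpa using ha) t ht]
    congr 1; ring

theorem mul_mlog_eq {n : Type*} [Fintype n] [DecidableEq n] {X : Matrix n n ℂ}
    (hX : X.IsHermitian) : X * mlog X = cfc (fun x => x * Real.logb 2 x) X := by
  rw [mlog]
  conv_lhs =>
    enter [1]
    rw [← cfc_id_matrix hX]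
  rw [cfc_mul_cfc]

theorem entropy_flip (M : Matrix (S × B) C ℂ) :
    entropy (M * Mᴴ) = entropy (trFst (flipMat M * (flipMat M)ᴴ)) := by
  have h1 := trace_cfc_gram_eq_trFst M (f := fun x => x * Real.logb 2 x) (by simp)
  have h2 : (trFst (flipMat M * (flipMat M)ᴴ)).IsHermitian :=
    (trFst_posSemidef (posSemidef_self_mul_conjTranspose _)).1
  rw [entropy, entropy, mul_mlog_eq h2, mul_mlog_eq (isHermitian_mul_conjTranspose_self M), h1]

/-- For a pure vector H(SB) = H(C) and H(B) = H(SC). -/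
theorem condEntropy_flip (M : Matrix (S × B) C ℂ) :
    condEntropy (M * Mᴴ) = -condEntropy (flipMat M * (flipMat M)ᴴ) := by
  have h1 := entropy_flip M
  have h2 := entropy_flip (flipMat M)
  rw [flipMat_flipMat] at h2
  rw [condEntropy, condEntropy, h1, h2]
  ring

theorem mlog_one_kronecker {X : Matrix B B ℂ} (hX : X.IsHermitian) :
    mlog ((1 : Matrix S S ℂ) ⊗ₖ X) = (1 : Matrix S S ℂ) ⊗ₖ mlog X :=
  cfc_one_kronecker _ hX

theorem relEntropy_eq {Z : Matrix (S × B) (S × B) ℂ} (hZ : IsState Z) {τ : Matrix B B ℂ}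
    (hτ : τ.PosSemidef) (h : SuppLE Z ((1 : Matrix S S ℂ) ⊗ₖ τ)) :
    relEntropy Z ((1 : Matrix S S ℂ) ⊗ₖ τ) =
      ((-entropy Z - (trFst Z * mlog τ).trace.re : ℝ) : EReal) := by
  rw [relEntropy, if_pos h, hZ.trace_re, div_one, Matrix.mul_sub, trace_sub, Complex.sub_re,
    mlog_one_kronecker hτ.1, trace_mul_one_kronecker, entropy, neg_neg]

theorem relEntropy_trFst {Z : Matrix (S × B) (S × B) ℂ} (hZ : IsState Z) :
    relEntropy Z ((1 : Matrix S S ℂ) ⊗ₖ trFst Z) = ((-condEntropy Z : ℝ) : EReal) := by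
  rw [relEntropy_eq hZ hZ.trFst.1 (suppLE_one_kronecker_trFst hZ.1), condEntropy, entropy, entropy]
  congr 1
  ring

/-- Klein's inequality. -/
theorem trace_mul_mlog_le {n : Type*} [Fintype n] [DecidableEq n] {ρ τ : Matrix n n ℂ}
    (hρ : IsState ρ) (hτ : IsState τ) (h : ρ * kerProj τ = 0) :
    (ρ * mlog τ).trace.re ≤ (ρ * mlog ρ).trace.re := by
  have hz : cfc (fun x : ℝ => x) ρ * cfc (fun y : ℝ => if y = 0 then (1 : ℝ) else 0) τ = 0 := by
    rw [cfc_id_matrix hρ.1.1]; exact h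
  have hl2 : 0 < Real.log 2 := Real.log_pos (by norm_num)
  have key := trace_cfc_mul_cfc_le hρ.1.1 hτ.1.1 (f := fun x => x) (g := fun y => Real.logb 2 y)
    -- From `log t ≤ t - 1` at `t = y / x`; the two linear terms cancel because both traces are 1.
    (h := fun x => x * Real.logb 2 x + (-(Real.log 2)⁻¹) * x)
    (k := fun y => (Real.log 2)⁻¹ * y) hz ?_
  · rw [cfc_id_matrix hρ.1.1, cfc_add (a := ρ) _ _ (continuousOn_spectrum _ _)
      (continuousOn_spectrum _ _), cfc_const_smul, cfc_const_smul, ← cfc_mul_cfc,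
      cfc_id_matrix hρ.1.1, cfc_id_matrix hτ.1.1, trace_add, trace_smul, trace_smul,
      Complex.add_re, Complex.smul_re, Complex.smul_re, hρ.trace_re, hτ.trace_re] at key
    simp only [smul_eq_mul, mul_one, neg_add_cancel_right] at key
    exact key
  · intro i j hij
    set x := hρ.1.1.eigenvalues i
    set y := hτ.1.1.eigenvalues j
    have hx : 0 ≤ x := hρ.1.eigenvalues_nonneg i
    have hy : 0 ≤ y := hτ.1.eigenvalues_nonneg j
    rcases hx.eq_or_lt with hx0 | hx0
    · rw [← hx0]
      simpa using mul_nonneg (inv_nonneg.2 hl2.le) hy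
    · have hy0 : 0 < y := by
        refine lt_of_le_of_ne hy fun h0 => ?_
        rw [← h0] at hij
        simp at hij
        exact hx0.ne' hij
      have h1 := Real.log_le_sub_one_of_pos (div_pos hy0 hx0)
      rw [Real.log_div hy0.ne' hx0.ne'] at h1
      have h2 : x * (Real.log y - Real.log x) ≤ y - x := by
        calc _ ≤ x * (y / x - 1) := mul_le_mul_of_nonneg_left h1 hx
          _ = _ := by field_simp
      have h3 := mul_le_mul_of_nonneg_left h2 (inv_nonneg.2 hl2.le)
      simp only [Real.logb, div_eq_mul_inv]
      nlinarith

theorem iInf_relEntropy {Z : Matrix (S × B) (S × B) ℂ} (hZ : IsState Z) :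
    ⨅ τ : {τ : Matrix B B ℂ // IsState τ}, relEntropy Z ((1 : Matrix S S ℂ) ⊗ₖ τ.1) =
      ((-condEntropy Z : ℝ) : EReal) := by
  refine le_antisymm ?_ (le_iInf fun τ => ?_)
  · rw [← relEntropy_trFst hZ]
    exact iInf_le (fun τ : {τ : Matrix B B ℂ // IsState τ} =>
      relEntropy Z ((1 : Matrix S S ℂ) ⊗ₖ τ.1)) ⟨trFst Z, hZ.trFst⟩
  · by_cases h : SuppLE Z ((1 : Matrix S S ℂ) ⊗ₖ τ.1)
    · rw [relEntropy_eq hZ τ.2.1 h, EReal.coe_le_coe_iff, condEntropy]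
      have := trace_mul_mlog_le hZ.trFst τ.2 ((suppLE_one_kronecker_iff hZ.1 τ.2.1).1 h)
      rw [entropy.eq_1 (trFst Z)]
      linarith
    · rw [relEntropy, if_neg h]
      exact le_top

end Marginals

/-! ### The optimized Petz divergence in closed form. -/

section PetzOptimization

variable {S B : Type*} [Fintype S] [DecidableEq S] [Fintype B] [DecidableEq B]

theorem trFst_mpow_ne_zero {Z : Matrix (S × B) (S × B) ℂ} (hZ : IsState Z) (b : ℝ) :
    trFst (mpow Z b) ≠ 0 := by
  intro h
  have h1 := trace_mpow_pos hZ.1 hZ.ne_zero b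
  rw [← trace_trFst, h] at h1
  simp at h1

theorem trace_petz_one_kronecker (Z : Matrix (S × B) (S × B) ℂ) {τ : Matrix B B ℂ}
    (hτ : τ.IsHermitian) (b c : ℝ) :
    (mpow Z b * mpow ((1 : Matrix S S ℂ) ⊗ₖ τ) c).trace.re =
      (trFst (mpow Z b) * mpow τ c).trace.re := by
  rw [mpow_one_kronecker hτ, trace_mul_one_kronecker]

theorem closedForm_one_div {Z : Matrix (S × B) (S × B) ℂ} (hZ : IsState Z) {b : ℝ} (hb : 0 < b)
    (hb1 : b ≠ 1) :
    closedForm (1 / b) Z =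
      1 / (b - 1) * Real.logb 2 ((mpow (trFst (mpow Z b)) (1 / b)).trace.re ^ b) := by
  have hX := trFst_posSemidef (posSemidef_mpow hZ.1 b)
  rw [closedForm, one_div_one_div, Real.logb_rpow_eq_mul_logb_of_pos
    (trace_mpow_pos hX (trFst_mpow_ne_zero hZ b) _)]
  have : b - 1 ≠ 0 := sub_ne_zero.2 hb1
  rw [← mul_assoc]
  congr 1
  field_simp

/-- After tracing out S this is Hölder with `s = 1 - b` for `b < 1`, and reverse Hölder with `s = b
- 1` for `b > 1`; the sign of the prefactor changes along with the inequality. -/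
theorem closedForm_le_petzReal {Z : Matrix (S × B) (S × B) ℂ} (hZ : IsState Z) {b : ℝ}
    (hb : 0 < b) (hb1 : b ≠ 1) {τ : Matrix B B ℂ} (hτ : IsState τ) :
    ((closedForm (1 / b) Z : ℝ) : EReal) ≤ petzReal b Z ((1 : Matrix S S ℂ) ⊗ₖ τ) := by
  by_cases hfin : FiniteDomain b Z ((1 : Matrix S S ℂ) ⊗ₖ τ)
  swap
  · rw [petzReal, if_neg hfin]; exact le_top
  have hσ := posSemidef_one_kronecker (S := S) hτ.1
  have hZb := posSemidef_mpow hZ.1 b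
  have hX := trFst_posSemidef hZb
  rw [petzReal_eq hfin hZ, closedForm_one_div hZ hb hb1, EReal.coe_le_coe_iff,
    trace_petz_one_kronecker Z hτ.1.1]
  rcases lt_or_gt_of_ne hb1 with h | h
  · have hpos := petz_trace_pos_of_not_orthogonal (a := b) hZ.1 hσ
      ((finiteDomain_of_lt_one h hZ.1.1 hZ.ne_zero hσ.1).1 hfin)
    rw [trace_petz_one_kronecker Z hτ.1.1] at hpos
    refine mul_le_mul_of_nonpos_left ?_ (one_div_nonpos.2 (by linarith))
    refine Real.logb_le_logb_of_le (by norm_num) hpos ?_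
    have := trace_mul_mpow_le hX hτ.1 hτ.trace_re.le (s := 1 - b) (by linarith) (by linarith)
    rwa [sub_sub_cancel] at this
  · refine mul_le_mul_of_nonneg_left ?_ (one_div_nonneg.2 (by linarith))
    refine Real.logb_le_logb_of_le (by norm_num)
      (Real.rpow_pos_of_pos (trace_mpow_pos hX (trFst_mpow_ne_zero hZ b) _) _) ?_
    have hs := (finiteDomain_of_one_lt h).1 hfin
    rw [← suppLE_mpow_iff hZ.1 hσ.1 hb.ne', suppLE_one_kronecker_iff hZb hτ.1] at hs
    have := le_trace_mul_mpow_neg hX hτ.1 hτ.trace_re.le (s := b - 1) (by linarith) hs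
    rwa [add_sub_cancel, neg_sub] at this

/-- The state proportional to a power of a nonzero positive operator. -/
theorem isState_normalize {X : Matrix B B ℂ} (hX : X.PosSemidef) (hX0 : X ≠ 0) :
    IsState ((1 / X.trace.re) • X) := by
  have hT := trace_re_pos hX hX0
  refine ⟨hX.smul (one_div_nonneg.2 hT.le), ?_⟩
  have him : X.trace = ((X.trace.re : ℝ) : ℂ) := by
    refine Complex.ext rfl ?_
    rw [Complex.ofReal_im]
    exact ((Complex.le_def.1 hX.trace_nonneg).2).symm
  rw [trace_smul, him, Complex.ofReal_re, Complex.real_smul, ← Complex.ofReal_mul,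
    one_div_mul_cancel hT.ne', Complex.ofReal_one]

theorem kerProj_smul_mpow {X : Matrix B B ℂ} (hX : X.PosSemidef) {c : ℝ} (hc : 0 < c) {p : ℝ}
    (hp : p ≠ 0) : kerProj (c • mpow X p) = kerProj X := by
  rw [mpow, ← cfc_const_smul, kerProj, kerProj, cfc_cfc _ _ hX.1]
  refine cfc_congr_nonneg hX fun x hx => ?_
  simp [hc.ne', Real.rpow_eq_zero_iff_of_nonneg hx, hp]

/-- The optimizer is the equality case of Hölder, τ proportional to (Tr_S Z^b)^(1/b). -/
theorem exists_petzReal_eq_closedForm {Z : Matrix (S × B) (S × B) ℂ} (hZ : IsState Z) {b : ℝ}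
    (hb : 0 < b) (hb1 : b ≠ 1) :
    ∃ τ : Matrix B B ℂ, IsState τ ∧
      petzReal b Z ((1 : Matrix S S ℂ) ⊗ₖ τ) = ((closedForm (1 / b) Z : ℝ) : EReal) := by
  have hZb := posSemidef_mpow hZ.1 b
  have hX := trFst_posSemidef hZb
  have hX0 := trFst_mpow_ne_zero hZ b
  set X := trFst (mpow Z b) with hXdef
  have hXp := posSemidef_mpow hX (1 / b)
  set T := (mpow X (1 / b)).trace.re with hT
  have hTpos : 0 < T := trace_mpow_pos hX hX0 _
  set τ := (1 / T) • mpow X (1 / b) with hτdef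
  have hτ : IsState τ := isState_normalize hXp (mpow_ne_zero hX hX0 _)
  have hσ := posSemidef_one_kronecker (S := S) hτ.1
  refine ⟨τ, hτ, ?_⟩
  have hs : SuppLE Z ((1 : Matrix S S ℂ) ⊗ₖ τ) := by
    rw [← suppLE_mpow_iff hZ.1 hσ.1 hb.ne', suppLE_one_kronecker_iff hZb hτ.1, hτdef,
      kerProj_smul_mpow hX (by positivity) (by positivity)]
    exact mul_kerProj_self hX.1
  rw [petzReal_eq (Or.inr hs) hZ, closedForm_one_div hZ hb hb1, trace_petz_one_kronecker Z hτ.1.1]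
  congr 3
  rw [hτdef, mpow_smul hXp (by positivity), mpow_mpow hX, Matrix.mul_smul, trace_smul,
    Complex.smul_re]
  have e1 : 1 / b * (1 - b) + 1 ≠ 0 := by
    have : 1 / b * (1 - b) + 1 = 1 / b := by field_simp; ring
    rw [this]; positivity
  have e2 : 1 + 1 / b * (1 - b) = 1 / b := by field_simp; ring
  rw [trace_mpow_add_one hX _ e1, e2, ← hT, smul_eq_mul, one_div, Real.inv_rpow hTpos.le,
    ← Real.rpow_neg hTpos.le, neg_sub, ← Real.rpow_add_one hTpos.ne', sub_add_cancel]

theorem iInf_petzReal {Z : Matrix (S × B) (S × B) ℂ} (hZ : IsState Z) {b : ℝ}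
    (hb : 0 < b) (hb1 : b ≠ 1) :
    ⨅ τ : {τ : Matrix B B ℂ // IsState τ}, petzReal b Z ((1 : Matrix S S ℂ) ⊗ₖ τ.1) =
      ((closedForm (1 / b) Z : ℝ) : EReal) := by
  obtain ⟨τ, hτ, h⟩ := exists_petzReal_eq_closedForm (S := S) hZ hb hb1
  refine le_antisymm ?_ (le_iInf fun τ => closedForm_le_petzReal hZ hb hb1 τ.2)
  rw [← h]
  exact iInf_le (fun τ : {τ : Matrix B B ℂ // IsState τ} =>
    petzReal b Z ((1 : Matrix S S ℂ) ⊗ₖ τ.1)) ⟨τ, hτ⟩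

end PetzOptimization

/-! ### Power means of a subnormalized distribution. -/

section PowerSums

variable {ι : Type*} [Fintype ι]

/-- Jensen for the concave power `t`, proved termwise by AM-GM of `r ^ c / q` and 1. Missing mass
only helps. -/
theorem sum_rpow_mul_le {p r : ι → ℝ} (hp : ∀ k, 0 ≤ p k) (hr : ∀ k, 0 < r k) (hp1 : ∑ k, p k ≤ 1)
    (hp0 : 0 < ∑ k, p k) {t : ℝ} (ht : 0 < t) (ht1 : t < 1) (c : ℝ) :
    ∑ k, p k * r k ^ (t * c) ≤ (∑ k, p k * r k ^ c) ^ t := by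
  set q := ∑ k, p k * r k ^ c with hq
  have hqpos : 0 < q := by
    obtain ⟨k, -, hk⟩ := Finset.exists_lt_of_sum_lt (f := fun _ : ι => (0 : ℝ)) (g := p)
      (s := Finset.univ) (by simpa using hp0)
    exact Finset.sum_pos' (fun k _ => mul_nonneg (hp k) (Real.rpow_pos_of_pos (hr k) _).le)
      ⟨k, Finset.mem_univ k, mul_pos hk (Real.rpow_pos_of_pos (hr k) _)⟩
  have hqt : 0 < q ^ t := Real.rpow_pos_of_pos hqpos _
  have hterm : ∀ k, p k * r k ^ (t * c) ≤ q ^ t * (t / q) * (p k * r k ^ c) +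
      q ^ t * (1 - t) * p k := by
    intro k
    have hrc : 0 < r k ^ c := Real.rpow_pos_of_pos (hr k) _
    have am := Real.geom_mean_le_arith_mean2_weighted ht.le (by linarith : 0 ≤ 1 - t)
      (div_pos hrc hqpos).le zero_le_one (by ring)
    rw [Real.one_rpow, mul_one, mul_one, Real.div_rpow hrc.le hqpos.le, ← Real.rpow_mul (hr k).le,
      mul_comm c t] at am
    have := mul_le_mul_of_nonneg_left am (mul_nonneg hqt.le (hp k))
    calc p k * r k ^ (t * c) = q ^ t * p k * (r k ^ (t * c) / q ^ t) := by field_simp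
      _ ≤ _ := this
      _ = _ := by ring
  calc ∑ k, p k * r k ^ (t * c) ≤ ∑ k, (q ^ t * (t / q) * (p k * r k ^ c) +
      q ^ t * (1 - t) * p k) := Finset.sum_le_sum fun k _ => hterm k
    _ = q ^ t * (t / q) * q + q ^ t * (1 - t) * ∑ k, p k := by
      rw [Finset.sum_add_distrib, ← Finset.mul_sum, ← Finset.mul_sum]
    _ ≤ q ^ t := by
      have e : q ^ t * (t / q) * q = q ^ t * t := by field_simp
      rw [e]
      nlinarith [mul_le_mul_of_nonneg_left hp1 (mul_nonneg hqt.le (by linarith : 0 ≤ 1 - t))]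

theorem sum_mul_rpow_pos {p r : ι → ℝ} (hp : ∀ k, 0 ≤ p k) (hr : ∀ k, 0 < r k)
    (hp0 : 0 < ∑ k, p k) (c : ℝ) : 0 < ∑ k, p k * r k ^ c := by
  obtain ⟨k, -, hk⟩ := Finset.exists_lt_of_sum_lt (f := fun _ : ι => (0 : ℝ)) (g := p)
    (s := Finset.univ) (by simpa using hp0)
  exact Finset.sum_pos' (fun k _ => mul_nonneg (hp k) (Real.rpow_pos_of_pos (hr k) _).le)
    ⟨k, Finset.mem_univ k, mul_pos hk (Real.rpow_pos_of_pos (hr k) _)⟩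

theorem hasDerivAt_sum_mul_rpow {p r : ι → ℝ} (hr : ∀ k, 0 < r k) (c : ℝ) :
    HasDerivAt (fun c : ℝ => ∑ k, p k * r k ^ c) (∑ k, p k * (r k ^ c * Real.log (r k))) c := by
  refine HasDerivAt.fun_sum fun k _ => HasDerivAt.const_mul _ ?_
  exact (Real.hasStrictDerivAt_const_rpow (hr k) c).hasDerivAt

/-- The limit is the derivative at 0 of the logarithmic moment function, which vanishes there
because the mass is 1. -/
theorem tendsto_logb_sum_div {p r : ι → ℝ} (hr : ∀ k, 0 < r k) (hp1 : ∑ k, p k = 1) :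
    Tendsto (fun c : ℝ => 1 / c * Real.logb 2 (∑ k, p k * r k ^ c)) (𝓝[≠] 0)
      (𝓝 (∑ k, p k * Real.logb 2 (r k))) := by
  have h0 : ∑ k, p k * r k ^ (0 : ℝ) = 1 := by simpa using hp1
  have h1 := (hasDerivAt_sum_mul_rpow (p := p) hr 0).log (by rw [h0]; norm_num)
  have h2 := (h1.div_const (Real.log 2))
  have h3 := hasDerivAt_iff_tendsto_slope_zero.1 h2
  refine (h3.congr fun c => ?_).trans (le_of_eq ?_)
  · rw [zero_add, h0, Real.log_one, zero_div, sub_zero, smul_eq_mul, one_div, Real.logb]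
  · congr 1
    rw [h0, div_one, Finset.sum_div]
    refine Finset.sum_congr rfl fun k _ => ?_
    rw [Real.rpow_zero, one_mul, mul_div_assoc, Real.logb]

end PowerSums

/-! ### Dependence of the Petz divergence on its order. -/

section PetzOrder

variable {n : Type*} [Fintype n] [DecidableEq n]

/-- The Petz divergence of two operators is the Rényi divergence of a pair of (Nussbaum–Szkoła)
distributions; `r` is their density and `p` the first of them, restricted to the support of the
second. -/
theorem exists_petz_weights {ρ σ : Matrix n n ℂ} (hρ : IsState ρ) (hσ : σ.PosSemidef) :
    ∃ p r : n × n → ℝ, (∀ k, 0 ≤ p k) ∧ (∀ k, 0 < r k) ∧ ∑ k, p k ≤ 1 ∧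
      (∀ b : ℝ, b ≠ 0 → b ≠ 1 →
        (mpow ρ b * mpow σ (1 - b)).trace.re = ∑ k, p k * r k ^ (b - 1)) ∧
      (SuppLE ρ σ ↔ ∑ k, p k = 1) ∧ (Orthogonal ρ σ ↔ ∑ k, p k = 0) ∧
      (SuppLE ρ σ → (ρ * (mlog ρ - mlog σ)).trace.re = ∑ k, p k * Real.logb 2 (r k)) := by
  obtain ⟨w, hw, hw1, hw2, htr, hz⟩ := exists_overlap hρ.1.1 hσ.1
  set x := hρ.1.1.eigenvalues with hxdef
  set y := hσ.1.eigenvalues with hydef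
  have hx : ∀ i, 0 ≤ x i := hρ.1.eigenvalues_nonneg
  have hy : ∀ j, 0 ≤ y j := hσ.eigenvalues_nonneg
  have hxw : ∑ i, ∑ j, x i * w i j = 1 := by
    simp only [← Finset.mul_sum, hw1, mul_one]
    have := trace_cfc_re (fun x => x) hρ.1.1
    rw [cfc_id_matrix hρ.1.1, hρ.trace_re] at this
    exact this.symm
  -- Mass off the support of σ is discarded, so total mass 1 detects support inclusion and total
  -- mass 0 orthogonality. Where the ratio is meaningless `r` is set to 1, to stay positive.
  let p : n × n → ℝ := fun k => if y k.2 = 0 then 0 else x k.1 * w k.1 k.2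
  let r : n × n → ℝ := fun k => if x k.1 = 0 ∨ y k.2 = 0 then 1 else x k.1 / y k.2
  have hp : ∀ k, 0 ≤ p k := fun k => by
    simp only [p]; split_ifs
    · exact le_rfl
    · exact mul_nonneg (hx _) (hw _ _)
  have hple : ∀ i j, p (i, j) ≤ x i * w i j := fun i j => by
    simp only [p]; split_ifs
    · exact mul_nonneg (hx _) (hw _ _)
    · exact le_rfl
  have hsupp : SuppLE ρ σ ↔ ∀ i j, p (i, j) = x i * w i j := by
    rw [suppLE_iff' hρ.1.1 hσ.1]
    have h := hz (fun x => x) (fun y => if y = 0 then 1 else 0)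
    rw [cfc_id_matrix hρ.1.1] at h
    rw [kerProj, h]
    refine forall_congr' fun i => forall_congr' fun j => ?_
    simp only [p]
    by_cases hj : y j = 0
    · simp [hj, eq_comm]
    · simp [hj]
  refine ⟨p, r, hp, fun k => ?_, ?_, ?_, ?_, ?_, ?_⟩
  · simp only [r]; split_ifs with h
    · exact one_pos
    · push Not at h
      exact div_pos (lt_of_le_of_ne (hx _) h.1.symm) (lt_of_le_of_ne (hy _) h.2.symm)
  · rw [Fintype.sum_prod_type, ← hxw]
    exact Finset.sum_le_sum fun i _ => Finset.sum_le_sum fun j _ => hple i j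
  · intro b hb hb1
    rw [mpow, mpow, htr, Fintype.sum_prod_type]
    refine Finset.sum_congr rfl fun i _ => Finset.sum_congr rfl fun j _ => ?_
    simp only [p, r]
    rcases (hx i).eq_or_lt with hi | hi
    · rw [← hi, Real.zero_rpow hb]; simp
    · rcases (hy j).eq_or_lt with hj | hj
      · rw [← hj, Real.zero_rpow (sub_ne_zero.2 hb1.symm)]; simp
      · simp only [hi.ne', hj.ne', or_self, if_false]
        rw [Real.div_rpow hi.le hj.le, Real.rpow_sub_one hi.ne', ← neg_sub 1 b,
          Real.rpow_neg hj.le]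
        field_simp
  · rw [hsupp]
    constructor
    · intro h
      rw [Fintype.sum_prod_type, ← hxw]
      exact Finset.sum_congr rfl fun i _ => Finset.sum_congr rfl fun j _ => h i j
    · intro h i j
      have h1 : ∑ k : n × n, (x k.1 * w k.1 k.2 - p k) = 0 := by
        rw [Finset.sum_sub_distrib, h, Fintype.sum_prod_type, hxw, sub_self]
      have := (Finset.sum_eq_zero_iff_of_nonneg
        (fun k _ => sub_nonneg.2 (hple k.1 k.2))).1 h1 (i, j) (Finset.mem_univ _)
      linarith
  · have h := hz (fun x => x) (fun y => y)
    rw [cfc_id_matrix hρ.1.1, cfc_id_matrix hσ.1] at h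
    rw [Orthogonal, h, Finset.sum_eq_zero_iff_of_nonneg (fun k _ => hp k)]
    constructor
    · rintro h ⟨i, j⟩ -
      have := h i j
      simp only [p]
      split_ifs with hj
      · rfl
      · rw [mul_right_comm] at this
        exact (mul_eq_zero.1 this).resolve_right hj
    · intro h i j
      have := h (i, j) (Finset.mem_univ _)
      simp only [p] at this
      split_ifs at this with hj
      · change x i * y j * w i j = 0
        rw [hj]; simp
      · change x i * y j * w i j = 0
        rw [mul_right_comm, this, zero_mul]
  · intro hs
    have hs' := hsupp.1 hs
    rw [Matrix.mul_sub, trace_sub, Complex.sub_re]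
    have h1 := htr (fun x => x * Real.logb 2 x) (fun _ => 1)
    have h2 := htr (fun x => x) (fun y => Real.logb 2 y)
    have hsa : IsSelfAdjoint σ := hσ.1
    rw [cfc_const_one ℝ σ, Matrix.mul_one, ← mul_mlog_eq hρ.1.1] at h1
    rw [cfc_id_matrix hρ.1.1] at h2
    rw [h1, mlog, h2, ← Finset.sum_sub_distrib, Fintype.sum_prod_type]
    refine Finset.sum_congr rfl fun i _ => ?_
    rw [← Finset.sum_sub_distrib]
    refine Finset.sum_congr rfl fun j _ => ?_
    have hij := hs' i j
    change x i * Real.logb 2 (x i) * 1 * w i j - x i * Real.logb 2 (y j) * w i j = _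
    rw [hij]
    by_cases hi : x i = 0
    · simp [hi]
    · by_cases hj : y j = 0
      · have : x i * w i j = 0 := by rw [← hij]; simp [p, hj]
        linear_combination (Real.logb 2 (x i) - Real.logb 2 (y j) - Real.logb 2 (r (i, j))) * this
      · simp only [r, hi, hj, or_self, if_false]
        rw [Real.logb_div hi hj]
        ring

/-- Jensen with ratio `(1 - b') / (1 - b)`; the negative prefactor reverses it. -/
theorem petzReal_monotoneOn_Ioo {ρ σ : Matrix n n ℂ} (hρ : IsState ρ) (hσ : σ.PosSemidef) :
    MonotoneOn (fun b => petzReal b ρ σ) (Set.Ioo 0 1) := by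
  obtain ⟨p, r, hp, hr, hp1, hQ, hs, ho, -⟩ := exists_petz_weights hρ hσ
  intro b hb b' hb' hbb
  simp only
  by_cases hor : Orthogonal ρ σ
  · rw [petzReal.eq_1 b', if_neg]
    · exact le_top
    · rw [finiteDomain_of_lt_one hb'.2 hρ.1.1 hρ.ne_zero hσ.1]
      exact not_not.2 hor
  have hp0 : 0 < ∑ k, p k := lt_of_le_of_ne (Finset.sum_nonneg fun k _ => hp k)
    (fun h => hor (ho.2 h.symm))
  rcases hbb.eq_or_lt with rfl | hlt
  · exact le_rfl
  rw [petzReal_eq (Or.inl ⟨hb.2, hor⟩) hρ, petzReal_eq (Or.inl ⟨hb'.2, hor⟩) hρ,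
    hQ b hb.1.ne' hb.2.ne, hQ b' hb'.1.ne' hb'.2.ne, EReal.coe_le_coe_iff]
  have h1b : 0 < 1 - b := by linarith [hb.2]
  have h1b' : 0 < 1 - b' := by linarith [hb'.2]
  have h := sum_rpow_mul_le hp hr hp1 hp0 (t := (1 - b') / (1 - b)) (by positivity)
    (by rw [div_lt_one h1b]; linarith) (b - 1)
  have e : (1 - b') / (1 - b) * (b - 1) = b' - 1 := by field_simp; ring
  rw [e] at h
  have hq := sum_mul_rpow_pos hp hr hp0 (b - 1)
  have hl := Real.logb_le_logb_of_le (b := 2) (by norm_num)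
    (sum_mul_rpow_pos hp hr hp0 (b' - 1)) h
  rw [Real.logb_rpow_eq_mul_logb_of_pos hq] at hl
  have := mul_le_mul_of_nonpos_left hl (one_div_nonpos.2 (by linarith : b' - 1 ≤ 0))
  refine le_trans (le_of_eq ?_) this
  rw [← mul_assoc]
  congr 1
  rw [← neg_sub 1 b, ← neg_sub 1 b']
  field_simp

theorem petzReal_monotoneOn_Ioi {ρ σ : Matrix n n ℂ} (hρ : IsState ρ) (hσ : σ.PosSemidef) :
    MonotoneOn (fun b => petzReal b ρ σ) (Set.Ioi 1) := by
  obtain ⟨p, r, hp, hr, hp1, hQ, hs, ho, -⟩ := exists_petz_weights hρ hσ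
  intro b hb b' hb' hbb
  have hb : 1 < b := hb
  have hb' : 1 < b' := hb'
  simp only
  by_cases hsl : SuppLE ρ σ
  swap
  · rw [petzReal.eq_1 b', if_neg]
    · exact le_top
    · rwa [finiteDomain_of_one_lt hb']
  have hp0 : 0 < ∑ k, p k := by rw [hs.1 hsl]; exact one_pos
  rcases hbb.eq_or_lt with rfl | hlt
  · exact le_rfl
  rw [petzReal_eq (Or.inr hsl) hρ, petzReal_eq (Or.inr hsl) hρ,
    hQ b (by linarith) hb.ne', hQ b' (by linarith) hb'.ne', EReal.coe_le_coe_iff]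
  have h1b : 0 < b - 1 := by linarith
  have h1b' : 0 < b' - 1 := by linarith
  have h := sum_rpow_mul_le hp hr hp1 hp0 (t := (b - 1) / (b' - 1)) (by positivity)
    (by rw [div_lt_one h1b']; linarith) (b' - 1)
  rw [div_mul_cancel₀ _ h1b'.ne'] at h
  have hq := sum_mul_rpow_pos hp hr hp0 (b' - 1)
  have hl := Real.logb_le_logb_of_le (b := 2) (by norm_num)
    (sum_mul_rpow_pos hp hr hp0 (b - 1)) h
  rw [Real.logb_rpow_eq_mul_logb_of_pos hq] at hl
  have := mul_le_mul_of_nonneg_left hl (one_div_nonneg.2 h1b.le)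
  refine le_trans this (le_of_eq ?_)
  rw [← mul_assoc]
  congr 1
  field_simp

theorem tendsto_sub_one_nhdsNE : Tendsto (fun b : ℝ => b - 1) (𝓝[≠] 1) (𝓝[≠] 0) := by
  refine tendsto_nhdsWithin_of_tendsto_nhds_of_eventually_within _ ?_ ?_
  · have : Tendsto (fun b : ℝ => b - 1) (𝓝 1) (𝓝 (1 - 1)) :=
      (continuous_id.sub continuous_const).tendsto 1
    rw [sub_self] at this
    exact this.mono_left nhdsWithin_le_nhds
  · filter_upwards [self_mem_nhdsWithin] with b hb
    exact sub_ne_zero.2 hb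

/-- With support inclusion this is a derivative. For a partial overlap the mass is strictly between
0 and 1, so its negative logarithm times `1 / (b - 1)` tends to ∞ from the left, while the right
side is already infinite. -/
theorem tendsto_petzReal_one {ρ σ : Matrix n n ℂ} (hρ : IsState ρ) (hσ : σ.PosSemidef) :
    Tendsto (fun b => petzReal b ρ σ) (𝓝[≠] 1) (𝓝 (relEntropy ρ σ)) := by
  obtain ⟨p, r, hp, hr, hp1, hQ, hs, ho, hrel⟩ := exists_petz_weights hρ hσ
  have hb0 : ∀ᶠ b : ℝ in 𝓝[≠] 1, 0 < b := nhdsWithin_le_nhds (lt_mem_nhds one_pos)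
  by_cases hsl : SuppLE ρ σ
  · rw [relEntropy, if_pos hsl, hρ.trace_re, div_one, hrel hsl]
    have h := (tendsto_logb_sum_div hr (hs.1 hsl)).comp tendsto_sub_one_nhdsNE
    refine ((continuous_coe_real_ereal.tendsto _).comp h).congr' ?_
    filter_upwards [self_mem_nhdsWithin, hb0] with b hb hb0
    rw [petzReal_eq (Or.inr hsl) hρ, hQ b hb0.ne' hb]
    rfl
  rw [relEntropy, if_neg hsl]
  by_cases hor : Orthogonal ρ σ
  · refine tendsto_const_nhds.congr' ?_
    filter_upwards with b
    rw [petzReal, if_neg]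
    rintro (h | h)
    · exact h.2 hor
    · exact hsl h
  have hp0 : 0 < ∑ k, p k := lt_of_le_of_ne (Finset.sum_nonneg fun k _ => hp k)
    (fun h => hor (ho.2 h.symm))
  have hp1' : ∑ k, p k < 1 := lt_of_le_of_ne hp1 (fun h => hsl (hs.2 h))
  rw [show (𝓝[≠] (1 : ℝ)) = 𝓝[<] 1 ⊔ 𝓝[>] 1 from (nhdsLT_sup_nhdsGT 1).symm]
  refine Tendsto.sup ?_ ?_
  · have hlog : Tendsto (fun c : ℝ => Real.logb 2 (∑ k, p k * r k ^ c)) (𝓝 0)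
        (𝓝 (Real.logb 2 (∑ k, p k))) := by
      have h1 := (hasDerivAt_sum_mul_rpow (p := p) hr 0).continuousAt.tendsto
      simp only [Real.rpow_zero, mul_one] at h1
      exact (Real.continuousAt_log hp0.ne').tendsto.comp h1 |>.div_const _
    have hneg : Real.logb 2 (∑ k, p k) < 0 := Real.logb_neg (by norm_num) hp0 hp1'
    have h0 : Tendsto (fun b : ℝ => b - 1) (𝓝[<] 1) (𝓝[<] 0) := by
      refine tendsto_nhdsWithin_of_tendsto_nhds_of_eventually_within _ ?_ ?_
      · exact (tendsto_sub_one_nhdsNE.mono_left (nhdsWithin_mono _ fun b hb => ne_of_lt hb)).mono_right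
          nhdsWithin_le_nhds
      · filter_upwards [self_mem_nhdsWithin] with b hb
        exact sub_neg.2 (Set.mem_Iio.1 hb)
    have hinv : Tendsto (fun b : ℝ => 1 / (b - 1)) (𝓝[<] 1) atBot := by
      simp only [one_div]
      exact tendsto_inv_nhdsLT_zero.comp h0
    have hprod := hinv.atBot_mul_neg hneg (hlog.comp (h0.mono_right nhdsWithin_le_nhds))
    have htop := EReal.tendsto_coe_nhds_top_iff.2 hprod
    refine htop.congr' ?_
    filter_upwards [self_mem_nhdsWithin, nhdsWithin_mono 1 (fun b hb => ne_of_lt hb) hb0]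
      with b hb hb0
    rw [petzReal_eq (Or.inl ⟨hb, hor⟩) hρ, hQ b (ne_of_gt hb0) (ne_of_lt hb)]
    rfl
  · refine tendsto_const_nhds.congr' ?_
    filter_upwards [self_mem_nhdsWithin] with b hb
    rw [petzReal, if_neg]
    rwa [finiteDomain_of_one_lt hb]

/-- Needed at order 2, the dual of order 0, which is defined by a limit. -/
theorem continuousAt_petzReal {ρ σ : Matrix n n ℂ} (hρ : IsState ρ) (hσ : σ.PosSemidef)
    (hs : SuppLE ρ σ) {b : ℝ} (hb : 1 < b) : ContinuousAt (fun b => petzReal b ρ σ) b := by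
  obtain ⟨p, r, hp, hr, hp1, hQ, hs', ho, hrel⟩ := exists_petz_weights hρ hσ
  have hp0 : 0 < ∑ k, p k := by rw [hs'.1 hs]; exact one_pos
  have h1 : ContinuousAt (fun b : ℝ =>
      1 / (b - 1) * Real.logb 2 (∑ k, p k * r k ^ (b - 1))) b := by
    refine ContinuousAt.mul ?_ ?_
    · exact continuousAt_const.div (continuousAt_id.sub continuousAt_const) (by simp; linarith)
    · have h2 : ContinuousAt (fun b : ℝ => ∑ k, p k * r k ^ (b - 1)) b :=
        ContinuousAt.comp (f := fun b : ℝ => b - 1) (g := fun c : ℝ => ∑ k, p k * r k ^ c)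
          (hasDerivAt_sum_mul_rpow (p := p) hr (b - 1)).continuousAt
          (continuousAt_id.sub continuousAt_const)
      exact (h2.log (sum_mul_rpow_pos hp hr hp0 _).ne').div_const _
  refine ((continuous_coe_real_ereal.continuousAt).comp h1).congr ?_
  filter_upwards [lt_mem_nhds hb] with c hc
  rw [petzReal_eq (Or.inr hs) hρ, hQ c (by linarith) hc.ne']
  rfl

end PetzOrder

/-- A Dini argument. For L below the left side, each point has a neighbourhood in K on which a
single order exceeds L; monotonicity lets the larger of two orders serve both neighbourhoods, and
compactness yields one order for all of K. -/
theorem iInf_iSup_le_of_monotoneOn {X : Type*} [TopologicalSpace X] {K : Set X} (hK : IsCompact K)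
    {D : Set ℝ} (hD : D.Nonempty) {f : ℝ → X → EReal}
    (hlsc : ∀ b ∈ D, LowerSemicontinuousOn (f b) K)
    (hmono : ∀ x ∈ K, MonotoneOn (fun b => f b x) D) :
    ⨅ x ∈ K, ⨆ b ∈ D, f b x ≤ ⨆ b ∈ D, ⨅ x ∈ K, f b x := by
  by_contra! hlt
  obtain ⟨L, hL1, hL2⟩ := exists_between hlt
  have key : ∃ b ∈ D, ∀ x ∈ K ∩ K, L < f b x := by
    refine hK.induction_on (p := fun s => ∃ b ∈ D, ∀ x ∈ s ∩ K, L < f b x) ?_ ?_ ?_ ?_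
    · obtain ⟨b, hb⟩ := hD
      exact ⟨b, hb, by simp⟩
    · rintro s t hst ⟨b, hb, h⟩
      exact ⟨b, hb, fun x hx => h x ⟨hst hx.1, hx.2⟩⟩
    · rintro s t ⟨b, hb, h⟩ ⟨b', hb', h'⟩
      have hm : max b b' ∈ D := by
        rcases max_choice b b' with e | e <;> rw [e] <;> assumption
      refine ⟨max b b', hm, ?_⟩
      rintro x ⟨hx | hx, hxK⟩
      · exact (h x ⟨hx, hxK⟩).trans_le (hmono x hxK hb hm (le_max_left _ _))
      · exact (h' x ⟨hx, hxK⟩).trans_le (hmono x hxK hb' hm (le_max_right _ _))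
    · intro x hx
      have h1 : L < ⨆ b ∈ D, f b x := hL2.trans_le (iInf₂_le x hx)
      obtain ⟨b, hb⟩ := lt_iSup_iff.1 h1
      obtain ⟨hbD, hb⟩ := lt_iSup_iff.1 hb
      exact ⟨_, hlsc b hbD x hx L hb, b, hbD, fun y hy => hy.1⟩
  obtain ⟨b, hb, h⟩ := key
  have : L ≤ ⨆ b ∈ D, ⨅ x ∈ K, f b x :=
    le_iSup₂_of_le b hb (le_iInf₂ fun x hx => (h x ⟨hx, hx⟩).le)
  exact absurd hL1 (not_lt.2 this)

/-! ### Lower semicontinuity of the Petz divergence in its second argument. -/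

section Semicontinuity

variable {S B : Type*} [Fintype S] [DecidableEq S] [Fintype B] [DecidableEq B]

theorem lt_one_div_mul_logb_iff {m c P : ℝ} (hc : 0 < c) (hP : 0 < P) :
    m < 1 / c * Real.logb 2 P ↔ (2 : ℝ) ^ (m * c) < P := by
  rw [← Real.lt_logb_iff_rpow_lt (by norm_num) hP, one_div, inv_mul_eq_div, lt_div_iff₀ hc]

theorem lt_one_div_neg_mul_logb_iff {m c P : ℝ} (hc : c < 0) (hP : 0 < P) :
    m < 1 / c * Real.logb 2 P ↔ P < (2 : ℝ) ^ (m * c) := by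
  rw [← Real.logb_lt_iff_lt_rpow (by norm_num) hP, one_div, inv_mul_eq_div, lt_div_iff_of_neg hc]

theorem isState_subset_posSemidef {n : Type*} [Fintype n] [DecidableEq n] :
    {τ : Matrix n n ℂ | IsState τ} ⊆ {τ | τ.PosSemidef} :=
  fun _ h => h.1

/-- Exceeding a real `m` amounts to a strict upper bound on a continuous trace. This covers the
orthogonal case too, where the trace is 0 and the divergence infinite. -/
theorem lowerSemicontinuousOn_petzReal_of_lt_one {Z : Matrix (S × B) (S × B) ℂ} (hZ : IsState Z)
    {b : ℝ} (hb0 : 0 < b) (hb : b < 1) :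
    LowerSemicontinuousOn (fun τ : Matrix B B ℂ => petzReal b Z ((1 : Matrix S S ℂ) ⊗ₖ τ))
      {τ | IsState τ} := by
  have hc : ContinuousOn (fun τ : Matrix B B ℂ => (trFst (mpow Z b) * mpow τ (1 - b)).trace.re)
      {τ | IsState τ} := by
    have h1 := (continuousOn_mpow (n := B) (p := 1 - b) (by linarith)).mono
      isState_subset_posSemidef
    have h2 : Continuous fun Y : Matrix B B ℂ => (trFst (mpow Z b) * Y).trace.re := by fun_prop
    exact h2.comp_continuousOn h1
  have key : ∀ τ : Matrix B B ℂ, IsState τ → ∀ m : ℝ,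
      ((m : EReal) < petzReal b Z ((1 : Matrix S S ℂ) ⊗ₖ τ) ↔
        (trFst (mpow Z b) * mpow τ (1 - b)).trace.re < (2 : ℝ) ^ (m * (b - 1))) := by
    intro τ hτ m
    have hσ := posSemidef_one_kronecker (S := S) hτ.1
    by_cases hor : Orthogonal Z ((1 : Matrix S S ℂ) ⊗ₖ τ)
    · have hfin : ¬ FiniteDomain b Z ((1 : Matrix S S ℂ) ⊗ₖ τ) := by
        rw [finiteDomain_of_lt_one hb hZ.1.1 hZ.ne_zero hσ.1, not_not]; exact hor
      rw [petzReal, if_neg hfin, ← trace_petz_one_kronecker Z hτ.1.1]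
      refine iff_of_true (EReal.coe_lt_top m) ?_
      obtain ⟨p, r, hp, hr, hp1, hQ, hs, ho, -⟩ := exists_petz_weights hZ hσ
      have h0 := (Finset.sum_eq_zero_iff_of_nonneg (fun k _ => hp k)).1 (ho.1 hor)
      rw [hQ b hb0.ne' hb.ne, Finset.sum_eq_zero fun k hk => by rw [h0 k hk, zero_mul]]
      positivity
    · have hpos := petz_trace_pos_of_not_orthogonal (a := b) hZ.1 hσ hor
      rw [petzReal_eq (Or.inl ⟨hb, hor⟩) hZ, EReal.coe_lt_coe_iff]
      rw [trace_petz_one_kronecker Z hτ.1.1] at hpos ⊢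
      exact lt_one_div_neg_mul_logb_iff (by linarith) hpos
  intro τ hτ y hy
  obtain ⟨m, hm1, hm2⟩ := EReal.lt_iff_exists_real_btwn.1 hy
  filter_upwards [(hc τ hτ).eventually (gt_mem_nhds ((key τ hτ m).1 hm2)), self_mem_nhdsWithin]
    with τ' h1 h2
  exact hm1.trans ((key τ' h2 m).2 h1)

open scoped Matrix.Norms.L2Operator in
theorem continuousOn_cfc_add_rpow {ε : ℝ} (hε : 0 < ε) (p : ℝ) :
    ContinuousOn (fun A : Matrix B B ℂ => cfc (fun y : ℝ => (y + ε) ^ p) A)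
      {A | A.PosSemidef} := by
  refine ContinuousOn.cfc_of_mem_nhdsSet (s := Set.Ioi (-ε)) _ ?_
    continuousOn_id (fun _ hA => hA.1) ?_
  · refine isOpen_Ioi.mem_nhdsSet.2 ?_
    refine Set.iUnion₂_subset fun A hA => ?_
    change spectrum ℝ A ⊆ _
    have hA' : A.PosSemidef := hA
    rw [hA'.1.spectrum_real_eq_range_eigenvalues]
    rintro _ ⟨i, rfl⟩
    have := hA'.eigenvalues_nonneg i
    exact Set.mem_Ioi.2 (by linarith)
  · intro y hy
    have hy' : y + ε ≠ 0 := by have := Set.mem_Ioi.1 hy; linarith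
    exact ((continuousAt_id.add continuousAt_const).rpow_const (Or.inl hy')).continuousWithinAt

/-- Regularized negative powers increase to the negative power on the support, and diverge in the
pairing with operators supported elsewhere. -/
theorem exists_lt_trace_mul_cfc_add {X Y : Matrix B B ℂ} (hX : X.PosSemidef) (hY : Y.PosSemidef)
    {p : ℝ} (hp : p < 0) {L : ℝ} (h : X * kerProj Y = 0 → L < (X * mpow Y p).trace.re) :
    ∃ ε > 0, L < (X * cfc (fun y : ℝ => (y + ε) ^ p) Y).trace.re := by
  obtain ⟨w, hw, -, -, htr, hz⟩ := exists_overlap hX.1 hY.1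
  have hx : ∀ i, 0 ≤ hX.1.eigenvalues i := hX.eigenvalues_nonneg
  have hy : ∀ j, 0 ≤ hY.1.eigenvalues j := hY.eigenvalues_nonneg
  have htr' : ∀ g : ℝ → ℝ, (X * cfc g Y).trace.re =
      ∑ i, ∑ j, hX.1.eigenvalues i * g (hY.1.eigenvalues j) * w i j := by
    intro g
    have := htr (fun x => x) g
    rwa [cfc_id_matrix hX.1] at this
  suffices hev : ∀ᶠ ε : ℝ in 𝓝[>] 0, L < (X * cfc (fun y : ℝ => (y + ε) ^ p) Y).trace.re by
    obtain ⟨ε, h1, h2⟩ := (hev.and self_mem_nhdsWithin).exists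
    exact ⟨ε, h2, h1⟩
  by_cases hs : X * kerProj Y = 0
  · have hz' := hz (fun x => x) (fun y => if y = 0 then 1 else 0)
    rw [cfc_id_matrix hX.1] at hz'
    have hs' := hz'.1 hs
    have hlim : Tendsto (fun ε : ℝ => (X * cfc (fun y : ℝ => (y + ε) ^ p) Y).trace.re) (𝓝[>] 0)
        (𝓝 (X * mpow Y p).trace.re) := by
      rw [mpow, htr']
      simp only [htr']
      refine tendsto_finsetSum _ fun i _ => tendsto_finsetSum _ fun j _ => ?_
      rcases (hy j).eq_or_lt with hj | hj
      · have h0 : hX.1.eigenvalues i * w i j = 0 := by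
          have := hs' i j
          rw [← hj] at this
          simpa using this
        simp only [mul_right_comm _ _ (w i j), h0, zero_mul]
        exact tendsto_const_nhds
      · refine Tendsto.mul_const _ (Tendsto.const_mul _ ?_)
        have h1 : ContinuousAt (fun ε : ℝ => (hY.1.eigenvalues j + ε) ^ p) 0 :=
          (continuousAt_const.add continuousAt_id).rpow_const (Or.inl (by simpa using hj.ne'))
        have h2 := h1.tendsto
        rw [add_zero] at h2
        exact h2.mono_left nhdsWithin_le_nhds
    exact hlim.eventually (lt_mem_nhds (h hs))
  · have hz' := hz (fun x => x) (fun y => if y = 0 then 1 else 0)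
    rw [cfc_id_matrix hX.1] at hz'
    have hs' : ∃ i j, hX.1.eigenvalues i * (if hY.1.eigenvalues j = 0 then 1 else 0) * w i j ≠ 0 := by
      by_contra! hcon
      exact hs (hz'.2 hcon)
    obtain ⟨i, j, hij⟩ := hs'
    have hj : hY.1.eigenvalues j = 0 := by
      by_contra hj
      simp [hj] at hij
    simp only [hj, if_true, mul_one] at hij
    have hpos : 0 < hX.1.eigenvalues i * w i j :=
      lt_of_le_of_ne (mul_nonneg (hx i) (hw i j)) hij.symm
    have hlim : Tendsto (fun ε : ℝ => hX.1.eigenvalues i * w i j * ε ^ p) (𝓝[>] 0) atTop :=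
      (tendsto_rpow_neg_nhdsGT_zero hp).const_mul_atTop hpos
    filter_upwards [hlim.eventually_gt_atTop L, self_mem_nhdsWithin] with ε h1 hε
    refine h1.trans_le ?_
    have hε : 0 < ε := hε
    have hnn : ∀ i j, 0 ≤ hX.1.eigenvalues i * (hY.1.eigenvalues j + ε) ^ p * w i j := fun i j =>
      mul_nonneg (mul_nonneg (hx i) (Real.rpow_nonneg (by linarith [hy j]) p)) (hw i j)
    rw [htr']
    calc _ = hX.1.eigenvalues i * (hY.1.eigenvalues j + ε) ^ p * w i j := by
            rw [hj, zero_add]; ring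
      _ ≤ ∑ j, hX.1.eigenvalues i * (hY.1.eigenvalues j + ε) ^ p * w i j :=
          Finset.single_le_sum (f := fun j =>
            hX.1.eigenvalues i * (hY.1.eigenvalues j + ε) ^ p * w i j)
            (fun j _ => hnn i j) (Finset.mem_univ j)
      _ ≤ _ := Finset.single_le_sum (f := fun i => ∑ j,
            hX.1.eigenvalues i * (hY.1.eigenvalues j + ε) ^ p * w i j)
            (fun i _ => Finset.sum_nonneg fun j _ => hnn i j) (Finset.mem_univ i)

theorem trace_mul_cfc_add_le {X Y : Matrix B B ℂ} (hX : X.PosSemidef) (hY : Y.PosSemidef)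
    {p : ℝ} (hp : p < 0) {ε : ℝ} (hε : 0 < ε) (h : X * kerProj Y = 0) :
    (X * cfc (fun y : ℝ => (y + ε) ^ p) Y).trace.re ≤ (X * mpow Y p).trace.re := by
  obtain ⟨w, hw, -, -, htr, hz⟩ := exists_overlap hX.1 hY.1
  have hz' := hz (fun x => x) (fun y => if y = 0 then 1 else 0)
  have htr1 := htr (fun x => x) (fun y : ℝ => (y + ε) ^ p)
  have htr2 := htr (fun x => x) (fun y : ℝ => y ^ p)
  rw [cfc_id_matrix hX.1] at hz' htr1 htr2
  rw [htr1, mpow, htr2]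
  refine Finset.sum_le_sum fun i _ => Finset.sum_le_sum fun j _ => ?_
  rcases (hY.eigenvalues_nonneg j).eq_or_lt with hj | hj
  · have h0 : hX.1.eigenvalues i * w i j = 0 := by
      have := hz'.1 h i j
      rw [← hj] at this
      simpa using this
    rw [mul_right_comm, h0, mul_right_comm, h0]
    simp
  · refine mul_le_mul_of_nonneg_right (mul_le_mul_of_nonneg_left ?_ (hX.eigenvalues_nonneg i))
      (hw i j)
    exact Real.rpow_le_rpow_of_nonpos hj (by linarith) hp.le

/-- Negative powers jump at the kernel, so the trace is approached from below by the continuous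
functionals with `y + ε` in place of `y`. -/
theorem lowerSemicontinuousOn_petzReal_of_one_lt {Z : Matrix (S × B) (S × B) ℂ} (hZ : IsState Z)
    {b : ℝ} (hb : 1 < b) :
    LowerSemicontinuousOn (fun τ : Matrix B B ℂ => petzReal b Z ((1 : Matrix S S ℂ) ⊗ₖ τ))
      {τ | IsState τ} := by
  have hZb := posSemidef_mpow hZ.1 b
  have hX := trFst_posSemidef hZb
  have hp : 1 - b < 0 := by linarith
  have hsupp : ∀ τ : Matrix B B ℂ, IsState τ →
      (SuppLE Z ((1 : Matrix S S ℂ) ⊗ₖ τ) ↔ trFst (mpow Z b) * kerProj τ = 0) := by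
    intro τ hτ
    rw [← suppLE_mpow_iff hZ.1 (posSemidef_one_kronecker (S := S) hτ.1).1 (by linarith : b ≠ 0),
      suppLE_one_kronecker_iff hZb hτ.1]
  have key : ∀ τ : Matrix B B ℂ, IsState τ → ∀ m : ℝ,
      ((m : EReal) < petzReal b Z ((1 : Matrix S S ℂ) ⊗ₖ τ) ↔
        (trFst (mpow Z b) * kerProj τ = 0 →
          (2 : ℝ) ^ (m * (b - 1)) < (trFst (mpow Z b) * mpow τ (1 - b)).trace.re)) := by
    intro τ hτ m
    have hσ := posSemidef_one_kronecker (S := S) hτ.1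
    rw [← hsupp τ hτ]
    by_cases hs : SuppLE Z ((1 : Matrix S S ℂ) ⊗ₖ τ)
    · have hpos := petz_trace_pos_of_not_orthogonal (a := b) hZ.1 hσ
        (not_orthogonal_of_suppLE hZ.1.1 hZ.ne_zero hσ.1 hs)
      rw [petzReal_eq (Or.inr hs) hZ, EReal.coe_lt_coe_iff]
      rw [trace_petz_one_kronecker Z hτ.1.1] at hpos ⊢
      rw [lt_one_div_mul_logb_iff (by linarith) hpos]
      simp [hs]
    · rw [petzReal, if_neg (by rwa [finiteDomain_of_one_lt hb])]
      simp [hs]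
  intro τ hτ y hy
  obtain ⟨m, hm1, hm2⟩ := EReal.lt_iff_exists_real_btwn.1 hy
  obtain ⟨ε, hε, hlt⟩ := exists_lt_trace_mul_cfc_add hX hτ.1 hp ((key τ hτ m).1 hm2)
  have hc : ContinuousOn (fun τ : Matrix B B ℂ =>
      (trFst (mpow Z b) * cfc (fun y : ℝ => (y + ε) ^ (1 - b)) τ).trace.re) {τ | IsState τ} := by
    have h1 := (continuousOn_cfc_add_rpow (B := B) hε (1 - b)).mono
      isState_subset_posSemidef
    have h2 : Continuous fun Y : Matrix B B ℂ => (trFst (mpow Z b) * Y).trace.re := by fun_prop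
    exact h2.comp_continuousOn h1
  filter_upwards [(hc τ hτ).eventually (lt_mem_nhds hlt), self_mem_nhdsWithin] with τ' h1 h2
  exact hm1.trans ((key τ' h2 m).2 fun h3 => h1.trans_le (trace_mul_cfc_add_le hX h2.1 hp hε h3))

end Semicontinuity

/-! ### One-sided limits of monotone extended-real functions. -/

section MonotoneLimits

theorem tendsto_nhdsGT_of_monotoneOn {f : ℝ → EReal} {a b : ℝ} (hab : a < b)
    (hf : MonotoneOn f (Set.Ioo a b)) : Tendsto f (𝓝[>] a) (𝓝 (⨅ x ∈ Set.Ioo a b, f x)) := by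
  rw [← sInf_image]
  exact hf.tendsto_nhdsWithin_Ioo_right (Set.nonempty_Ioo.2 hab) (OrderBot.bddBelow _)

theorem tendsto_nhdsLT_of_monotoneOn {f : ℝ → EReal} {a b : ℝ} (hab : a < b)
    (hf : MonotoneOn f (Set.Ioo a b)) : Tendsto f (𝓝[<] b) (𝓝 (⨆ x ∈ Set.Ioo a b, f x)) := by
  rw [← sSup_image]
  exact hf.tendsto_nhdsWithin_Ioo_left (Set.nonempty_Ioo.2 hab) (OrderTop.bddAbove _)

theorem tendsto_atTop_of_monotoneOn {f : ℝ → EReal} {a : ℝ}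
    (hf : MonotoneOn f (Set.Ioi a)) : Tendsto f atTop (𝓝 (⨆ x ∈ Set.Ioi a, f x)) := by
  refine tendsto_order.2 ⟨fun y hy => ?_, fun y hy => ?_⟩
  · obtain ⟨b, hb⟩ := lt_iSup_iff.1 hy
    obtain ⟨hbD, hb⟩ := lt_iSup_iff.1 hb
    filter_upwards [eventually_ge_atTop b] with c hc
    exact hb.trans_le (hf hbD (lt_of_lt_of_le hbD hc) hc)
  · filter_upwards [eventually_gt_atTop a] with c hc
    exact (le_iSup₂ (f := fun x _ => f x) c hc).trans_lt hy

end MonotoneLimits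

/-! ### Extreme orders and order one as suprema or infima over orders. -/

section PetzExtremes

variable {n : Type*} [Fintype n] [DecidableEq n]

theorem petzDiv_zero {ρ σ : Matrix n n ℂ} (hρ : IsState ρ) (hσ : σ.PosSemidef) :
    petzDiv 0 ρ σ = ⨅ b ∈ Set.Ioo (0 : ℝ) 1, petzReal b ρ σ := by
  rw [petzDiv, extendOrder, if_pos rfl]
  exact (tendsto_nhdsGT_of_monotoneOn one_pos (petzReal_monotoneOn_Ioo hρ hσ)).liminf_eq

theorem petzDiv_top {ρ σ : Matrix n n ℂ} (hρ : IsState ρ) (hσ : σ.PosSemidef) :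
    petzDiv ⊤ ρ σ = ⨆ b ∈ Set.Ioi (1 : ℝ), petzReal b ρ σ := by
  rw [petzDiv, extendOrder, if_neg ENNReal.top_ne_zero, if_neg ENNReal.top_ne_one, if_pos rfl]
  exact (tendsto_atTop_of_monotoneOn (petzReal_monotoneOn_Ioi hρ hσ)).liminf_eq

theorem petzDiv_one (ρ σ : Matrix n n ℂ) : petzDiv 1 ρ σ = relEntropy ρ σ := by
  rw [petzDiv, extendOrder, if_neg one_ne_zero, if_pos rfl]

theorem relEntropy_eq_iSup {ρ σ : Matrix n n ℂ} (hρ : IsState ρ) (hσ : σ.PosSemidef) :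
    relEntropy ρ σ = ⨆ b ∈ Set.Ioo (0 : ℝ) 1, petzReal b ρ σ :=
  tendsto_nhds_unique
    ((tendsto_petzReal_one hρ hσ).mono_left (nhdsLT_le_nhdsNE 1))
    (tendsto_nhdsLT_of_monotoneOn one_pos (petzReal_monotoneOn_Ioo hρ hσ))

theorem relEntropy_eq_iInf {ρ σ : Matrix n n ℂ} (hρ : IsState ρ) (hσ : σ.PosSemidef) :
    relEntropy ρ σ = ⨅ b ∈ Set.Ioo (1 : ℝ) 2, petzReal b ρ σ :=
  tendsto_nhds_unique
    ((tendsto_petzReal_one hρ hσ).mono_left (nhdsGT_le_nhdsNE 1))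
    (tendsto_nhdsGT_of_monotoneOn one_lt_two
      ((petzReal_monotoneOn_Ioi hρ hσ).mono fun _ hb => hb.1))

end PetzExtremes

/-! ### Limits of the closed form at 0, 1 and ∞. -/

section ClosedForm

variable {S B : Type*} [Fintype S] [DecidableEq S] [Fintype B] [DecidableEq B]

theorem closedForm_eq_iInf {Z : Matrix (S × B) (S × B) ℂ} (hZ : IsState Z) {a : ℝ} (ha : 0 < a)
    (ha1 : a ≠ 1) :
    ((closedForm a Z : ℝ) : EReal) =
      ⨅ τ : {τ : Matrix B B ℂ // IsState τ}, petzReal (a⁻¹) Z ((1 : Matrix S S ℂ) ⊗ₖ τ.1) := by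
  rw [iInf_petzReal hZ (inv_pos.2 ha) (inv_ne_one.2 ha1), one_div, inv_inv]

theorem iInf_petzReal_monotoneOn_Ioo {Z : Matrix (S × B) (S × B) ℂ} (hZ : IsState Z) :
    MonotoneOn (fun b => ⨅ τ : {τ : Matrix B B ℂ // IsState τ},
      petzReal b Z ((1 : Matrix S S ℂ) ⊗ₖ τ.1)) (Set.Ioo 0 1) :=
  fun _ hb _ hb' h => iInf_mono fun τ =>
    petzReal_monotoneOn_Ioo hZ (posSemidef_one_kronecker τ.2.1) hb hb' h

theorem iInf_petzReal_monotoneOn_Ioi {Z : Matrix (S × B) (S × B) ℂ} (hZ : IsState Z) :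
    MonotoneOn (fun b => ⨅ τ : {τ : Matrix B B ℂ // IsState τ},
      petzReal b Z ((1 : Matrix S S ℂ) ⊗ₖ τ.1)) (Set.Ioi 1) :=
  fun _ hb _ hb' h => iInf_mono fun τ =>
    petzReal_monotoneOn_Ioi hZ (posSemidef_one_kronecker τ.2.1) hb hb' h

theorem iSup_iInf_petzReal {Z : Matrix (S × B) (S × B) ℂ} {D : Set ℝ} (hD : D.Nonempty)
    (hlsc : ∀ b ∈ D, LowerSemicontinuousOn
      (fun τ : Matrix B B ℂ => petzReal b Z ((1 : Matrix S S ℂ) ⊗ₖ τ)) {τ | IsState τ})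
    (hmono : ∀ τ : Matrix B B ℂ, IsState τ →
      MonotoneOn (fun b => petzReal b Z ((1 : Matrix S S ℂ) ⊗ₖ τ)) D) :
    ⨆ b ∈ D, ⨅ τ : {τ : Matrix B B ℂ // IsState τ}, petzReal b Z ((1 : Matrix S S ℂ) ⊗ₖ τ.1) =
      ⨅ τ : {τ : Matrix B B ℂ // IsState τ}, ⨆ b ∈ D,
        petzReal b Z ((1 : Matrix S S ℂ) ⊗ₖ τ.1) := by
  refine le_antisymm (iSup₂_le fun b hb => le_iInf fun τ => ?_) ?_
  · exact (iInf_le (fun τ : {τ : Matrix B B ℂ // IsState τ} =>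
      petzReal b Z ((1 : Matrix S S ℂ) ⊗ₖ τ.1)) τ).trans
      (le_iSup₂ (f := fun b _ => petzReal b Z ((1 : Matrix S S ℂ) ⊗ₖ τ.1)) b hb)
  · have := iInf_iSup_le_of_monotoneOn (isCompact_isState (n := B)) hD hlsc hmono
    simpa only [iInf_subtype, Set.mem_ofPred_eq] using this

/-- Here the Petz order `a⁻¹` increases to ∞, so a supremum over orders must be exchanged with the
infimum over states; this needs compactness. -/
theorem tendsto_closedForm_zero {Z : Matrix (S × B) (S × B) ℂ} (hZ : IsState Z) :
    Tendsto (fun a : ℝ => ((closedForm a Z : ℝ) : EReal)) (𝓝[>] 0)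
      (𝓝 (⨅ τ : {τ : Matrix B B ℂ // IsState τ},
        petzDiv ⊤ Z ((1 : Matrix S S ℂ) ⊗ₖ τ.1))) := by
  have h1 := tendsto_atTop_of_monotoneOn (iInf_petzReal_monotoneOn_Ioi hZ)
  rw [iSup_iInf_petzReal (D := Set.Ioi 1) ⟨2, Set.mem_Ioi.2 one_lt_two⟩
    (fun b hb => lowerSemicontinuousOn_petzReal_of_one_lt hZ hb)
    (fun τ hτ => petzReal_monotoneOn_Ioi hZ (posSemidef_one_kronecker hτ.1))] at h1
  simp only [fun τ : {τ : Matrix B B ℂ // IsState τ} =>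
    petzDiv_top hZ (posSemidef_one_kronecker (S := S) τ.2.1)]
  refine (h1.comp tendsto_inv_nhdsGT_zero).congr' ?_
  filter_upwards [self_mem_nhdsWithin, nhdsWithin_le_nhds (gt_mem_nhds one_pos)] with a ha ha1
  exact (closedForm_eq_iInf hZ ha (ne_of_lt ha1)).symm

/-- Here the Petz order decreases to 0, and two infima commute freely. -/
theorem tendsto_closedForm_atTop {Z : Matrix (S × B) (S × B) ℂ} (hZ : IsState Z) :
    Tendsto (fun a : ℝ => ((closedForm a Z : ℝ) : EReal)) atTop
      (𝓝 (⨅ τ : {τ : Matrix B B ℂ // IsState τ},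
        petzDiv 0 Z ((1 : Matrix S S ℂ) ⊗ₖ τ.1))) := by
  have h1 := tendsto_nhdsGT_of_monotoneOn one_pos (iInf_petzReal_monotoneOn_Ioo hZ)
  simp only [iInf_comm (ι' := {τ : Matrix B B ℂ // IsState τ})] at h1
  simp only [fun τ : {τ : Matrix B B ℂ // IsState τ} =>
    petzDiv_zero hZ (posSemidef_one_kronecker (S := S) τ.2.1)]
  refine (h1.comp tendsto_inv_atTop_nhdsGT_zero).congr' ?_
  filter_upwards [eventually_gt_atTop 1] with a ha
  exact (closedForm_eq_iInf hZ (one_pos.trans ha) (ne_of_gt ha)).symm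

theorem tendsto_closedForm_one {Z : Matrix (S × B) (S × B) ℂ} (hZ : IsState Z) :
    Tendsto (fun a : ℝ => ((closedForm a Z : ℝ) : EReal)) (𝓝[≠] 1)
      (𝓝 (⨅ τ : {τ : Matrix B B ℂ // IsState τ},
        relEntropy Z ((1 : Matrix S S ℂ) ⊗ₖ τ.1))) := by
  have h1 : Tendsto (fun b => ⨅ τ : {τ : Matrix B B ℂ // IsState τ},
      petzReal b Z ((1 : Matrix S S ℂ) ⊗ₖ τ.1)) (𝓝[≠] 1)
      (𝓝 (⨅ τ : {τ : Matrix B B ℂ // IsState τ},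
        relEntropy Z ((1 : Matrix S S ℂ) ⊗ₖ τ.1))) := by
    rw [← nhdsLT_sup_nhdsGT (1 : ℝ)]
    refine Tendsto.sup ?_ ?_
    · have h := tendsto_nhdsLT_of_monotoneOn one_pos (iInf_petzReal_monotoneOn_Ioo hZ)
      rw [iSup_iInf_petzReal (Set.nonempty_Ioo.2 one_pos)
        (fun b hb => lowerSemicontinuousOn_petzReal_of_lt_one hZ hb.1 hb.2)
        (fun τ hτ => petzReal_monotoneOn_Ioo hZ (posSemidef_one_kronecker hτ.1))] at h
      simpa only [fun τ : {τ : Matrix B B ℂ // IsState τ} =>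
        relEntropy_eq_iSup hZ (posSemidef_one_kronecker (S := S) τ.2.1)] using h
    · have h := tendsto_nhdsGT_of_monotoneOn one_lt_two
        ((iInf_petzReal_monotoneOn_Ioi hZ).mono fun _ hb => hb.1)
      simp only [iInf_comm (ι' := {τ : Matrix B B ℂ // IsState τ})] at h
      simpa only [fun τ : {τ : Matrix B B ℂ // IsState τ} =>
        relEntropy_eq_iInf hZ (posSemidef_one_kronecker (S := S) τ.2.1)] using h
  have hinv : Tendsto (fun a : ℝ => a⁻¹) (𝓝[≠] 1) (𝓝[≠] 1) := by
    refine tendsto_nhdsWithin_of_tendsto_nhds_of_eventually_within _ ?_ ?_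
    · have := (continuousAt_inv₀ (one_ne_zero (α := ℝ))).tendsto
      rw [inv_one] at this
      exact this.mono_left nhdsWithin_le_nhds
    · filter_upwards [self_mem_nhdsWithin] with a ha
      exact inv_ne_one.2 ha
  refine (h1.comp hinv).congr' ?_
  filter_upwards [self_mem_nhdsWithin, nhdsWithin_le_nhds (lt_mem_nhds one_pos)] with a ha ha0
  exact (closedForm_eq_iInf hZ ha0 ha).symm

end ClosedForm

/-! ### Dualities for parts 2, 3 and 4. -/

section Duality

variable {S B C : Type*} [Fintype S] [DecidableEq S] [Fintype B] [DecidableEq B] [Fintype C]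
  [DecidableEq C]

theorem extendOrder_ofReal {n : Type*} [Fintype n] [DecidableEq n]
    (D : ℝ → Matrix n n ℂ → Matrix n n ℂ → EReal) {a : ℝ} (ha : 0 < a) (ha1 : a ≠ 1)
    (ρ σ : Matrix n n ℂ) : extendOrder D (ENNReal.ofReal a) ρ σ = D a ρ σ := by
  rw [extendOrder, if_neg (by simpa using ha), if_neg (by simpa using ha1),
    if_neg ENNReal.ofReal_ne_top, ENNReal.toReal_ofReal ha.le]

theorem sandDown_ofReal {M : Matrix (S × B) C ℂ} (hM : IsState (M * Mᴴ)) {a : ℝ} (ha : 0 < a)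
    (ha1 : a ≠ 1) :
    sandDown (ENNReal.ofReal a) (M * Mᴴ) =
      ((closedForm a (flipMat M * (flipMat M)ᴴ) : ℝ) : EReal) := by
  rw [sandDown, sandDiv, extendOrder_ofReal _ ha ha1, sandReal_trFst M hM ha, ← EReal.coe_neg,
    neg_neg]

theorem sandDown_eq_iInf {M : Matrix (S × B) C ℂ} (hM : IsState (M * Mᴴ)) (α : ℝ≥0∞) :
    sandDown α (M * Mᴴ) = ⨅ τ : {τ : Matrix C C ℂ // IsState τ},
      petzDiv (1 / α) (flipMat M * (flipMat M)ᴴ) ((1 : Matrix S S ℂ) ⊗ₖ τ.1) := by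
  by_cases h0 : α = 0
  · subst h0
    have h := (continuous_neg.tendsto _).comp (tendsto_closedForm_zero hM.flip)
    rw [sandDown, sandDiv, extendOrder, if_pos rfl, one_div, ENNReal.inv_zero]
    rw [(h.congr' ?_).liminf_eq, neg_neg]
    filter_upwards [self_mem_nhdsWithin] with a ha
    rw [sandReal_trFst M hM ha, EReal.coe_neg]
    rfl
  by_cases h1 : α = 1
  · subst h1
    simp only [one_div, inv_one, petzDiv_one]
    rw [iInf_relEntropy hM.flip, sandDown, sandDiv, extendOrder, if_neg h0, if_pos rfl,
      relEntropy_trFst hM, condEntropy_flip M, ← EReal.coe_neg, neg_neg]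
  by_cases ht : α = ⊤
  · subst ht
    have h := (continuous_neg.tendsto _).comp (tendsto_closedForm_atTop hM.flip)
    rw [sandDown, sandDiv, extendOrder, if_neg h0, if_neg h1, if_pos rfl, one_div, ENNReal.inv_top]
    rw [(h.congr' ?_).liminf_eq, neg_neg]
    filter_upwards [eventually_gt_atTop 0] with a ha
    rw [sandReal_trFst M hM ha, EReal.coe_neg]
    rfl
  have ha : 0 < α.toReal := ENNReal.toReal_pos h0 ht
  have ha1 : α.toReal ≠ 1 := by
    rwa [Ne, ENNReal.toReal_eq_one_iff]
  have hα : α = ENNReal.ofReal α.toReal := (ENNReal.ofReal_toReal ht).symm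
  generalize α.toReal = a at *
  subst hα
  rw [sandDown_ofReal hM ha ha1, closedForm_eq_iInf hM.flip ha ha1, one_div,
    ← ENNReal.ofReal_inv_of_pos ha]
  simp only [petzDiv, extendOrder_ofReal _ (inv_pos.2 ha) (inv_ne_one.2 ha1)]

theorem ereal_iSup_neg {ι : Type*} (f : ι → EReal) : ⨆ i, -f i = -⨅ i, f i :=
  (EReal.negOrderIso.map_iInf f).symm

/-- The previous duality with B and C interchanged, at order `1 / α`. -/
theorem petzUp_eq_sandDiv {M : Matrix (S × B) C ℂ} (hM : IsState (M * Mᴴ)) (α : ℝ≥0∞) :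
    petzUp α (M * Mᴴ) = sandDiv (1 / α) (flipMat M * (flipMat M)ᴴ)
      ((1 : Matrix S S ℂ) ⊗ₖ trFst (flipMat M * (flipMat M)ᴴ)) := by
  have h := sandDown_eq_iInf hM.flip (1 / α)
  rw [one_div (1 / α), one_div α, inv_inv, ← one_div, flipMat_flipMat] at h
  rw [petzUp, ereal_iSup_neg, ← h, sandDown, neg_neg]

/-- Covers both ends of part 4: order 0 directly, order 2 after interchanging B and C. -/
theorem liminf_petzReal_trFst {M : Matrix (S × B) C ℂ} (hM : IsState (M * Mᴴ)) :
    liminf (fun a => petzReal a (M * Mᴴ) ((1 : Matrix S S ℂ) ⊗ₖ trFst (M * Mᴴ))) (𝓝[>] 0) =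
      -petzReal 2 (flipMat M * (flipMat M)ᴴ)
        ((1 : Matrix S S ℂ) ⊗ₖ trFst (flipMat M * (flipMat M)ᴴ)) := by
  have h1 := continuousAt_petzReal hM.flip (posSemidef_one_kronecker (S := S) hM.flip.trFst.1)
    (suppLE_one_kronecker_trFst hM.flip.1) one_lt_two
  have h2 : Tendsto (fun a : ℝ => 2 - a) (𝓝[>] 0) (𝓝 2) := by
    have : Tendsto (fun a : ℝ => 2 - a) (𝓝 0) (𝓝 (2 - 0)) :=
      (continuous_const.sub continuous_id).tendsto 0
    rw [sub_zero] at this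
    exact this.mono_left nhdsWithin_le_nhds
  have h3 := (continuous_neg.tendsto _).comp (h1.tendsto.comp h2)
  refine (h3.congr' ?_).liminf_eq
  filter_upwards [self_mem_nhdsWithin, nhdsWithin_le_nhds (gt_mem_nhds two_pos)] with a ha ha2
  rw [petzReal_trFst M hM (ne_of_gt ha) (ne_of_lt ha2)]
  rfl

theorem petzDown_eq_petzDiv {M : Matrix (S × B) C ℂ} (hM : IsState (M * Mᴴ)) {α : ℝ≥0∞}
    (hα : α ≤ 2) :
    petzDown α (M * Mᴴ) = petzDiv (2 - α) (flipMat M * (flipMat M)ᴴ)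
      ((1 : Matrix S S ℂ) ⊗ₖ trFst (flipMat M * (flipMat M)ᴴ)) := by
  have h2 : (2 : ℝ≥0∞) = ENNReal.ofReal 2 := by simp
  by_cases h0 : α = 0
  · subst h0
    rw [tsub_zero, h2, petzDiv, extendOrder_ofReal _ two_pos (by norm_num), petzDown, petzDiv,
      extendOrder, if_pos rfl, liminf_petzReal_trFst hM, neg_neg]
  by_cases h1 : α = 1
  · subst h1
    have : (2 : ℝ≥0∞) - 1 = 1 := by
      rw [← one_add_one_eq_two, ENNReal.add_sub_cancel_right ENNReal.one_ne_top]
    rw [this, petzDown, petzDiv_one, petzDiv_one, relEntropy_trFst hM, relEntropy_trFst hM.flip,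
      condEntropy_flip M, ← EReal.coe_neg, neg_neg]
  have ht : α ≠ ⊤ := ne_top_of_le_ne_top (by simp) hα
  have ha : 0 < α.toReal := ENNReal.toReal_pos h0 ht
  have ha1 : α.toReal ≠ 1 := by
    rwa [Ne, ENNReal.toReal_eq_one_iff]
  have hαe : α = ENNReal.ofReal α.toReal := (ENNReal.ofReal_toReal ht).symm
  generalize α.toReal = a at *
  subst hαe
  rw [h2] at hα ⊢
  have ha2 : a ≤ 2 := (ENNReal.ofReal_le_ofReal_iff two_pos.le).1 hα
  rw [← ENNReal.ofReal_sub 2 ha.le, petzDown, petzDiv, petzDiv, extendOrder_ofReal _ ha ha1]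
  rcases ha2.eq_or_lt with rfl | ha2
  · have h := liminf_petzReal_trFst hM.flip
    rw [flipMat_flipMat] at h
    rw [sub_self, ENNReal.ofReal_zero, extendOrder, if_pos rfl, h]
  · rw [extendOrder_ofReal _ (by linarith) (by intro h; apply ha1; linarith),
      petzReal_trFst M hM ha.ne' ha2.ne, neg_neg]

end Duality

/-! ### The minimax theorem for the bilinear pairing. -/

section Minimax

variable {S B C : Type*} [Fintype S] [DecidableEq S] [Fintype B] [DecidableEq B] [Fintype C]
  [DecidableEq C]

theorem sliceMap_add (M : Matrix (S × B) C ℂ) (A A' : Matrix C C ℂ) :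
    sliceMap M (A + A') = sliceMap M A + sliceMap M A' := by
  rw [sliceMap, sliceMap, sliceMap, transpose_add, Matrix.mul_add, Matrix.add_mul]
  ext b b'
  simp [trFst, Finset.sum_add_distrib]

theorem sliceMap_smul (M : Matrix (S × B) C ℂ) (c : ℝ) (A : Matrix C C ℂ) :
    sliceMap M (c • A) = c • sliceMap M A := by
  rw [sliceMap, sliceMap, transpose_smul, Matrix.mul_smul, Matrix.smul_mul]
  ext b b'
  simp [trFst, Finset.mul_sum]

theorem continuous_trace_sliceMap_mul (M : Matrix (S × B) C ℂ) :
    Continuous fun q : Matrix C C ℂ × Matrix B B ℂ => (sliceMap M q.1 * q.2).trace.re := by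
  have h1 : Continuous fun A : Matrix C C ℂ => sliceMap M A := by
    refine continuous_matrix fun b b' => ?_
    simp only [sliceMap, trFst, Matrix.of_apply]
    have h2 : Continuous fun A : Matrix C C ℂ => M * Aᵀ * Mᴴ := by fun_prop
    exact continuous_finsetSum _ fun s _ => h2.matrix_elem _ _
  have h2 : Continuous fun q : Matrix C C ℂ × Matrix B B ℂ => sliceMap M q.1 * q.2 :=
    (h1.comp continuous_fst).matrix_mul continuous_snd
  exact Complex.continuous_re.comp h2.matrix_trace

/-- Subadditivity of `t ^ β` for `β ≤ 1` controls the cost of making Y invertible. -/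
theorem trace_mpow_add_smul_one_le {Y : Matrix B B ℂ} (hY : Y.PosSemidef) {η β : ℝ} (hη : 0 < η)
    (hβ : 0 < β) (hβ1 : β ≤ 1) :
    (Y + η • (1 : Matrix B B ℂ)).PosDef ∧ (mpow (Y + η • (1 : Matrix B B ℂ)) β).trace.re ≤
      (mpow Y β).trace.re + Fintype.card B * η ^ β := by
  have hsa : IsSelfAdjoint Y := hY.1
  have h1 : Y + η • (1 : Matrix B B ℂ) = cfc (fun x : ℝ => x + η) Y := by
    rw [cfc_add (a := Y) _ _ (continuousOn_spectrum _ _) (continuousOn_spectrum _ _),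
      cfc_id_matrix hY.1, cfc_const η Y, Algebra.algebraMap_eq_smul_one]
  rw [h1]
  refine ⟨posDef_cfc hY.1 fun i => by linarith [hY.eigenvalues_nonneg i], ?_⟩
  rw [mpow, cfc_cfc _ _ hY.1, mpow, trace_cfc_re _ hY.1, trace_cfc_re _ hY.1, ← nsmul_eq_mul,
    ← Finset.card_univ, ← Finset.sum_const, ← Finset.sum_add_distrib]
  exact Finset.sum_le_sum fun i _ =>
    Real.rpow_add_le_add_rpow (hY.eigenvalues_nonneg i) hη.le hβ.le hβ1

/-- Up to `δ`, the reverse Hölder inequality is attained by a positive definite operator. -/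
theorem exists_negSchattenBall_trace_le [Nonempty B] {Y : Matrix B B ℂ} (hY : Y.PosSemidef)
    {s : ℝ} (hs : 0 < s) {L δ : ℝ} (hδ : 0 < δ) (hL : (mpow Y (1 / (1 + s))).trace.re ≤ L) :
    ∃ D ∈ negSchattenBall B (1 / s), (Y * D).trace.re ≤ (L + δ) ^ (1 + s) := by
  have h1s : 0 < 1 + s := by linarith
  set β := 1 / (1 + s) with hβ
  have hβ0 : 0 < β := by positivity
  have hβ1 : β ≤ 1 := by rw [hβ, div_le_one h1s]; linarith
  have hcard : (0 : ℝ) < Fintype.card B := by exact_mod_cast Fintype.card_pos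
  -- Chosen so that the regularization costs exactly `δ`.
  set η := (δ / Fintype.card B) ^ (1 + s) with hη
  have hη0 : 0 < η := by positivity
  have hηβ : Fintype.card B * η ^ β = δ := by
    rw [hη, ← Real.rpow_mul (by positivity), hβ, mul_one_div_cancel h1s.ne', Real.rpow_one]
    field_simp
  obtain ⟨hpd, hle⟩ := trace_mpow_add_smul_one_le hY hη0 hβ0 hβ1
  rw [hηβ] at hle
  set W := Y + η • (1 : Matrix B B ℂ) with hW
  set T := (mpow W β).trace.re with hT
  have hW0 : W ≠ 0 := by
    rintro h
    have := hpd.diag_pos (i := Classical.arbitrary B)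
    rw [h] at this
    simp at this
  have hT0 : 0 < T := trace_mpow_pos hpd.posSemidef hW0 _
  have hDpd : (T ^ s • mpow W (-(s * β))).PosDef :=
    (posDef_mpow hpd _).smul (Real.rpow_pos_of_pos hT0 _)
  -- The equality case of reverse Hölder for W, normalized so that its power `-(1 / s)` has trace 1.
  refine ⟨T ^ s • mpow W (-(s * β)), ⟨hDpd, ?_⟩, ?_⟩
  · rw [mpow_smul (posSemidef_mpow hpd.posSemidef _) (by positivity), mpow_mpow hpd.posSemidef,
      trace_smul, Complex.smul_re]
    have e1 : -(s * β) * -(1 / s) = β := by field_simp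
    have e2 : (T ^ s) ^ (-(1 / s)) = T⁻¹ := by
      rw [← Real.rpow_mul hT0.le, mul_neg, mul_one_div_cancel hs.ne', Real.rpow_neg_one]
    rw [e1, e2, ← hT, smul_eq_mul, inv_mul_cancel₀ hT0.ne']
  · have e0 : 1 + -(s * β) = β := by rw [hβ]; field_simp; ring
    have e1 : (W * (T ^ s • mpow W (-(s * β)))).trace.re = T ^ (1 + s) := by
      rw [Matrix.mul_smul, trace_smul, Complex.smul_re, trace_mpow_add_one hpd.posSemidef _
        (by rw [add_comm, e0]; exact hβ0.ne'), e0, ← hT, smul_eq_mul, add_comm 1 s,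
        Real.rpow_add_one hT0.ne']
    have e2 : (Y * (T ^ s • mpow W (-(s * β)))).trace.re ≤
        (W * (T ^ s • mpow W (-(s * β)))).trace.re := by
      rw [hW, Matrix.add_mul, trace_add, Complex.add_re, Matrix.smul_mul, Matrix.one_mul,
        trace_smul, Complex.smul_re, smul_eq_mul]
      have := trace_re_nonneg hDpd.posSemidef
      rw [hW] at this
      linarith [mul_nonneg hη0.le this]
    rw [e1] at e2
    exact e2.trans (Real.rpow_le_rpow hT0.le (by linarith) h1s.le)

/-- For each A reverse Hölder supplies a good D; Sion's theorem makes D uniform in A. Convexity of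
the A-side requires `1 / s ≥ 1`. Only that side is compact, and the gap between `L` and `L'` absorbs
the failure of attainment on the D-side. -/
theorem exists_negSchattenBall_forall_trace_le [Nonempty B] (M : Matrix (S × B) C ℂ) {s : ℝ}
    (hs : 0 < s) (hs1 : s ≤ 1) {L L' : ℝ} (hLL : L < L')
    (hL : ∀ A ∈ schattenBall C (1 / s), (mpow (sliceMap M A) (1 / (1 + s))).trace.re ≤ L) :
    ∃ D ∈ negSchattenBall B (1 / s), ∀ A ∈ schattenBall C (1 / s),
      (sliceMap M A * D).trace.re ≤ L' ^ (1 + s) := by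
  have hc := continuous_trace_sliceMap_mul M
  have hcA : ∀ D : Matrix B B ℂ, Continuous fun A : Matrix C C ℂ =>
      -(sliceMap M A * D).trace.re := fun D => (hc.comp (Continuous.prodMk_left D)).neg
  have hcD : ∀ A : Matrix C C ℂ, Continuous fun D : Matrix B B ℂ =>
      -(sliceMap M A * D).trace.re := fun A => (hc.comp (Continuous.prodMk_right A)).neg
  have h0 : (0 : Matrix C C ℂ) ∈ schattenBall C (1 / s) := by
    have hp : (0 : Matrix C C ℂ).PosSemidef := Matrix.PosSemidef.zero
    refine ⟨hp, ?_⟩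
    have h := mpow_smul hp (le_refl (0 : ℝ)) (1 / s)
    rw [Real.zero_rpow (by positivity), zero_smul ℝ (0 : Matrix C C ℂ), zero_smul] at h
    rw [h]; simp
  have hL0 : 0 ≤ L := (trace_mpow_nonneg (sliceMap_posSemidef M h0.1) _).trans (hL 0 h0)
  have hK : IsCompact (schattenBall C (1 / s)) := isCompact_schattenBall (by positivity)
  have hKc : Convex ℝ (schattenBall C (1 / s)) := convex_schattenBall (by rwa [le_div_iff₀ hs, one_mul])
  have hDc : Convex ℝ (negSchattenBall B (1 / s)) := convex_negSchattenBall (by positivity)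
  -- By compactness finitely many D already defeat every A, the hypothesis under which Sion's
  -- theorem needs no compactness in D. The payoff is negated so that the compact side minimizes.
  obtain ⟨F, hFsub, hFfin, hF⟩ := hK.elim_finite_subcover_image (b := negSchattenBall B (1 / s))
    (c := fun D => {A | -(L' ^ (1 + s)) < -(sliceMap M A * D).trace.re})
    (fun D _ => isOpen_lt continuous_const (hcA D)) (by
      intro A hA
      obtain ⟨D, hD, hle⟩ := exists_negSchattenBall_trace_le (sliceMap_posSemidef M hA.1) hs
        (δ := (L' - L) / 2) (by linarith) (hL A hA)
      refine Set.mem_iUnion₂.2 ⟨D, hD, ?_⟩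
      refine neg_lt_neg (hle.trans_lt ?_)
      exact Real.rpow_lt_rpow (by linarith) (by linarith) (by linarith))
  obtain ⟨D, hD, h⟩ := Sion.exists_lt_iInf_of_lt_iInf_of_finite (X := schattenBall C (1 / s))
    (Y := negSchattenBall B (1 / s)) (f := fun A D => -(sliceMap M A * D).trace.re)
    (t := -(L' ^ (1 + s))) ⟨0, h0⟩ hK
    (fun D _ => (hcA D).lowerSemicontinuous.lowerSemicontinuousOn _)
    (fun D _ => by
      refine ConvexOn.quasiconvexOn ⟨hKc, fun A _ A' _ a b _ _ _ => le_of_eq ?_⟩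
      simp only [sliceMap_add, sliceMap_smul, Matrix.add_mul, Matrix.smul_mul, trace_add,
        trace_smul, Complex.add_re, Complex.smul_re, smul_eq_mul]
      ring)
    hDc
    (fun A _ => (hcD A).upperSemicontinuous.upperSemicontinuousOn _)
    (fun A _ => by
      refine ConcaveOn.quasiconcaveOn ⟨hDc, fun D _ D' _ a b _ _ _ => le_of_eq ?_⟩
      simp only [Matrix.mul_add, Matrix.mul_smul, trace_add,
        trace_smul, Complex.add_re, Complex.smul_re, smul_eq_mul]
      ring)
    hKc hFfin hFsub (fun A hA => by
      obtain ⟨D, hD, h⟩ := Set.mem_iUnion₂.1 (hF hA)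
      exact ⟨D, hD, h⟩)
  exact ⟨D, hD, fun A hA => (neg_lt_neg_iff.1 (h A hA)).le⟩

/-- Minimax: a uniform bound over the marginal problem is certified by a single invertible state. -/
theorem exists_state_forall_trace_le [Nonempty B] (M : Matrix (S × B) C ℂ) {s : ℝ}
    (hs : 0 < s) (hs1 : s ≤ 1) {L L' : ℝ} (hLL : L < L')
    (hL : ∀ A ∈ schattenBall C (1 / s), (mpow (sliceMap M A) (1 / (1 + s))).trace.re ≤ L) :
    ∃ τ : Matrix B B ℂ, IsState τ ∧ τ.PosDef ∧ ∀ A ∈ schattenBall C (1 / s),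
      (sliceMap M A * mpow τ (-s)).trace.re ≤ L' ^ (1 + s) := by
  obtain ⟨D, hD, h⟩ := exists_negSchattenBall_forall_trace_le M hs hs1 hLL hL
  have hpd := posDef_mpow hD.1 (-(1 / s))
  set τ₀ := mpow D (-(1 / s)) with hτ₀
  have h0 : τ₀ ≠ 0 := by
    rintro h
    have := hpd.diag_pos (i := Classical.arbitrary B)
    rw [h] at this
    simp at this
  have hc := trace_re_pos hpd.posSemidef h0
  refine ⟨(1 / τ₀.trace.re) • τ₀, isState_normalize hpd.posSemidef h0,
    hpd.smul (one_div_pos.2 hc), fun A hA => ?_⟩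
  -- The trace of `τ₀` is at most 1, so passing to the state only lowers the pairing.
  have e : mpow ((1 / τ₀.trace.re) • τ₀) (-s) = τ₀.trace.re ^ s • D := by
    rw [mpow_smul hpd.posSemidef (by positivity), hτ₀, mpow_mpow hD.1.posSemidef]
    have e1 : -(1 / s) * -s = 1 := by field_simp
    rw [e1, mpow_one hD.1.1, ← hτ₀, one_div, Real.inv_rpow hc.le, Real.rpow_neg hc.le, inv_inv]
  rw [e, Matrix.mul_smul, trace_smul, Complex.smul_re, smul_eq_mul]
  have h1 : τ₀.trace.re ^ s ≤ 1 := Real.rpow_le_one hc.le hD.2 hs.le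
  have h2 := trace_mul_re_nonneg (sliceMap_posSemidef M hA.1) hD.1.posSemidef
  exact (mul_le_of_le_one_left h2 h1).trans (h A hA)

end Minimax

/-! ### Weak and strong duality for the optimized sandwiched divergence. -/

section SandwichedDuality

variable {S B C : Type*} [Fintype S] [DecidableEq S] [Fintype B] [DecidableEq B] [Fintype C]
  [DecidableEq C]

theorem sandReal_one_kronecker {M : Matrix (S × B) C ℂ} (hM : IsState (M * Mᴴ))
    {τ : Matrix B B ℂ} (hτ : τ.PosSemidef) {a : ℝ} (ha : 0 < a) (ha1 : a ≠ 1)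
    (hfin : FiniteDomain a (M * Mᴴ) ((1 : Matrix S S ℂ) ⊗ₖ τ)) :
    sandReal a (M * Mᴴ) ((1 : Matrix S S ℂ) ⊗ₖ τ) =
      ((1 / (a - 1) * Real.logb 2
        (mpow (sliceMap (flipMat M) (mpow τ ((1 - a) / a))) a).trace.re : ℝ) : EReal) := by
  rw [sandReal_eq hfin hM, mpow_one_kronecker hτ.1]
  have h1 := trace_cfc_sandwich M (X := mpow τ ((1 - a) / (2 * a))) (isHermitian_cfc _ _)
    (f := fun t => t ^ a) (Real.zero_rpow ha.ne')
  have e : (1 - a) / (2 * a) + (1 - a) / (2 * a) = (1 - a) / a := by field_simp; ring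
  rw [mpow_mul_mpow hτ (fun h => by linarith), e] at h1
  change (mpow (_ * (M * Mᴴ) * _) a).trace = (mpow (sliceMap _ _) a).trace at h1
  rw [h1]

theorem trace_sliceMap (M : Matrix (S × B) C ℂ) (A : Matrix C C ℂ) :
    (sliceMap M A).trace =
      (flipMat M * (flipMat M)ᴴ * ((1 : Matrix S S ℂ) ⊗ₖ A)).trace := by
  have h := trace_sliceMap_mul M A 1
  rw [Matrix.mul_one, sliceMap.eq_1 (flipMat M), transpose_one, Matrix.mul_one,
    ← trace_mul_one_kronecker] at h
  exact h

theorem orthogonal_iff_sliceMap_eq_zero (M : Matrix (S × B) C ℂ) {ω : Matrix C C ℂ}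
    (hω : ω.PosSemidef) {s : ℝ} (hs : s ≠ 0) :
    Orthogonal (flipMat M * (flipMat M)ᴴ) ((1 : Matrix S S ℂ) ⊗ₖ ω) ↔
      sliceMap M (mpow ω s) = 0 := by
  have hωs := posSemidef_mpow hω s
  have hslice := sliceMap_posSemidef M hωs
  have hN := posSemidef_self_mul_conjTranspose (flipMat M)
  have h1 : sliceMap M (mpow ω s) = 0 ↔
      flipMat M * (flipMat M)ᴴ * ((1 : Matrix S S ℂ) ⊗ₖ mpow ω s) = 0 := by
    rw [← trace_mul_re_eq_zero hN (posSemidef_one_kronecker hωs), ← trace_sliceMap]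
    constructor
    · intro h; rw [h]; simp
    · intro h
      by_contra h0
      exact (trace_re_pos hslice h0).ne' h
  rw [h1, Orthogonal]
  constructor
  · intro h
    have : mpow ω s = ω * mpow ω (s - 1) := by
      rw [mul_mpow_self hω (by simpa using hs), add_sub_cancel]
    rw [this, ← Matrix.one_mul (1 : Matrix S S ℂ), Matrix.mul_kronecker_mul, ← Matrix.mul_assoc, h,
      Matrix.zero_mul]
  · intro h
    have : ω = mpow ω s * mpow ω (1 - s) := by
      rw [mpow_mul_mpow hω (fun h => by linarith), add_sub_cancel, mpow_one hω.1]
    rw [this, ← Matrix.one_mul (1 : Matrix S S ℂ), Matrix.mul_kronecker_mul, ← Matrix.mul_assoc, h,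
      Matrix.zero_mul]

/-- At order 1/(1+s) the slice is taken at ω^s; at the dual order 1/(1-s) it is taken at τ^(-s)
(`sandReal_of_suppLE`). The prefactors become ∓1/s once the powers 1±s are put inside the logarithm.
-/
theorem sandReal_flip_of_pos {M : Matrix (S × B) C ℂ} (hM : IsState (M * Mᴴ)) {ω : Matrix C C ℂ}
    (hω : IsState ω) {s : ℝ} (hs : 0 < s)
    (hq : 0 < (mpow (sliceMap M (mpow ω s)) (1 / (1 + s))).trace.re) :
    sandReal (1 / (1 + s)) (flipMat M * (flipMat M)ᴴ) ((1 : Matrix S S ℂ) ⊗ₖ ω) =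
      ((-(1 / s) * Real.logb 2
        ((mpow (sliceMap M (mpow ω s)) (1 / (1 + s))).trace.re ^ (1 + s)) : ℝ) : EReal) := by
  have h1s : 0 < 1 + s := by linarith
  have hlt : 1 / (1 + s) < 1 := by rw [div_lt_one h1s]; linarith
  have hor : ¬ Orthogonal (flipMat M * (flipMat M)ᴴ) ((1 : Matrix S S ℂ) ⊗ₖ ω) := by
    rw [orthogonal_iff_sliceMap_eq_zero M hω.1 hs.ne']
    intro h
    have hz := mpow_smul (Matrix.PosSemidef.zero (n := B) (R := ℂ)) (le_refl (0 : ℝ)) (1 / (1 + s))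
    rw [Real.zero_rpow (by positivity), zero_smul ℝ (0 : Matrix B B ℂ), zero_smul] at hz
    rw [h, hz] at hq
    simp at hq
  rw [sandReal_one_kronecker hM.flip hω.1 (by positivity) hlt.ne (Or.inl ⟨hlt, hor⟩),
    flipMat_flipMat, Real.logb_rpow_eq_mul_logb_of_pos hq]
  have e1 : (1 - 1 / (1 + s)) / (1 / (1 + s)) = s := by field_simp; ring
  have e2 : 1 / (1 / (1 + s) - 1) = -(1 / s) * (1 + s) := by
    have : 1 / (1 + s) - 1 = -(s / (1 + s)) := by field_simp; ring
    rw [this]; field_simp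
  rw [e1, e2, mul_assoc]

theorem sandReal_flip_of_eq_zero {M : Matrix (S × B) C ℂ} (hM : IsState (M * Mᴴ))
    {ω : Matrix C C ℂ} (hω : IsState ω) {s : ℝ} (hs : 0 < s)
    (hq : ¬ 0 < (mpow (sliceMap M (mpow ω s)) (1 / (1 + s))).trace.re) :
    sandReal (1 / (1 + s)) (flipMat M * (flipMat M)ᴴ) ((1 : Matrix S S ℂ) ⊗ₖ ω) = ⊤ := by
  have h1s : 0 < 1 + s := by linarith
  have hlt : 1 / (1 + s) < 1 := by rw [div_lt_one h1s]; linarith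
  rw [sandReal, if_neg]
  rw [finiteDomain_of_lt_one hlt hM.flip.1.1 hM.flip.ne_zero
    (posSemidef_one_kronecker (S := S) hω.1).1, not_not,
    orthogonal_iff_sliceMap_eq_zero M hω.1 hs.ne']
  by_contra h
  exact hq (trace_mpow_pos (sliceMap_posSemidef M (posSemidef_mpow hω.1 s)) h _)

theorem sandReal_of_suppLE {M : Matrix (S × B) C ℂ} (hM : IsState (M * Mᴴ)) {τ : Matrix B B ℂ}
    (hτ : IsState τ) (hsupp : SuppLE (M * Mᴴ) ((1 : Matrix S S ℂ) ⊗ₖ τ)) {s : ℝ} (hs : 0 < s)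
    (hs1 : s < 1) :
    sandReal (1 / (1 - s)) (M * Mᴴ) ((1 : Matrix S S ℂ) ⊗ₖ τ) =
      ((1 / s * Real.logb 2 ((mpow (sliceMap (flipMat M) (mpow τ (-s)))
        (1 / (1 - s))).trace.re ^ (1 - s)) : ℝ) : EReal) := by
  have h1s : 0 < 1 - s := by linarith
  have hlt : 1 < 1 / (1 - s) := by rw [lt_div_iff₀ h1s]; linarith
  rw [sandReal_one_kronecker hM hτ.1 (by positivity) hlt.ne' (Or.inr hsupp)]
  have e1 : (1 - 1 / (1 - s)) / (1 / (1 - s)) = -s := by field_simp; ring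
  have e2 : 1 / (1 / (1 - s) - 1) = 1 / s * (1 - s) := by
    have : 1 / (1 - s) - 1 = s / (1 - s) := by field_simp; ring
    rw [this]; field_simp
  rw [e1, e2]
  have hT := trace_mpow_nonneg (sliceMap_posSemidef (flipMat M) (posSemidef_mpow hτ.1 (-s)))
    (1 / (1 - s))
  rcases hT.eq_or_lt with h | h
  · rw [← h, Real.zero_rpow h1s.ne']; simp
  · rw [Real.logb_rpow_eq_mul_logb_of_pos h, mul_assoc]

theorem sliceMap_mul_kerProj_eq_zero {M : Matrix (S × B) C ℂ} {τ : Matrix B B ℂ}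
    (hτ : τ.PosSemidef) (hsupp : SuppLE (M * Mᴴ) ((1 : Matrix S S ℂ) ⊗ₖ τ)) {A : Matrix C C ℂ}
    (hA : A.PosSemidef) : sliceMap M A * kerProj τ = 0 := by
  rw [suppLE_iff' (isHermitian_mul_conjTranspose_self M) (isHermitian_one_kronecker hτ.1),
    kerProj_one_kronecker hτ.1, Matrix.self_mul_conjTranspose_mul_eq_zero] at hsupp
  rw [← trace_mul_re_eq_zero (sliceMap_posSemidef M hA) (posSemidef_kerProj hτ.1), sliceMap,
    ← trace_mul_one_kronecker, Matrix.mul_assoc, hsupp]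
  simp

/-- Weak duality below the pairing. -/
theorem rpow_le_trace_sliceMap {M : Matrix (S × B) C ℂ} {τ : Matrix B B ℂ} (hτ : IsState τ)
    (hsupp : SuppLE (M * Mᴴ) ((1 : Matrix S S ℂ) ⊗ₖ τ)) {A : Matrix C C ℂ} (hA : A.PosSemidef)
    {s : ℝ} (hs : 0 < s) :
    (mpow (sliceMap M A) (1 / (1 + s))).trace.re ^ (1 + s) ≤
      (sliceMap M A * mpow τ (-s)).trace.re :=
  le_trace_mul_mpow_neg (sliceMap_posSemidef M hA) hτ.1 hτ.trace_re.le hs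
    (sliceMap_mul_kerProj_eq_zero hτ.1 hsupp hA)

/-- Weak duality above the pairing. -/
theorem trace_sliceMap_le_rpow (M : Matrix (S × B) C ℂ) {Y : Matrix B B ℂ} (hY : Y.PosSemidef)
    {ω : Matrix C C ℂ} (hω : IsState ω) {s : ℝ} (hs : 0 < s) (hs1 : s < 1) :
    (sliceMap M (mpow ω s) * Y).trace.re ≤
      (mpow (sliceMap (flipMat M) Y) (1 / (1 - s))).trace.re ^ (1 - s) := by
  rw [trace_sliceMap_mul]
  exact trace_mul_mpow_le (sliceMap_posSemidef _ hY) hω.1 hω.trace_re.le hs hs1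

/-- The pairing of ω^s with τ^(-s) lies between the two traces, by reverse Hölder on B and Hölder on
C. -/
theorem neg_sandReal_le {M : Matrix (S × B) C ℂ} (hM : IsState (M * Mᴴ)) {τ : Matrix B B ℂ}
    (hτ : IsState τ) {ω : Matrix C C ℂ} (hω : IsState ω) {s : ℝ} (hs : 0 < s) (hs1 : s < 1) :
    -sandReal (1 / (1 - s)) (M * Mᴴ) ((1 : Matrix S S ℂ) ⊗ₖ τ) ≤
      sandReal (1 / (1 + s)) (flipMat M * (flipMat M)ᴴ) ((1 : Matrix S S ℂ) ⊗ₖ ω) := by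
  by_cases hq : 0 < (mpow (sliceMap M (mpow ω s)) (1 / (1 + s))).trace.re
  swap
  · rw [sandReal_flip_of_eq_zero hM hω hs hq]; exact le_top
  have hlt : 1 < 1 / (1 - s) := by rw [lt_div_iff₀ (by linarith)]; linarith
  by_cases hsupp : SuppLE (M * Mᴴ) ((1 : Matrix S S ℂ) ⊗ₖ τ)
  swap
  · rw [sandReal, if_neg (by rwa [finiteDomain_of_one_lt hlt]), EReal.neg_top]
    exact bot_le
  rw [sandReal_flip_of_pos hM hω hs hq, sandReal_of_suppLE hM hτ hsupp hs hs1, ← EReal.coe_neg,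
    EReal.coe_le_coe_iff, neg_mul, neg_le_neg_iff]
  refine mul_le_mul_of_nonneg_left ?_ (one_div_pos.2 hs).le
  refine Real.logb_le_logb_of_le (by norm_num) (Real.rpow_pos_of_pos hq _) ?_
  exact (rpow_le_trace_sliceMap hτ hsupp (posSemidef_mpow hω.1 s) hs).trans
    (trace_sliceMap_le_rpow M (posSemidef_mpow hτ.1 (-s)) hω hs hs1)

theorem continuousAt_mpow_exponent {n : Type*} [Fintype n] [DecidableEq n] {X : Matrix n n ℂ}
    (hX : X.IsHermitian) {p : ℝ} (hp : p ≠ 0) : ContinuousAt (fun p : ℝ => mpow X p) p := by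
  have h1 : ContinuousAt (fun p : ℝ => fun i => ((hX.eigenvalues i ^ p : ℝ) : ℂ)) p :=
    continuousAt_pi.2 fun i => Complex.continuous_ofReal.continuousAt.comp
      (Real.continuousAt_const_rpow' hp)
  have hc : Continuous fun d : n → ℂ => (hX.eigenvectorUnitary : Matrix n n ℂ) * diagonal d *
      (hX.eigenvectorUnitary : Matrix n n ℂ)ᴴ :=
    (continuous_const.matrix_mul continuous_id.matrix_diagonal).matrix_mul continuous_const
  have h2 : (fun p : ℝ => mpow X p) = fun p => (hX.eigenvectorUnitary : Matrix n n ℂ) *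
      diagonal (fun i => ((hX.eigenvalues i ^ p : ℝ) : ℂ)) *
      (hX.eigenvectorUnitary : Matrix n n ℂ)ᴴ := by
    funext p
    rw [mpow, cfc_eq_conj _ hX]
  rw [h2]
  exact ContinuousAt.comp (f := fun p : ℝ => fun i => ((hX.eigenvalues i ^ p : ℝ) : ℂ))
    hc.continuousAt h1

theorem tendsto_one_sub_inv_atTop : Tendsto (fun a : ℝ => 1 - a⁻¹) atTop (𝓝 1) := by
  have := tendsto_const_nhds (x := (1 : ℝ)) (f := atTop).sub tendsto_inv_atTop_zero
  rwa [sub_zero] at this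

theorem sandDiv_top_eq {n : Type*} [Fintype n] [DecidableEq n] (ρ σ : Matrix n n ℂ) :
    sandDiv ⊤ ρ σ = liminf (fun a : ℝ => sandReal a ρ σ) atTop := by
  rw [sandDiv, extendOrder, if_neg ENNReal.top_ne_zero, if_neg ENNReal.top_ne_one, if_pos rfl]

theorem tendsto_trace_sliceMap_mpow (M : Matrix (S × B) C ℂ) {τ : Matrix B B ℂ}
    (hτ : τ.IsHermitian) {ω : Matrix C C ℂ} (hω : ω.IsHermitian) :
    Tendsto (fun a : ℝ => (sliceMap M (mpow ω (1 - a⁻¹)) * mpow τ (-(1 - a⁻¹))).trace.re) atTop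
      (𝓝 (sliceMap M (mpow ω 1) * mpow τ (-1)).trace.re) := by
  have h1 : Tendsto (fun a : ℝ => mpow ω (1 - a⁻¹)) atTop (𝓝 (mpow ω 1)) :=
    Tendsto.comp (g := fun p : ℝ => mpow ω p)
      (continuousAt_mpow_exponent hω (p := 1) one_ne_zero).tendsto tendsto_one_sub_inv_atTop
  have h2 : Tendsto (fun a : ℝ => mpow τ (-(1 - a⁻¹))) atTop (𝓝 (mpow τ (-1))) :=
    Tendsto.comp (g := fun p : ℝ => mpow τ p)
      (continuousAt_mpow_exponent hτ (p := -1) (by norm_num)).tendsto tendsto_one_sub_inv_atTop.neg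
  have h3 := (continuous_trace_sliceMap_mul M).tendsto (mpow ω 1, mpow τ (-1))
  exact Tendsto.comp (f := fun a : ℝ => (mpow ω (1 - a⁻¹), mpow τ (-(1 - a⁻¹)))) h3
    (h1.prodMk_nhds h2)

/-- Reverse Hölder still holds at `s = 1`. The Hölder half is used at `s = 1 - a⁻¹`, and the pairing
is continuous in `s` as `a → ∞`. -/
theorem neg_sandDiv_top_le {M : Matrix (S × B) C ℂ} (hM : IsState (M * Mᴴ)) {τ : Matrix B B ℂ}
    (hτ : IsState τ) {ω : Matrix C C ℂ} (hω : IsState ω) :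
    -sandDiv ⊤ (M * Mᴴ) ((1 : Matrix S S ℂ) ⊗ₖ τ) ≤
      sandReal (1 / (1 + 1)) (flipMat M * (flipMat M)ᴴ) ((1 : Matrix S S ℂ) ⊗ₖ ω) := by
  by_cases hq : 0 < (mpow (sliceMap M (mpow ω 1)) (1 / (1 + 1))).trace.re
  swap
  · rw [sandReal_flip_of_eq_zero hM hω one_pos hq]; exact le_top
  rw [sandDiv_top_eq]
  by_cases hsupp : SuppLE (M * Mᴴ) ((1 : Matrix S S ℂ) ⊗ₖ τ)
  swap
  · have : Tendsto (fun a : ℝ => sandReal a (M * Mᴴ) ((1 : Matrix S S ℂ) ⊗ₖ τ)) atTop (𝓝 ⊤) := by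
      refine tendsto_const_nhds.congr' ?_
      filter_upwards [eventually_gt_atTop 1] with a ha
      rw [sandReal, if_neg (by rwa [finiteDomain_of_one_lt ha])]
    rw [this.liminf_eq, EReal.neg_top]
    exact bot_le
  rw [sandReal_flip_of_pos hM hω one_pos hq, EReal.neg_le]
  have hQ := Real.rpow_pos_of_pos hq (1 + 1)
  have hle := rpow_le_trace_sliceMap hτ hsupp (posSemidef_mpow hω.1 1) one_pos
  have hGt := tendsto_trace_sliceMap_mpow M hτ.1.1 hω.1.1
  set G : ℝ → ℝ := fun s => (sliceMap M (mpow ω s) * mpow τ (-s)).trace.re with hG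
  change Tendsto (fun a : ℝ => G (1 - a⁻¹)) atTop (𝓝 (G 1)) at hGt
  have hG1 : 0 < G 1 := hQ.trans_le hle
  have hlim : Tendsto (fun a : ℝ => 1 / (1 - a⁻¹) * Real.logb 2 (G (1 - a⁻¹))) atTop
      (𝓝 (1 / 1 * Real.logb 2 (G 1))) :=
    (tendsto_const_nhds.div tendsto_one_sub_inv_atTop one_ne_zero).mul
      ((hGt.log hG1.ne').div_const _)
  have hlimE := (continuous_coe_real_ereal.tendsto _).comp hlim
  calc -((-(1 / 1) * Real.logb 2
        ((mpow (sliceMap M (mpow ω 1)) (1 / (1 + 1))).trace.re ^ ((1 : ℝ) + 1)) : ℝ) : EReal)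
      ≤ ((1 / 1 * Real.logb 2 (G 1) : ℝ) : EReal) := by
        rw [← EReal.coe_neg, EReal.coe_le_coe_iff, neg_mul, neg_neg]
        exact mul_le_mul_of_nonneg_left (Real.logb_le_logb_of_le (by norm_num) hQ hle) (by norm_num)
    _ = liminf (fun a : ℝ =>
          ((1 / (1 - a⁻¹) * Real.logb 2 (G (1 - a⁻¹)) : ℝ) : EReal)) atTop := hlimE.liminf_eq.symm
    _ ≤ _ := by
        refine liminf_le_liminf ?_
        filter_upwards [eventually_gt_atTop 1, hGt.eventually (lt_mem_nhds hG1)] with a ha hGa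
        have ha0 : 0 < a := one_pos.trans ha
        have hs : 0 < 1 - a⁻¹ := sub_pos.2 (inv_lt_one_of_one_lt₀ ha)
        have hs1 : 1 - a⁻¹ < 1 := by linarith [inv_pos.2 ha0]
        have h := sandReal_of_suppLE hM hτ hsupp hs hs1
        rw [sub_sub_cancel, one_div, inv_inv] at h
        rw [h, EReal.coe_le_coe_iff]
        refine mul_le_mul_of_nonneg_left ?_ (one_div_pos.2 hs).le
        refine Real.logb_le_logb_of_le (by norm_num) hGa ?_
        have := trace_sliceMap_le_rpow M (posSemidef_mpow hτ.1 (-(1 - a⁻¹))) hω hs hs1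
        rwa [sub_sub_cancel, one_div, inv_inv] at this

theorem mpow_zero_matrix {n : Type*} [Fintype n] [DecidableEq n] {p : ℝ} (hp : p ≠ 0) :
    mpow (0 : Matrix n n ℂ) p = 0 := by
  have h := mpow_smul (Matrix.PosSemidef.zero (n := n) (R := ℂ)) (le_refl (0 : ℝ)) p
  rwa [Real.zero_rpow hp, zero_smul ℝ (0 : Matrix n n ℂ), zero_smul] at h

/-- Strong duality: a lower bound on all divergences of the dual marginal is certified by an
invertible state. -/
theorem exists_state_of_forall_lt_sandReal {M : Matrix (S × B) C ℂ} (hM : IsState (M * Mᴴ))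
    {s : ℝ} (hs : 0 < s) (hs1 : s ≤ 1) {m m' : ℝ} (hmm : m < m')
    (h : ∀ ω : Matrix C C ℂ, IsState ω → (m' : EReal) <
      sandReal (1 / (1 + s)) (flipMat M * (flipMat M)ᴴ) ((1 : Matrix S S ℂ) ⊗ₖ ω)) :
    ∃ τ : Matrix B B ℂ, IsState τ ∧ τ.PosDef ∧ ∀ A ∈ schattenBall C (1 / s),
      (sliceMap M A * mpow τ (-s)).trace.re ≤ 2 ^ (-(s * m)) := by
  have h1s : 0 < 1 + s := by linarith
  have hne : Nonempty B := by
    by_contra hB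
    rw [not_nonempty_iff] at hB
    have := hM.trFst.trace_re
    simp [Matrix.trace] at this
  set β := 1 / (1 + s) with hβ
  have hβ0 : 0 < β := by positivity
  have hexp : (2 : ℝ) ^ (-(s * m)) = ((2 : ℝ) ^ (-(s * m) * β)) ^ (1 + s) := by
    rw [← Real.rpow_mul (by norm_num), mul_assoc, hβ, one_div_mul_cancel h1s.ne', mul_one]
  rw [hexp]
  refine exists_state_forall_trace_le M hs hs1 (L := 2 ^ (-(s * m') * β)) ?_ fun A hA => ?_
  · refine Real.rpow_lt_rpow_of_exponent_lt (by norm_num) ?_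
    refine mul_lt_mul_of_pos_right ?_ hβ0
    exact neg_lt_neg (mul_lt_mul_of_pos_left hmm hs)
  have hstate : ∀ ω : Matrix C C ℂ, IsState ω →
      (mpow (sliceMap M (mpow ω s)) β).trace.re ≤ 2 ^ (-(s * m') * β) := by
    intro ω hω
    by_cases hq : 0 < (mpow (sliceMap M (mpow ω s)) (1 / (1 + s))).trace.re
    · have h2 := h ω hω
      rw [sandReal_flip_of_pos hM hω hs hq, EReal.coe_lt_coe_iff,
        Real.logb_rpow_eq_mul_logb_of_pos hq] at h2
      rw [← Real.logb_le_iff_le_rpow (by norm_num) hq]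
      set l := Real.logb 2 (mpow (sliceMap M (mpow ω s)) (1 / (1 + s))).trace.re
      have e1 : (1 + s) * l < -(s * m') := by
        have := mul_lt_mul_of_pos_left h2 hs
        have e : s * (-(1 / s) * ((1 + s) * l)) = -((1 + s) * l) := by field_simp
        linarith
      rw [hβ, mul_one_div, le_div_iff₀ h1s]
      linarith
    · exact (not_lt.1 hq).trans (by positivity)
  by_cases hA0 : A = 0
  · have e : sliceMap M (0 : Matrix C C ℂ) = 0 := by
      have := sliceMap_smul M 0 (0 : Matrix C C ℂ)
      rwa [zero_smul, zero_smul] at this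
    rw [hA0, e, mpow_zero_matrix hβ0.ne']
    simp only [trace_zero, Complex.zero_re]
    positivity
  have hAp := posSemidef_mpow hA.1 (1 / s)
  have hAp0 := mpow_ne_zero hA.1 hA0 (1 / s)
  have hc := trace_re_pos hAp hAp0
  have hω := isState_normalize hAp hAp0
  set c := (mpow A (1 / s)).trace.re with hcdef
  -- Every nonzero element of the ball is ω^s for a state ω, times a factor `c ^ s ≤ 1`.
  have e : A = c ^ s • mpow ((1 / c) • mpow A (1 / s)) s := by
    rw [mpow_smul hAp (by positivity), mpow_mpow hA.1, one_div_mul_cancel hs.ne', mpow_one hA.1.1,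
      smul_smul, ← Real.mul_rpow hc.le (by positivity), mul_one_div_cancel hc.ne', Real.one_rpow,
      one_smul]
  have hpos := sliceMap_posSemidef M (posSemidef_mpow hω.1 s)
  rw [e, sliceMap_smul, mpow_smul hpos (by positivity), trace_smul, Complex.smul_re, smul_eq_mul]
  refine (mul_le_of_le_one_left (trace_mpow_nonneg hpos _) ?_).trans (hstate _ hω)
  exact Real.rpow_le_one (by positivity) (Real.rpow_le_one hc.le hA.2 hs.le) hβ0.le

theorem sliceMap_ne_zero_of_posDef {M : Matrix (S × B) C ℂ} (hM : IsState (M * Mᴴ))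
    {D : Matrix B B ℂ} (hD : D.PosDef) : sliceMap (flipMat M) D ≠ 0 := by
  have h := orthogonal_iff_sliceMap_eq_zero (flipMat M) hD.posSemidef (one_ne_zero (α := ℝ))
  rw [mpow_one hD.1, flipMat_flipMat] at h
  rw [Ne, ← h]
  exact not_orthogonal_of_suppLE hM.1.1 hM.ne_zero (posSemidef_one_kronecker hD.posSemidef).1
    (suppLE_of_posDef _ (Matrix.PosDef.one.kronecker hD))

/-- The extremal element of the Schatten ball attaining the dual norm. -/
theorem exists_schattenBall_trace_eq {n : Type*} [Fintype n] [DecidableEq n] {X : Matrix n n ℂ}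
    (hX : X.PosSemidef) (hX0 : X ≠ 0) {s : ℝ} (hs : 0 < s) (hs1 : s < 1) :
    ∃ A ∈ schattenBall n (1 / s), (X * A).trace.re =
      (mpow X (1 / (1 - s))).trace.re ^ (1 - s) := by
  have h1s : 0 < 1 - s := by linarith
  set T := (mpow X (1 / (1 - s))).trace.re with hT
  have hT0 : 0 < T := trace_mpow_pos hX hX0 _
  have hXp := posSemidef_mpow hX (s / (1 - s))
  have hTs : 0 ≤ T ^ (-s) := (Real.rpow_pos_of_pos hT0 _).le
  refine ⟨T ^ (-s) • mpow X (s / (1 - s)), ⟨hXp.smul hTs, ?_⟩, ?_⟩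
  · have e1 : s / (1 - s) * (1 / s) = 1 / (1 - s) := by field_simp
    have e2 : (T ^ (-s)) ^ (1 / s) = T⁻¹ := by
      rw [← Real.rpow_mul hT0.le, neg_mul, mul_one_div_cancel hs.ne', Real.rpow_neg_one]
    rw [mpow_smul hXp hTs, mpow_mpow hX, e1, e2, trace_smul, Complex.smul_re, ← hT, smul_eq_mul,
      inv_mul_cancel₀ hT0.ne']
  · have e1 : 1 + s / (1 - s) = 1 / (1 - s) := by field_simp; ring
    rw [Matrix.mul_smul, trace_smul, Complex.smul_re,
      trace_mpow_add_one hX _ (by rw [add_comm, e1]; positivity), e1, ← hT, smul_eq_mul,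
      ← Real.rpow_add_one hT0.ne', neg_add_eq_sub]

/-- The equality case of Hölder is one of the tested A, so the uniform bound controls the whole norm
of the slice. -/
theorem sandReal_le_of_forall_trace_le {M : Matrix (S × B) C ℂ} (hM : IsState (M * Mᴴ))
    {τ : Matrix B B ℂ} (hτ : IsState τ) (hτp : τ.PosDef) {s : ℝ} (hs : 0 < s) (hs1 : s < 1)
    {V : ℝ} (h : ∀ A ∈ schattenBall C (1 / s), (sliceMap M A * mpow τ (-s)).trace.re ≤ V) :
    sandReal (1 / (1 - s)) (M * Mᴴ) ((1 : Matrix S S ℂ) ⊗ₖ τ) ≤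
      ((1 / s * Real.logb 2 V : ℝ) : EReal) := by
  have hsupp := suppLE_of_posDef (M * Mᴴ)
    ((Matrix.PosDef.one (n := S) (R := ℂ)).kronecker hτp)
  have hX := sliceMap_posSemidef (flipMat M) (posSemidef_mpow hτ.1 (-s))
  have hX0 := sliceMap_ne_zero_of_posDef hM (posDef_mpow hτp (-s))
  rw [sandReal_of_suppLE hM hτ hsupp hs hs1, EReal.coe_le_coe_iff]
  refine mul_le_mul_of_nonneg_left ?_ (one_div_pos.2 hs).le
  refine Real.logb_le_logb_of_le (by norm_num)
    (Real.rpow_pos_of_pos (trace_mpow_pos hX hX0 _) _) ?_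
  obtain ⟨A, hA, hAeq⟩ := exists_schattenBall_trace_eq hX hX0 hs hs1
  rw [← hAeq, ← trace_sliceMap_mul]
  exact h A hA

theorem trace_mul_mpow_neg_le {n : Type*} [Fintype n] [DecidableEq n] {Y τ : Matrix n n ℂ}
    (hY : Y.PosSemidef) (hτ : IsState τ) (hτp : τ.PosDef) {s : ℝ} (hs1 : s ≤ 1) :
    (Y * mpow τ (-s)).trace.re ≤ (Y * mpow τ (-1)).trace.re := by
  have hle : ∀ i, hτ.1.1.eigenvalues i ≤ 1 := by
    intro i
    have h1 := trace_cfc_re (fun x => x) hτ.1.1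
    rw [cfc_id_matrix hτ.1.1, hτ.trace_re] at h1
    rw [h1]
    exact Finset.single_le_sum (f := fun i => hτ.1.1.eigenvalues i)
      (fun k _ => hτ.1.eigenvalues_nonneg k) (Finset.mem_univ i)
  have hpsd : (mpow τ (-1) - mpow τ (-s)).PosSemidef := by
    rw [mpow, mpow, ← cfc_sub (a := τ) _ _ (continuousOn_spectrum _ _) (continuousOn_spectrum _ _)]
    refine posSemidef_cfc hτ.1.1 fun i => sub_nonneg.2 ?_
    exact Real.rpow_le_rpow_of_exponent_ge (hτp.eigenvalues_pos i) (hle i) (by linarith)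
  have := trace_mul_re_nonneg hY hpsd
  rw [Matrix.mul_sub, trace_sub, Complex.sub_re] at this
  linarith

/-- At a finite order `a` the ball is larger than the trace ball, but only by the factor `card C ^
a⁻¹`, which tends to 1; replacing τ^(-s) by τ^(-1) only increases the pairing. -/
theorem sandDiv_top_le_of_forall_trace_le {M : Matrix (S × B) C ℂ} (hM : IsState (M * Mᴴ))
    {τ : Matrix B B ℂ} (hτ : IsState τ) (hτp : τ.PosDef) {V : ℝ} (hV : 0 < V)
    (h : ∀ A ∈ schattenBall C 1, (sliceMap M A * mpow τ (-1)).trace.re ≤ V) :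
    sandDiv ⊤ (M * Mᴴ) ((1 : Matrix S S ℂ) ⊗ₖ τ) ≤ ((Real.logb 2 V : ℝ) : EReal) := by
  have hne : Nonempty C := by
    by_contra hC
    rw [not_nonempty_iff] at hC
    have := hM.flip.trFst.trace_re
    simp [Matrix.trace] at this
  have hd : (0 : ℝ) < Fintype.card C := by exact_mod_cast Fintype.card_pos
  have hbound : ∀ a : ℝ, 1 < a → sandReal a (M * Mᴴ) ((1 : Matrix S S ℂ) ⊗ₖ τ) ≤
      ((1 / (1 - a⁻¹) * Real.logb 2 ((Fintype.card C : ℝ) ^ a⁻¹ * V) : ℝ) : EReal) := by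
    intro a ha
    have ha0 : 0 < a := one_pos.trans ha
    have hs : 0 < 1 - a⁻¹ := sub_pos.2 (inv_lt_one_of_one_lt₀ ha)
    have hs1 : 1 - a⁻¹ < 1 := by linarith [inv_pos.2 ha0]
    have key := sandReal_le_of_forall_trace_le hM hτ hτp hs hs1
      (V := (Fintype.card C : ℝ) ^ a⁻¹ * V) ?_
    · rwa [sub_sub_cancel, one_div, inv_inv] at key
    intro A hA
    refine (trace_mul_mpow_neg_le (sliceMap_posSemidef M hA.1) hτ hτp hs1.le).trans ?_
    have hdp : 0 < (Fintype.card C : ℝ) ^ a⁻¹ := Real.rpow_pos_of_pos hd _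
    have htr : A.trace.re ≤ (Fintype.card C : ℝ) ^ a⁻¹ := by
      have h1 := trace_mul_mpow_le (Matrix.PosSemidef.one (n := C) (R := ℂ))
        (posSemidef_mpow hA.1 (1 / (1 - a⁻¹))) hA.2 hs hs1
      rw [mpow_inv_mpow hA.1 (one_div_mul_cancel hs.ne'), Matrix.one_mul, sub_sub_cancel,
        one_div, inv_inv] at h1
      have hsa : IsSelfAdjoint (1 : Matrix C C ℂ) := IsSelfAdjoint.one _
      have e : mpow (1 : Matrix C C ℂ) a = 1 := by
        rw [mpow, cfc_apply_one (R := ℝ)]; simp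
      rwa [e, trace_one, Complex.natCast_re] at h1
    have hA' : ((Fintype.card C : ℝ) ^ a⁻¹)⁻¹ • A ∈ schattenBall C 1 := by
      refine ⟨hA.1.smul (inv_pos.2 hdp).le, ?_⟩
      rw [mpow_one (hA.1.smul (inv_pos.2 hdp).le).1, trace_smul, Complex.smul_re, smul_eq_mul,
        inv_mul_le_iff₀ hdp, mul_one]
      exact htr
    have h2 := h _ hA'
    rw [sliceMap_smul, Matrix.smul_mul, trace_smul, Complex.smul_re, smul_eq_mul,
      inv_mul_le_iff₀ hdp] at h2
    exact h2
  have hlim : Tendsto (fun a : ℝ =>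
      1 / (1 - a⁻¹) * Real.logb 2 ((Fintype.card C : ℝ) ^ a⁻¹ * V)) atTop
      (𝓝 (1 / 1 * Real.logb 2 ((Fintype.card C : ℝ) ^ (0 : ℝ) * V))) := by
    refine (tendsto_const_nhds.div tendsto_one_sub_inv_atTop one_ne_zero).mul ?_
    have h1 : Tendsto (fun a : ℝ => (Fintype.card C : ℝ) ^ a⁻¹ * V) atTop
        (𝓝 ((Fintype.card C : ℝ) ^ (0 : ℝ) * V)) :=
      ((Real.continuousAt_const_rpow hd.ne').tendsto.comp tendsto_inv_atTop_zero).mul_const V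
    exact (h1.log (by simpa using hV.ne')).div_const _
  rw [Real.rpow_zero, one_mul, one_div_one, one_mul] at hlim
  rw [sandDiv_top_eq, ← ((continuous_coe_real_ereal.tendsto _).comp hlim).liminf_eq]
  refine liminf_le_liminf ?_
  filter_upwards [eventually_gt_atTop 1] with a ha
  exact hbound a ha

/-- The second real number leaves room for the loss in the minimax step. -/
theorem le_of_forall_real_lt {x y : EReal} (h : ∀ m m' : ℝ, m < m' → (m' : EReal) < x → (m : EReal) ≤ y) :
    x ≤ y := by
  refine le_of_forall_lt fun c hc => ?_
  obtain ⟨m', hcm', hm'⟩ := EReal.lt_iff_exists_real_btwn.1 hc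
  obtain ⟨m, hcm, hm⟩ := EReal.lt_iff_exists_real_btwn.1 hcm'
  exact hcm.trans_le (h m m' (EReal.coe_lt_coe_iff.1 hm) hm')

theorem iSup_neg_sandReal {M : Matrix (S × B) C ℂ} (hM : IsState (M * Mᴴ)) {s : ℝ} (hs : 0 < s)
    (hs1 : s < 1) :
    ⨆ τ : {τ : Matrix B B ℂ // IsState τ},
        -sandReal (1 / (1 - s)) (M * Mᴴ) ((1 : Matrix S S ℂ) ⊗ₖ τ.1) =
      ⨅ ω : {ω : Matrix C C ℂ // IsState ω},
        sandReal (1 / (1 + s)) (flipMat M * (flipMat M)ᴴ) ((1 : Matrix S S ℂ) ⊗ₖ ω.1) := by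
  refine le_antisymm (iSup_le fun τ => le_iInf fun ω => neg_sandReal_le hM τ.2 ω.2 hs hs1) ?_
  refine le_of_forall_real_lt fun m m' hmm hm' => ?_
  obtain ⟨τ, hτ, hτp, h⟩ := exists_state_of_forall_lt_sandReal hM hs hs1.le hmm
    fun ω hω => hm'.trans_le (iInf_le (fun ω : {ω : Matrix C C ℂ // IsState ω} => sandReal
      (1 / (1 + s)) (flipMat M * (flipMat M)ᴴ) ((1 : Matrix S S ℂ) ⊗ₖ ω.1)) ⟨ω, hω⟩)
  refine le_iSup_of_le ⟨τ, hτ⟩ ?_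
  have h1 := sandReal_le_of_forall_trace_le hM hτ hτp hs hs1 h
  rw [Real.logb_rpow (by norm_num) (by norm_num)] at h1
  have e : 1 / s * -(s * m) = -m := by field_simp
  rw [e, EReal.coe_neg] at h1
  exact EReal.le_neg_of_le_neg h1

theorem iSup_neg_sandDiv_top {M : Matrix (S × B) C ℂ} (hM : IsState (M * Mᴴ)) :
    ⨆ τ : {τ : Matrix B B ℂ // IsState τ},
        -sandDiv ⊤ (M * Mᴴ) ((1 : Matrix S S ℂ) ⊗ₖ τ.1) =
      ⨅ ω : {ω : Matrix C C ℂ // IsState ω},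
        sandReal (1 / (1 + 1)) (flipMat M * (flipMat M)ᴴ) ((1 : Matrix S S ℂ) ⊗ₖ ω.1) := by
  refine le_antisymm (iSup_le fun τ => le_iInf fun ω => neg_sandDiv_top_le hM τ.2 ω.2) ?_
  refine le_of_forall_real_lt fun m m' hmm hm' => ?_
  obtain ⟨τ, hτ, hτp, h⟩ := exists_state_of_forall_lt_sandReal hM one_pos le_rfl hmm
    fun ω hω => hm'.trans_le (iInf_le (fun ω : {ω : Matrix C C ℂ // IsState ω} => sandReal
      (1 / (1 + 1)) (flipMat M * (flipMat M)ᴴ) ((1 : Matrix S S ℂ) ⊗ₖ ω.1)) ⟨ω, hω⟩)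
  refine le_iSup_of_le ⟨τ, hτ⟩ ?_
  rw [one_div_one] at h
  have h1 := sandDiv_top_le_of_forall_trace_le hM hτ hτp (by positivity) h
  rw [Real.logb_rpow (by norm_num) (by norm_num), one_mul, EReal.coe_neg] at h1
  exact EReal.le_neg_of_le_neg h1

end SandwichedDuality

/-! ### Part 1 for all orders. -/

section Assembly

variable {S B C : Type*} [Fintype S] [DecidableEq S] [Fintype B] [DecidableEq B] [Fintype C]
  [DecidableEq C]

theorem sandDiv_ofReal {n : Type*} [Fintype n] [DecidableEq n] {a : ℝ} (ha : 0 < a) (ha1 : a ≠ 1)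
    (ρ σ : Matrix n n ℂ) : sandDiv (ENNReal.ofReal a) ρ σ = sandReal a ρ σ :=
  extendOrder_ofReal sandReal ha ha1 ρ σ

theorem sandDiv_one {n : Type*} [Fintype n] [DecidableEq n] (ρ σ : Matrix n n ℂ) :
    sandDiv 1 ρ σ = relEntropy ρ σ := by
  rw [sandDiv, extendOrder, if_neg one_ne_zero, if_pos rfl]

theorem dualOrder_ofReal {a : ℝ} (ha : 1 / 2 < a) :
    dualOrder (ENNReal.ofReal a) = ENNReal.ofReal (a / (2 * a - 1)) := by
  rw [dualOrder, if_neg ENNReal.ofReal_ne_top, ENNReal.ofReal_div_of_pos (by linarith),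
    ENNReal.ofReal_sub _ zero_le_one, ENNReal.ofReal_mul zero_le_two, ENNReal.ofReal_one,
    ENNReal.ofReal_ofNat]

theorem dualOrder_half : dualOrder (ENNReal.ofReal (1 / 2)) = ⊤ := by
  have h : (2 : ℝ≥0∞) * ENNReal.ofReal (1 / 2) - 1 = 0 := by
    rw [← ENNReal.ofReal_ofNat 2, ← ENNReal.ofReal_mul zero_le_two, mul_one_div_cancel two_ne_zero,
      ENNReal.ofReal_one, tsub_self]
  rw [dualOrder, if_neg ENNReal.ofReal_ne_top, h, ENNReal.div_zero]
  exact (ENNReal.ofReal_pos.2 (by norm_num)).ne'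

theorem dualOrder_one : dualOrder 1 = 1 := by
  have h := dualOrder_ofReal (a := 1) (by norm_num)
  norm_num at h
  exact h

theorem sandUp_eq_neg_iInf (α : ℝ≥0∞) (ρ : Matrix (S × B) (S × B) ℂ) :
    sandUp α ρ = -⨅ τ : {τ : Matrix B B ℂ // IsState τ},
      sandDiv α ρ ((1 : Matrix S S ℂ) ⊗ₖ τ.1) :=
  ereal_iSup_neg _

theorem sandUp_of_one_lt {M : Matrix (S × B) C ℂ} (hM : IsState (M * Mᴴ)) {a : ℝ} (ha : 1 < a) :
    sandUp (ENNReal.ofReal a) (M * Mᴴ) = ⨅ ω : {ω : Matrix C C ℂ // IsState ω},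
      sandDiv (ENNReal.ofReal (a / (2 * a - 1))) (flipMat M * (flipMat M)ᴴ)
        ((1 : Matrix S S ℂ) ⊗ₖ ω.1) := by
  have ha0 : 0 < a := one_pos.trans ha
  have h := iSup_neg_sandReal hM (s := 1 - a⁻¹) (sub_pos.2 (inv_lt_one_of_one_lt₀ ha))
    (by linarith [inv_pos.2 ha0])
  have e : 1 / (1 + (1 - a⁻¹)) = a / (2 * a - 1) := by
    have h1 : 1 + (1 - a⁻¹) = (2 * a - 1) / a := by field_simp; ring
    rw [h1, one_div_div]
  rw [sub_sub_cancel, one_div, inv_inv, e] at h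
  have hpos : 0 < 2 * a - 1 := by linarith
  have hne : a / (2 * a - 1) ≠ 1 := by rw [Ne, div_eq_one_iff_eq hpos.ne']; linarith
  simp only [sandUp, sandDiv_ofReal ha0 ha.ne', sandDiv_ofReal (div_pos ha0 hpos) hne]
  exact h

theorem sandUp_top {M : Matrix (S × B) C ℂ} (hM : IsState (M * Mᴴ)) :
    sandUp ⊤ (M * Mᴴ) = ⨅ ω : {ω : Matrix C C ℂ // IsState ω},
      sandDiv (ENNReal.ofReal (1 / 2)) (flipMat M * (flipMat M)ᴴ)
        ((1 : Matrix S S ℂ) ⊗ₖ ω.1) := by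
  have h := iSup_neg_sandDiv_top hM
  rw [one_add_one_eq_two] at h
  simp only [sandUp, sandDiv_ofReal (a := 1 / 2) (by norm_num) (by norm_num)]
  exact h

theorem sandUp_one {M : Matrix (S × B) C ℂ} (hM : IsState (M * Mᴴ)) :
    sandUp 1 (M * Mᴴ) = ⨅ ω : {ω : Matrix C C ℂ // IsState ω},
      sandDiv 1 (flipMat M * (flipMat M)ᴴ) ((1 : Matrix S S ℂ) ⊗ₖ ω.1) := by
  rw [sandUp_eq_neg_iInf]
  simp only [sandDiv_one]
  rw [iInf_relEntropy hM, iInf_relEntropy hM.flip, condEntropy_flip, neg_neg, EReal.coe_neg]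

theorem sandUp_eq_iInf {M : Matrix (S × B) C ℂ} (hM : IsState (M * Mᴴ)) {α : ℝ≥0∞}
    (hα : 1 / 2 ≤ α) :
    sandUp α (M * Mᴴ) = ⨅ ω : {ω : Matrix C C ℂ // IsState ω},
      sandDiv (dualOrder α) (flipMat M * (flipMat M)ᴴ) ((1 : Matrix S S ℂ) ⊗ₖ ω.1) := by
  have ehalf : ENNReal.ofReal (1 / 2) = 1 / 2 := by
    rw [ENNReal.ofReal_div_of_pos two_pos, ENNReal.ofReal_one, ENNReal.ofReal_ofNat]
  rcases eq_or_ne α ⊤ with rfl | htop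
  · rw [sandUp_top hM, dualOrder, if_pos rfl, ehalf]
  obtain ⟨a, ha0, rfl⟩ : ∃ a : ℝ, 0 ≤ a ∧ α = ENNReal.ofReal a :=
    ⟨α.toReal, ENNReal.toReal_nonneg, (ENNReal.ofReal_toReal htop).symm⟩
  rw [← ehalf, ENNReal.ofReal_le_ofReal_iff ha0] at hα
  -- The dual order is an involution exchanging orders below and above 1; for `a < 1` the known case
  -- is applied with B and C interchanged.
  rcases lt_trichotomy a 1 with ha | rfl | ha
  · rcases hα.eq_or_lt with rfl | hlt
    · have h := sandUp_top hM.flip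
      rw [flipMat_flipMat, sandUp_eq_neg_iInf] at h
      rw [dualOrder_half, sandUp_eq_neg_iInf, ← h, neg_neg]
    · have hpos : 0 < 2 * a - 1 := by linarith
      have h := sandUp_of_one_lt hM.flip (a := a / (2 * a - 1)) (by
        rw [lt_div_iff₀ hpos]; linarith)
      have e : a / (2 * a - 1) / (2 * (a / (2 * a - 1)) - 1) = a := by
        have h1 : 2 * (a / (2 * a - 1)) - 1 = 1 / (2 * a - 1) := by field_simp; ring
        rw [h1, div_div_div_cancel_right₀ hpos.ne', div_one]
      rw [flipMat_flipMat, e, sandUp_eq_neg_iInf] at h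
      rw [dualOrder_ofReal hlt, sandUp_eq_neg_iInf, ← h, neg_neg]
  · rw [ENNReal.ofReal_one, dualOrder_one, sandUp_one hM]
  · rw [dualOrder_ofReal (by linarith), sandUp_of_one_lt hM ha]

end Assembly

/-! ### From the channel and its dilation to a pure tripartite vector. -/

section Purification

variable {Q S I R E : Type*} [Fintype Q] [Fintype S] [Fintype I] [Fintype R]

/-- The amplitudes of the pure state `V |ψ⟩` on `S I R E`, as an operator from `R` to `S (I E)`. -/
def dilatedAmplitude (V : Matrix ((S × I) × R) Q ℂ) (ψ : Q × E → ℂ) :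
    Matrix (S × (I × E)) R ℂ :=
  Matrix.of fun p r => ∑ q, V ((p.1, p.2.1), r) q * ψ (q, p.2.2)

theorem mul_mul_conjTranspose_gram {P : Type*} (V : Matrix P Q ℂ) (ψ : Q × E → ℂ) (e e' : E)
    (x y : P) :
    (V * (Matrix.of fun q q' => vecMulVec ψ (star ψ) (q, e) (q', e')) * Vᴴ) x y =
      (∑ q, V x q * ψ (q, e)) * star (∑ q, V y q * ψ (q, e')) := by
  rw [star_sum, Finset.sum_mul_sum]
  simp only [mul_apply, of_apply, vecMulVec_apply, Pi.star_apply, conjTranspose_apply, star_mul',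
    Finset.sum_mul]
  rw [Finset.sum_comm]
  refine Finset.sum_congr rfl fun q _ => Finset.sum_congr rfl fun q' _ => ?_
  ring

theorem outState_eq [DecidableEq Q] {M : Matrix Q Q ℂ →ₗ[ℂ] Matrix (S × I) (S × I) ℂ}
    {V : Matrix ((S × I) × R) Q ℂ} (hV : IsStinespring M V) (ψ : Q × E → ℂ) :
    outState M (vecMulVec ψ (star ψ)) = dilatedAmplitude V ψ * (dilatedAmplitude V ψ)ᴴ := by
  ext p p'
  simp only [outState, submatrix_apply, Equiv.prodAssoc_symm_apply, tensorId, of_apply, hV.2,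
    trSnd, mul_mul_conjTranspose_gram]
  simp only [mul_apply, conjTranspose_apply, dilatedAmplitude, of_apply]

/-- Tracing E before the isometry and I after it amounts to tracing IE out of the dilated vector. -/
theorem complChannel_eq [Fintype E] (V : Matrix ((S × I) × R) Q ℂ) (ψ : Q × E → ℂ) :
    complChannel V (trSnd (vecMulVec ψ (star ψ))) =
      flipMat (dilatedAmplitude V ψ) * (flipMat (dilatedAmplitude V ψ))ᴴ := by
  have h : trSnd (vecMulVec ψ (star ψ)) =
      ∑ e, Matrix.of fun q q' => vecMulVec ψ (star ψ) (q, e) (q', e) := by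
    ext q q'
    simp [trSnd, Matrix.sum_apply]
  ext p p'
  rw [complChannel, h, Matrix.mul_sum, Matrix.sum_mul]
  simp only [trMid, of_apply, Matrix.sum_apply, mul_mul_conjTranspose_gram]
  simp only [mul_apply, conjTranspose_apply, dilatedAmplitude, flipMat, of_apply,
    Fintype.sum_prod_type]

theorem isState_dilatedAmplitude [Fintype E] [DecidableEq Q]
    {M : Matrix Q Q ℂ →ₗ[ℂ] Matrix (S × I) (S × I) ℂ} (hM : IsCPTP M)
    {V : Matrix ((S × I) × R) Q ℂ} (hV : IsStinespring M V) {ψ : Q × E → ℂ}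
    (hψ : IsState (vecMulVec ψ (star ψ))) :
    IsState (dilatedAmplitude V ψ * (dilatedAmplitude V ψ)ᴴ) := by
  refine ⟨posSemidef_self_mul_conjTranspose _, ?_⟩
  rw [← hψ.2, ← outState_eq hV, outState]
  have h : ∀ e, (M (Matrix.of fun q q' => vecMulVec ψ (star ψ) (q, e) (q', e))).trace =
      ∑ q, vecMulVec ψ (star ψ) (q, e) (q, e) := fun e => hM.2 _
  have h2 := (Equiv.prodAssoc S I E).symm.sum_comp fun p =>
    tensorId M (vecMulVec ψ (star ψ)) p p
  refine h2.trans ?_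
  simp only [Matrix.trace, diag_apply, tensorId, of_apply] at h ⊢
  rw [Fintype.sum_prod_type_right, Fintype.sum_prod_type_right]
  exact Finset.sum_congr rfl fun e _ => h e

end Purification

end RenyiCone

theorem mainTheorem6
    {Q S I R E : Type*}
    [Fintype Q] [DecidableEq Q] [Fintype S] [DecidableEq S] [Fintype I] [DecidableEq I]
    [Fintype R] [DecidableEq R] [Fintype E] [DecidableEq E]
    (M : Matrix Q Q ℂ →ₗ[ℂ] Matrix (S × I) (S × I) ℂ) (hM : RenyiCone.IsCPTP M)
    (V : Matrix ((S × I) × R) Q ℂ) (hV : RenyiCone.IsStinespring M V)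
    (ρ : Matrix (Q × E) (Q × E) ℂ) (hρ : RenyiCone.IsPureState ρ) :
    (∀ α : ℝ≥0∞, 1 / 2 ≤ α →
      RenyiCone.sandUp α (RenyiCone.outState M ρ) =
        ⨅ τ : {τ : Matrix R R ℂ // RenyiCone.IsState τ},
          RenyiCone.sandDiv (RenyiCone.dualOrder α)
            (RenyiCone.complChannel V (RenyiCone.trSnd ρ)) ((1 : Matrix S S ℂ) ⊗ₖ τ.1)) ∧
    (∀ α : ℝ≥0∞,
      RenyiCone.sandDown α (RenyiCone.outState M ρ) =
        ⨅ τ : {τ : Matrix R R ℂ // RenyiCone.IsState τ},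
          RenyiCone.petzDiv (1 / α)
            (RenyiCone.complChannel V (RenyiCone.trSnd ρ)) ((1 : Matrix S S ℂ) ⊗ₖ τ.1)) ∧
    (∀ a : ℝ, 0 < a → a ≠ 1 →
      RenyiCone.sandDown (ENNReal.ofReal a) (RenyiCone.outState M ρ) =
        ((RenyiCone.closedForm a (RenyiCone.complChannel V (RenyiCone.trSnd ρ)) : ℝ) : EReal)) ∧
    Tendsto
      (fun a : ℝ =>
        ((RenyiCone.closedForm a (RenyiCone.complChannel V (RenyiCone.trSnd ρ)) : ℝ) : EReal))
      (𝓝[>] 0) (𝓝 (RenyiCone.sandDown 0 (RenyiCone.outState M ρ))) ∧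
    Tendsto
      (fun a : ℝ =>
        ((RenyiCone.closedForm a (RenyiCone.complChannel V (RenyiCone.trSnd ρ)) : ℝ) : EReal))
      (𝓝[≠] 1) (𝓝 (RenyiCone.sandDown 1 (RenyiCone.outState M ρ))) ∧
    Tendsto
      (fun a : ℝ =>
        ((RenyiCone.closedForm a (RenyiCone.complChannel V (RenyiCone.trSnd ρ)) : ℝ) : EReal))
      atTop (𝓝 (RenyiCone.sandDown ⊤ (RenyiCone.outState M ρ))) ∧
    (∀ α : ℝ≥0∞,
      RenyiCone.petzUp α (RenyiCone.outState M ρ) =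
        RenyiCone.sandDiv (1 / α) (RenyiCone.complChannel V (RenyiCone.trSnd ρ))
          ((1 : Matrix S S ℂ) ⊗ₖ
            RenyiCone.trFst (RenyiCone.complChannel V (RenyiCone.trSnd ρ)))) ∧
    (∀ α : ℝ≥0∞, α ≤ 2 →
      RenyiCone.petzDown α (RenyiCone.outState M ρ) =
        RenyiCone.petzDiv (2 - α) (RenyiCone.complChannel V (RenyiCone.trSnd ρ))
          ((1 : Matrix S S ℂ) ⊗ₖ
            RenyiCone.trFst (RenyiCone.complChannel V (RenyiCone.trSnd ρ)))) ∧
    ((RenyiCone.condEntropy (RenyiCone.outState M ρ) : ℝ) : EReal) =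
      (⨅ τ : {τ : Matrix R R ℂ // RenyiCone.IsState τ},
        RenyiCone.relEntropy
          (RenyiCone.complChannel V (RenyiCone.trSnd ρ)) ((1 : Matrix S S ℂ) ⊗ₖ τ.1)) ∧
    ((RenyiCone.condEntropy (RenyiCone.outState M ρ) : ℝ) : EReal) =
      RenyiCone.relEntropy (RenyiCone.complChannel V (RenyiCone.trSnd ρ))
        ((1 : Matrix S S ℂ) ⊗ₖ
          RenyiCone.trFst (RenyiCone.complChannel V (RenyiCone.trSnd ρ))) := by
  obtain ⟨hρs, ψ, rfl⟩ := hρ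
  have hΨ := RenyiCone.isState_dilatedAmplitude hM hV hρs
  -- From here on only the two marginals of one amplitude matrix occur, with B = IE and C = R.
  rw [RenyiCone.outState_eq hV, RenyiCone.complChannel_eq]
  have hinf := RenyiCone.iInf_relEntropy hΨ.flip
  have hcond := RenyiCone.condEntropy_flip (RenyiCone.dilatedAmplitude V ψ)
  refine ⟨fun α hα => RenyiCone.sandUp_eq_iInf hΨ hα, RenyiCone.sandDown_eq_iInf hΨ,
    fun a ha ha1 => RenyiCone.sandDown_ofReal hΨ ha ha1, ?_, ?_, ?_,
    RenyiCone.petzUp_eq_sandDiv hΨ, fun α hα => RenyiCone.petzDown_eq_petzDiv hΨ hα, ?_, ?_⟩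
  · rw [RenyiCone.sandDown_eq_iInf hΨ, ENNReal.div_zero one_ne_zero]
    exact RenyiCone.tendsto_closedForm_zero hΨ.flip
  · rw [RenyiCone.sandDown_eq_iInf hΨ, one_div_one]
    simp only [RenyiCone.petzDiv_one]
    exact RenyiCone.tendsto_closedForm_one hΨ.flip
  · rw [RenyiCone.sandDown_eq_iInf hΨ, ENNReal.div_top]
    exact RenyiCone.tendsto_closedForm_atTop hΨ.flip
  · rw [hinf, hcond]
  · rw [RenyiCone.relEntropy_trFst hΨ.flip, hcond]
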